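/- Let $R$ be an irreducible reduced (crystallographic) root system in an $\ell$-dimensional Euclidean space $(V,(\cdot,\cdot))$, with Weyl group $W$, simple roots $\alpha_1,\dots,\alpha_\ell$, coroots $\alpha_j^\vee=2\alpha_j/(\alpha_j,\alpha_j)$ and fundamental weights $\omega_j$, $(\omega_i,\alpha_j^\vee)=\delta_{ij}$. Let $\omega=\sum_j m_j\omega_j\neq 0$ with $m_j\in\mathbb Z_{\ge 0}$, put $\theta_j=(\omega_j,\omega)$, and let $\kappa>0$ be the greatest common divisor of the numbers $(\omega,\alpha_r)$, i.e. the positive generator of the group $\sum_r\mathbb Z(\omega,\alpha_r)$. Let $x=(x^1,\dots,x^\ell)$ be the coordinates on $V\otimes\mathbb C$ with respect to $\alpha_1^\vee,\dots,\alpha_\ell^\vee$, write $\hat{\mathbf x}=\sum_r x^r\alpha_r^\vee$, and let $(a^{ij})=((\alpha_i^\vee,\alpha_j^\vee))^{-1}$. A $\lambda$-Fourier polynomial is a linear combination of monomials $\lambda^{a_0}e^{2\pi i\sum_r a_rx^r}$ with $a_0\in\mathbb Z_{\ge0}$, $a_r\in\mathbb Z$; such a monomial has degree $a_0\kappa+\sum_r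 a_r\theta_r$. It is called invariant if, with $\lambda=e^{-2\pi i\kappa c}$, it is as a function of $c\omega+\hat{\mathbf x}$ $(c,x^r\in\mathbb R)$ invariant under the affine Weyl group $W_a(R)$ of maps $v\mapsto\sigma(v)+\sum_r k_r\alpha_r^\vee$, $\sigma\in W$, $k\in\mathbb Z^\ell$. The basic generators are $$y^j=\frac1{N_j}\sum_{\sigma\in W}\lambda^{(\omega_j-\sigma\omega_j,\,\omega)/\kappa}\,e^{2\pi i(\sigma\omega_j,\hat{\mathbf x})},\qquad N_j=\#\{\sigma\in W\mid\sigma\omega_j=\omega_j\}.$$ Let $\{z^1,\dots,z^\ell\}$ be a set of pencil generators: each $z^j$ is an invariant $\lambda$-Fourier polynomial, homogeneous of degree $\theta_j$, with $z^j|_{\lambda=0}=y^j|_{\lambda=0}$; and, with $\varphi_\lambda\colon V\otimes\mathbb C\to\mathcal M=\mathbb C^\ell$, $x\mapsto(z^1,\dots,z^\ell)$, one has for all $\lambda\in\mathbb C$ $$\frac1{4\pi^2}\sum_{r,s}\frac{\partial z^i}{\partial x^r}a^{rs}\frac{\partial z^j}{\partial x^s}=\bigl(g^{ij}+\lambda\eta^{ij}\bigr)\circ\varphi_\lambda$$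 with polynomials $g^{ij},\eta^{ij}$ on $\mathcal M$, where $\det\eta\not\equiv0$ and the contravariant Christoffel symbols of the Levi-Civita connections satisfy $\Gamma^{ij}_{g+\lambda\eta,k}=\Gamma^{ij}_{g,k}+\lambda\Gamma^{ij}_{\eta,k}$. Put $D=\{\det\eta=0\}\subset\mathcal M$, $\Sigma'=\{p\in\mathcal M\setminus D\mid\det g(p)=0\}$ and $X=\mathcal M\setminus(D\cup\Sigma')$. **Theorem.** $X$ is path connected. Near each point $p_0\in X$ the null transformation $\varphi_0$ has a local holomorphic inverse $x|_{\lambda=0}$, and the components of any such inverse are flat coordinates of $g$, in which $g$ has the components $\frac1{4\pi^2}a^{ij}$. The germ $x|_{\lambda=0}$ can be continued analytically along every loop $\gamma$ at $p_0$ in $X$; the continuation along $\gamma$ ends in $r(\gamma)\circ x|_{\lambda=0}$, where $r(\gamma)$ is an isometry of $V\otimes\mathbb C$ (a complex affine transformation whose linear part preserves the complex bilinear extension of $(\cdot,\cdot)$), and this gives a representation $r\colon\pi_1(X,p_0)\to\mathrm{Iso}(V\otimes\mathbb C)$. Moreover: 1. $r(\pi_1(X,p_0))$ consists exactly of those isometries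 of $V\otimes\mathbb C$ whose restriction to $\varphi_0^{-1}(X)$ is a deck transformation over $X$, i.e. a homeomorphism $h$ of $\varphi_0^{-1}(X)$ with $\varphi_0\circ h=\varphi_0$. 2. $r(\pi_1(X,p_0))$ is isomorphic to $\mathrm{Stab}(\omega)\ltimes\mathbb Z^\ell$, where $\mathrm{Stab}(\omega)=\{\sigma\in W\mid\sigma(\omega)=\omega\}$, in such a way that $(\sigma,k)$ corresponds to the isometry $\hat{\mathbf x}\mapsto\sigma(\hat{\mathbf x})+\sum_rk_r\alpha_r^\vee$. In particular $r(\pi_1(X,p_0))$ is isomorphic, compatibly with the actions on $V\otimes\mathbb C$, to the subgroup of all elements of $W_a(R)\cong W\ltimes\mathbb Z^\ell$ whose component in $W$ fixes $\omega$. -/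

import Mathlib

open Filter Topology
set_option linter.unusedSectionVars false

namespace AffineWeylMonodromy

noncomputable section

variable {ι V N : Type*} [NormedAddCommGroup V] [InnerProductSpace ℝ V]
  [AddCommGroup N] [Module ℝ N]

/-! ### Root systems in a Euclidean space -/

/-- The root system lives in the Euclidean space `V`: under the identification of `V` with its
dual, the coroots are `α^∨ = 2 α / (α, α)`. -/
class IsEuclidean (P : RootPairing ι ℝ V N) : Prop where
  coroot'_apply (i : ι) (v : V) :
    P.coroot' i v = 2 * inner ℝ (P.root i) v / inner ℝ (P.root i) (P.root i)

/-- The coroot `α_i^∨ = 2 α_i / (α_i, α_i)` as a vector of `V`. -/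
def corootVec (P : RootPairing ι ℝ V N) (i : ι) : V :=
  (2 / inner ℝ (P.root i) (P.root i) : ℝ) • P.root i

theorem inner_corootVec (P : RootPairing ι ℝ V N) [IsEuclidean P] (i : ι) (v : V) :
    inner ℝ v (corootVec P i) = P.coroot' i v := by
  rw [IsEuclidean.coroot'_apply, corootVec, inner_smul_right, real_inner_comm v]
  ring

instance finite_weylGroup [Finite ι] (P : RootPairing ι ℝ V N) [P.IsRootSystem] :
    Finite P.weylGroup := by
  refine Finite.of_injective (fun w : P.weylGroup => P.weylGroupToPerm w) ?_
  intro v w h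
  apply Subtype.ext
  apply RootPairing.Equiv.weightHom_injective P
  apply LinearEquiv.toLinearMap_injective
  apply LinearMap.ext_on_range (v := P.root) (RootPairing.IsRootSystem.span_root_eq_top)
  intro i
  have hv := P.weylGroup_apply_root v i
  have hw := P.weylGroup_apply_root w i
  have : P.weylGroupToPerm v = P.weylGroupToPerm w := h
  rw [this, ← hw] at hv
  exact hv

variable {P : RootPairing ι ℝ V N} [P.IsRootSystem]

/-- The fundamental weight `ω_j`, the vector of `V` with `(ω_j, α_k^∨) = δ_{jk}`. -/
def fundWeight (b : P.Base) (j : b.support) : V :=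
  P.toLinearMap.toPerfPair.symm (b.toCoweightBasis.coord j)

theorem inner_fundWeight_corootVec [DecidableEq ι] [IsEuclidean P] (b : P.Base)
    (j k : b.support) :
    inner ℝ (fundWeight b j) (corootVec P k) = if j = k then 1 else 0 := by
  rw [inner_corootVec]
  change P.toLinearMap (fundWeight b j) (P.coroot k) = _
  rw [fundWeight, LinearMap.apply_symm_toPerfPair_self, Module.Basis.coord_apply,
    RootPairing.Base.toCoweightBasis_repr_coroot, Finsupp.single_apply]
  simp [eq_comm]

/-- The weight `ω = ∑ m_j ω_j`. -/
def weight (b : P.Base) (m : b.support → ℕ) : V := ∑ j, (m j : ℝ) • fundWeight b j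

/-- `θ_j = (ω_j, ω)`. -/
def theta (b : P.Base) (m : b.support → ℕ) (j : b.support) : ℝ :=
  inner ℝ (fundWeight b j) (weight b m)

/-- `κ`, the greatest common divisor of the commensurable numbers `(ω, α_r)`, i.e. the least
positive element of the additive group which they generate. -/
def kappa (b : P.Base) (m : b.support → ℕ) : ℝ :=
  sInf {t : ℝ | 0 < t ∧
    t ∈ AddSubgroup.closure (Set.range fun r : b.support => inner ℝ (weight b m) (P.root r))}

/-! ### `λ`-Fourier polynomials

The complexification of `V` carries the coordinates `x = (x^r)` with respect to the simple
coroots, so it is modelled on `b.support → ℂ`. The `λ`-Fourier polynomials are functions of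
`λ` and `x`. -/

/-- `e^{2πi (μ, ∑ x^r α_r^∨)}`. -/
def expPair (b : P.Base) (μ : V) (x : b.support → ℂ) : ℂ :=
  Complex.exp (2 * Real.pi * Complex.I * ∑ r : b.support, (inner ℝ μ (corootVec P r) : ℂ) * x r)

/-- The basic generator
`y^j = (1/N_j) ∑_{w ∈ W} λ^{(ω_j - w ω_j, ω)/κ} e^{2πi (w ω_j, ∑ x^r α_r^∨)}`, where `N_j` is the
order of the stabilizer of `ω_j`. The exponents of `λ` are natural numbers; at
`λ = e^{-2πiκc}` this is `e^{-2πiθ_j c} (1/N_j) ∑_w e^{2πi (ω_j, w (c ω + ∑ x^r α_r^∨))}`. -/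
def basicGen (b : P.Base) (m : b.support → ℕ) (j : b.support) (lam : ℂ) (x : b.support → ℂ) : ℂ :=
  (Nat.card (MulAction.stabilizer P.weylGroup (fundWeight b j)) : ℂ)⁻¹ *
    ∑ᶠ w : P.weylGroup,
      lam ^ ((inner ℝ (fundWeight b j - w • fundWeight b j) (weight b m) / kappa b m : ℝ) : ℂ) *
        expPair b (w • fundWeight b j) x

/-- The monomial `λ^{a₀} e^{2πi ∑ a_r x^r}`. -/
def lamMonomial (b : P.Base) (a₀ : ℕ) (a : b.support → ℤ) (lam : ℂ) (x : b.support → ℂ) : ℂ :=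
  lam ^ a₀ * Complex.exp (2 * Real.pi * Complex.I * ∑ r, (a r : ℂ) * x r)

/-- The homogeneous `λ`-Fourier polynomials of degree `d`, where `deg λ = κ` and
`deg e^{2πi x^r} = θ_r`. -/
def homogeneousPart (b : P.Base) (m : b.support → ℕ) (d : ℝ) :
    Submodule ℂ (ℂ → (b.support → ℂ) → ℂ) :=
  Submodule.span ℂ {f | ∃ (a₀ : ℕ) (a : b.support → ℤ),
    a₀ * kappa b m + ∑ r, a r * theta b m r = d ∧ f = lamMonomial b a₀ a}

/-- The point `c ω + ∑ x^r α_r^∨` of `V`. -/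
def affinePoint (b : P.Base) (m : b.support → ℕ) (c : ℝ) (x : b.support → ℝ) : V :=
  c • weight b m + ∑ r, x r • corootVec P r

/-- Invariance under the affine Weyl group: with `λ = e^{-2πiκc}`, the value does not change
when the coordinates `(x; c)` of a point `v` of `V` are replaced by those of
`w v + ∑ k_r α_r^∨`, for `w` in the Weyl group and integers `k_r`. -/
def IsInvariant (b : P.Base) (m : b.support → ℕ) (f : ℂ → (b.support → ℂ) → ℂ) : Prop :=
  ∀ (c : ℝ) (x x' : b.support → ℝ) (w : P.weylGroup) (k : b.support → ℤ),
    w • affinePoint b m c x + ∑ r, (k r : ℝ) • corootVec P r = affinePoint b m c x' →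
      f (Complex.exp (-2 * Real.pi * Complex.I * kappa b m * c)) (fun r => x' r) =
        f (Complex.exp (-2 * Real.pi * Complex.I * kappa b m * c)) (fun r => x r)

/-- Proper generators: invariant `λ`-Fourier polynomials `z^j`, homogeneous of degree `θ_j`, which
agree with the basic generators at `λ = 0`. -/
def IsProperGenerators (b : P.Base) (m : b.support → ℕ)
    (z : b.support → ℂ → (b.support → ℂ) → ℂ) : Prop :=
  ∀ j, z j ∈ homogeneousPart b m (theta b m j) ∧ IsInvariant b m (z j) ∧
    ∀ x, z j 0 x = basicGen b m j 0 x

/-- The transformation `φ_λ : x ↦ (z^j)`; `φ_0` is the null transformation. -/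
def phi {J : Type*} (z : J → ℂ → (J → ℂ) → ℂ) (lam : ℂ) (x : J → ℂ) : J → ℂ :=
  fun j => z j lam x

/-! ### Contravariant metrics and flat coordinates -/

/-- The partial derivative `∂u/∂p^r`. -/
def pd {J : Type*} [Fintype J] [DecidableEq J] (u : (J → ℂ) → ℂ) (r : J) (p : J → ℂ) : ℂ :=
  fderiv ℂ u p (Pi.single r 1)

/-- The Christoffel symbols `Γ^k_{ij}` of the Levi-Civita connection of the contravariant
metric `h = (h^{ij})`; its covariant components form the inverse matrix. -/
def christoffel {J : Type*} [Fintype J] [DecidableEq J] (h : (J → ℂ) → Matrix J J ℂ)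
    (k i j : J) (p : J → ℂ) : ℂ :=
  1 / 2 * ∑ r, h p k r *
    (pd (fun q => (h q)⁻¹ i r) j p + pd (fun q => (h q)⁻¹ j r) i p - pd (fun q => (h q)⁻¹ i j) r p)

/-- The contravariant components `Γ^{ij}_k = - h^{ir} Γ^j_{rk}`. -/
def contraChristoffel {J : Type*} [Fintype J] [DecidableEq J] (h : (J → ℂ) → Matrix J J ℂ)
    (i j k : J) (p : J → ℂ) : ℂ :=
  -∑ r, h p i r * christoffel h j r k p

/-- The value at `p` of a matrix of polynomials on `ℂ^J`. -/
def metricAt {J : Type*} (g : Matrix J J (MvPolynomial J ℂ)) (p : J → ℂ) : Matrix J J ℂ :=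
  g.map (MvPolynomial.eval p)

section Metric

variable [DecidableEq ι]

/-- The matrix `(α_i^∨, α_j^∨)`. -/
def gram (b : P.Base) : Matrix b.support b.support ℝ :=
  Matrix.of fun i j => inner ℝ (corootVec P i) (corootVec P j)

/-- The constant contravariant metric `a^{ij}` on the complexification of `V`. -/
def flatMetric (b : P.Base) : Matrix b.support b.support ℂ :=
  ((gram b)⁻¹).map Complex.ofReal

/-- `g_λ^{ij} = (1/4π²) ∂z^i/∂x^r a^{rs} ∂z^j/∂x^s` as a function of `x`. -/
def pushMetric (b : P.Base) (z : b.support → ℂ → (b.support → ℂ) → ℂ) (lam : ℂ)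
    (x : b.support → ℂ) (i j : b.support) : ℂ :=
  1 / (4 * Real.pi ^ 2) * ∑ r, ∑ s, pd (z i lam) r x * flatMetric b r s * pd (z j lam) s x

/-- `z` is a set of pencil generators, with the associated pencil of metrics `g + λ η` on the
orbit space with coordinates `z^j`. -/
structure IsPencilGenerators (b : P.Base) (m : b.support → ℕ)
    (z : b.support → ℂ → (b.support → ℂ) → ℂ)
    (g η : Matrix b.support b.support (MvPolynomial b.support ℂ)) : Prop where
  proper : IsProperGenerators b m z
  linear : ∀ (lam : ℂ) (x : b.support → ℂ) (i j : b.support),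
    pushMetric b z lam x i j =
      metricAt g (phi z lam x) i j + lam * metricAt η (phi z lam x) i j
  generic : η.det ≠ 0
  levi_civita : ∀ (lam : ℂ) (p : b.support → ℂ), (metricAt g p).det ≠ 0 →
    (metricAt η p).det ≠ 0 → (metricAt g p + lam • metricAt η p).det ≠ 0 →
    ∀ i j k : b.support,
      contraChristoffel (fun q => metricAt g q + lam • metricAt η q) i j k p =
        contraChristoffel (metricAt g) i j k p + lam * contraChristoffel (metricAt η) i j k p

/-- `x = (x^i)` is, near `p₀`, a system of flat coordinates of the contravariant metric `h`
in which `h` has the constant components `(1/4π²) a^{ij}`. -/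
structure IsFlatCoordinates (b : P.Base)
    (h : (b.support → ℂ) → Matrix b.support b.support ℂ)
    (x : (b.support → ℂ) → (b.support → ℂ)) (p₀ : b.support → ℂ) : Prop where
  analyticAt : AnalyticAt ℂ x p₀
  flat : ∀ᶠ p in 𝓝 p₀, ∀ u i j : b.support,
    pd (pd (fun q => x q u) i) j p = ∑ k, christoffel h k i j p * pd (fun q => x q u) k p
  metric : ∀ᶠ p in 𝓝 p₀, ∀ i j : b.support,
    ∑ r, ∑ s, pd (fun q => x q i) r p * h p r s * pd (fun q => x q j) s p =
      1 / (4 * Real.pi ^ 2) * flatMetric b i j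

end Metric

/-- `D = {p | det η(p) = 0}`. -/
def degeneracyLocus {J : Type*} [Fintype J] [DecidableEq J]
    (η : Matrix J J (MvPolynomial J ℂ)) : Set (J → ℂ) :=
  {p | (metricAt η p).det = 0}

/-- `Σ' = {p ∉ D | det g(p) = 0}`. -/
def sigmaLocus {J : Type*} [Fintype J] [DecidableEq J]
    (g η : Matrix J J (MvPolynomial J ℂ)) : Set (J → ℂ) :=
  {p | p ∉ degeneracyLocus η ∧ (metricAt g p).det = 0}

/-- The complement of `D ∪ Σ'` in the orbit space. -/
def regularLocus {J : Type*} [Fintype J] [DecidableEq J]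
    (g η : Matrix J J (MvPolynomial J ℂ)) : Set (J → ℂ) :=
  (degeneracyLocus η ∪ sigmaLocus g η)ᶜ

/-- `x` is, near `p₀`, a branch of the coordinates `x^i|_{λ=0}` as functions of the `z^j`, i.e. a
local holomorphic inverse of the null transformation. -/
def IsNullBranch {J : Type*} [Fintype J] (z : J → ℂ → (J → ℂ) → ℂ)
    (x : (J → ℂ) → (J → ℂ)) (p₀ : J → ℂ) : Prop :=
  AnalyticAt ℂ x p₀ ∧ ∀ᶠ p in 𝓝 p₀, phi z 0 (x p) = p

/-! ### Isometries, analytic continuation and monodromy -/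

/-- The group of isometries of the complexification of `V`: complex affine transformations whose
linear part preserves the `ℂ`-bilinear extension of the inner product. -/
def complexIsometry (b : P.Base) :
    Subgroup ((b.support → ℂ) ≃ᵃ[ℂ] (b.support → ℂ)) where
  carrier := {A | ∀ x y : b.support → ℂ,
    ∑ i, ∑ j, (gram b i j : ℂ) * A.linear x i * A.linear y j =
      ∑ i, ∑ j, (gram b i j : ℂ) * x i * y j}
  one_mem' := fun _ _ => rfl
  mul_mem' := by
    intro A B hA hB x y
    exact (hA (B.linear x) (B.linear y)).trans (hB x y)
  inv_mem' := by
    intro A hA x y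
    have h := hA (A.linear.symm x) (A.linear.symm y)
    rw [LinearEquiv.apply_symm_apply, LinearEquiv.apply_symm_apply] at h
    exact h.symm

/-- `F` is an analytic continuation along the path `γ`: a family of holomorphic germs `F t` at
`γ t` such that nearby members are direct continuations of each other. -/
def IsContinuation {J : Type*} [Fintype J] (γ : unitInterval → (J → ℂ))
    (F : unitInterval → (J → ℂ) → (J → ℂ)) : Prop :=
  ∀ t, AnalyticAt ℂ (F t) (γ t) ∧ ∀ᶠ s in 𝓝 t, F s =ᶠ[𝓝 (γ s)] F t

/-- `r` is the monodromy representation on the coordinates `x`: the germ `x` has an analytic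
continuation along each loop `γ` at `p₀`, and it always comes back as `r [γ] ∘ x`. Mathlib composes
loops from right to left, so the opposite of its fundamental group is the fundamental group with
the product `[γ] [γ'] = [γ followed by γ']`. -/
def IsMonodromy {b : P.Base} {X : Set (b.support → ℂ)} {p₀ : X}
    (x : (b.support → ℂ) → (b.support → ℂ))
    (r : (FundamentalGroup X p₀)ᵐᵒᵖ →* complexIsometry b) : Prop :=
  ∀ γ : Path p₀ p₀,
    (∃ F, IsContinuation (fun t => (γ t : b.support → ℂ)) F ∧ F 0 =ᶠ[𝓝 (p₀ : b.support → ℂ)] x) ∧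
    ∀ F, IsContinuation (fun t => (γ t : b.support → ℂ)) F →
      F 0 =ᶠ[𝓝 (p₀ : b.support → ℂ)] x →
      F 1 =ᶠ[𝓝 (p₀ : b.support → ℂ)] fun p =>
        (r (MulOpposite.op (FundamentalGroup.fromPath (Path.Homotopic.Quotient.mk γ))) :
          (b.support → ℂ) ≃ᵃ[ℂ] (b.support → ℂ)) (x p)

/-- The restriction of `A` to `φ⁻¹(X)` is a deck transformation over `X`. -/
def IsDeck {J : Type*} [Fintype J] (φ : (J → ℂ) → (J → ℂ)) (X : Set (J → ℂ))
    (A : (J → ℂ) → (J → ℂ)) : Prop :=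
  ∃ h : (φ ⁻¹' X) ≃ₜ (φ ⁻¹' X), ∀ y, φ (h y) = φ y ∧ A y = h y

/-! ### The affine Weyl group -/

theorem exists_int_corootVec [P.IsCrystallographic] [IsEuclidean P] (b : P.Base)
    (i : ι) : ∃ a : b.support → ℤ, corootVec P i = ∑ j, (a j : ℝ) • corootVec P j := by
  have h := b.coroot_mem_span_int i
  rw [Set.image_eq_range, Submodule.mem_span_range_iff_exists_fun] at h
  obtain ⟨a, ha⟩ := h
  refine ⟨a, ext_inner_left ℝ fun v => ?_⟩
  rw [inner_sum, inner_corootVec]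
  change P.toLinearMap v (P.coroot i) = _
  rw [← ha, map_sum]
  refine Finset.sum_congr rfl fun j _ => ?_
  rw [inner_smul_right, inner_corootVec, map_zsmul, zsmul_eq_mul]
  rfl

theorem exists_int_smul_corootVec [P.IsCrystallographic] [IsEuclidean P] (b : P.Base)
    (w : P.weylGroup) (i : ι) :
    ∃ a : b.support → ℤ, w • corootVec P i = ∑ j, (a j : ℝ) • corootVec P j := by
  obtain ⟨w, hw⟩ := w
  suffices h : ∃ i', w • corootVec P i = corootVec P i' by
    obtain ⟨i', hi'⟩ := h
    obtain ⟨a, ha⟩ := exists_int_corootVec b i'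
    exact ⟨a, hi'.trans ha⟩
  induction hw using RootPairing.weylGroup.induction generalizing i with
  | mem k =>
    have isom : ∀ x y : V, inner ℝ (P.reflection k x) (P.reflection k y) = inner ℝ x y := by
      intro x y
      have hk : inner ℝ (P.root k) (P.root k) ≠ (0 : ℝ) := by
        simpa using P.ne_zero k
      simp only [RootPairing.reflection_apply, IsEuclidean.coroot'_apply, inner_sub_left,
        inner_sub_right, inner_smul_left, inner_smul_right, RCLike.conj_to_real]
      rw [real_inner_comm x (P.root k)]
      field_simp
      ring
    refine ⟨P.reflectionPerm k i, ?_⟩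
    rw [RootPairing.Equiv.reflection_smul, corootVec, corootVec, map_smul,
      RootPairing.root_reflectionPerm, isom]
  | one => exact ⟨i, one_smul _ _⟩
  | mul x y hx hy h₁ h₂ =>
    obtain ⟨i₁, hi₁⟩ := h₂ i
    obtain ⟨i₂, hi₂⟩ := h₁ i₁
    exact ⟨i₂, by rw [mul_smul, hi₁, hi₂]⟩

section AffineWeyl

variable [P.IsCrystallographic] [IsEuclidean P]

/-- The integer matrix of `w` in the basis of simple coroots:
`w α_k^∨ = ∑_j (weylMatrix b w j k) α_j^∨`. -/
def weylMatrix (b : P.Base) (w : P.weylGroup) : Matrix b.support b.support ℤ :=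
  Matrix.of fun j k => (exists_int_smul_corootVec b w k).choose j

theorem smul_corootVec (b : P.Base) (w : P.weylGroup) (k : b.support) :
    w • corootVec P k = ∑ j, (weylMatrix b w j k : ℝ) • corootVec P j :=
  (exists_int_smul_corootVec b w k).choose_spec

theorem corootVec_coeff_unique (b : P.Base) {a a' : b.support → ℝ}
    (h : ∑ j, a j • corootVec P (j : ι) = ∑ j, a' j • corootVec P (j : ι)) : a = a' := by
  classical
  funext k
  have := congrArg (fun v => inner ℝ (fundWeight b k) v) h
  simpa [inner_sum, inner_smul_right, inner_fundWeight_corootVec] using this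

theorem weylMatrix_one [DecidableEq ι] (b : P.Base) : weylMatrix b 1 = 1 := by
  ext j k
  have h := smul_corootVec b 1 k
  rw [one_smul] at h
  have h' : ∑ j, ((1 : Matrix b.support b.support ℤ) j k : ℝ) • corootVec P (j : ι) =
      ∑ j, (weylMatrix b 1 j k : ℝ) • corootVec P (j : ι) := by
    rw [← h]
    simp [Matrix.one_apply, ite_smul]
  exact_mod_cast (congrFun (corootVec_coeff_unique b h') j).symm

theorem weylMatrix_mul (b : P.Base) (v w : P.weylGroup) :
    weylMatrix b (v * w) = weylMatrix b v * weylMatrix b w := by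
  ext j k
  have h : ∑ j, (weylMatrix b (v * w) j k : ℝ) • corootVec P (j : ι) =
      ∑ j, ((weylMatrix b v * weylMatrix b w) j k : ℝ) • corootVec P (j : ι) := by
    rw [← smul_corootVec, mul_smul, smul_corootVec, Finset.smul_sum]
    simp_rw [smul_comm v, smul_corootVec, Finset.smul_sum, Matrix.mul_apply, Int.cast_sum,
      Int.cast_mul, Finset.sum_smul, smul_smul]
    rw [Finset.sum_comm]
    simp_rw [mul_comm]
  exact_mod_cast congrFun (corootVec_coeff_unique b h) j

/-- The affine transformation `x ↦ w x + ∑ k_r α_r^∨` of the complexification of `V`, in the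
coordinates with respect to the simple coroots. -/
def affineMap (b : P.Base) (k : b.support → ℤ) (w : P.weylGroup) (x : b.support → ℂ) :
    b.support → ℂ :=
  fun j => ∑ i, (weylMatrix b w j i : ℂ) * x i + k j

variable [DecidableEq ι]

/-- The action of the Weyl group on the coroot lattice, identified with `ℤ^ℓ` through the basis
of simple coroots. -/
def latticeAction (b : P.Base) : P.weylGroup →* MulAut (Multiplicative (b.support → ℤ)) where
  toFun w := AddEquiv.toMultiplicative
    { toFun := fun k => (weylMatrix b w).mulVec k
      invFun := fun k => (weylMatrix b w⁻¹).mulVec k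
      left_inv := fun k => by
        beta_reduce
        rw [Matrix.mulVec_mulVec, ← weylMatrix_mul, inv_mul_cancel, weylMatrix_one,
          Matrix.one_mulVec]
      right_inv := fun k => by
        beta_reduce
        rw [Matrix.mulVec_mulVec, ← weylMatrix_mul, mul_inv_cancel, weylMatrix_one,
          Matrix.one_mulVec]
      map_add' := fun k l => Matrix.mulVec_add _ k l }
  map_one' := by
    ext k : 1
    change Multiplicative.ofAdd ((weylMatrix b 1).mulVec k.toAdd) = k
    rw [weylMatrix_one, Matrix.one_mulVec]
    rfl
  map_mul' v w := by
    ext k : 1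
    change Multiplicative.ofAdd ((weylMatrix b (v * w)).mulVec k.toAdd) =
      Multiplicative.ofAdd ((weylMatrix b v).mulVec ((weylMatrix b w).mulVec k.toAdd))
    rw [weylMatrix_mul, Matrix.mulVec_mulVec]

/-- The affine Weyl group, as the semidirect product of the coroot lattice `ℤ^ℓ` and the Weyl
group. -/
abbrev AffineWeylGroup (b : P.Base) : Type _ :=
  SemidirectProduct (Multiplicative (b.support → ℤ)) P.weylGroup (latticeAction b)

/-- The semidirect product of the coroot lattice `ℤ^ℓ` and the stabilizer of the weight `ω` in the
Weyl group. -/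
abbrev StabAffineGroup (b : P.Base) (m : b.support → ℕ) : Type _ :=
  SemidirectProduct (Multiplicative (b.support → ℤ))
    (MulAction.stabilizer P.weylGroup (weight b m))
    ((latticeAction b).comp (MulAction.stabilizer P.weylGroup (weight b m)).subtype)

end AffineWeyl

end

end AffineWeylMonodromy

open AffineWeylMonodromy

namespace AffineWeylMonodromy

noncomputable section

variable {ι V N : Type*} [NormedAddCommGroup V] [InnerProductSpace ℝ V]
  [AddCommGroup N] [Module ℝ N] {P : RootPairing ι ℝ V N}

/-! ### The Weyl group as a group of isometries -/

/-! At λ = 0 only the terms of y^j with (ω_j - wω_j, ω) = 0 survive (`basicGen_zero`), so φ_0 is the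
explicit map `nullMap`, invariant under G = Stab(ω) ⋉ ℤ^ℓ. The theorem follows once φ_0 is known to
restrict over X to a regular covering with group G (`isQuotientCoveringMap_nullCovering`) and path
connected total space. A branch x|_{λ=0} is a local section of this covering; its continuation along
a loop follows the lift of the loop, so it ends in s ∘ x for the deck transformation s that moves
the start of the lift to its end. Connectedness of the total space makes every s in G occur.

Three facts give the covering.

The fibres are G-orbits (`exists_affineMap_of_nullMap_eq`). The main tool is that every
Stab(ω)-invariant exponential polynomial is a function of φ_0, continuous where the coordinates p_j
with m_j ≠ 0 do not vanish (`mem_pullbackAlg_of_invariant`). This is a triangularity argument in the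
style of Chevalley and Bourbaki: a monomial in the generators has a leading exponential, all its
other weights are smaller for the dominance order of Stab(ω), and its coefficients are nonnegative,
so nothing cancels. The order rests on the fact that v - wv is a nonnegative combination of simple
roots for dominant v (`inner_fundWeight_sub_smul_nonneg`).

The action over X is free. By the formula for the metric at λ = 0, det g ∘ φ_0 is a nonzero constant
times the square of the Jacobian determinant of φ_0, so φ_0 is locally biholomorphic over X.
Differentiating φ_0 ∘ s = φ_0 at a fixed point then forces s = 1 (`eq_one_of_stabMap_eq`).

The image of φ_0 contains X (`regularLocus_subset_range`). It meets X in an open set because the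
Jacobian is invertible there. It is closed in the locus p_k ≠ 0 (m_k ≠ 0) because the exponentials
are roots of monic polynomials with invariant coefficients, hence bounded in terms of φ_0. And X
lies in that locus because column k of g is divisible by p_k (`metric_column_eq`). Both X and its
preimage are nonvanishing loci of nonzero entire functions, hence path connected
(`isPathConnected_ne_zero`); nonvanishing comes from an asymptotic computation of the Jacobian
(`exists_det_nullJacobian_ne_zero`). -/

theorem inner_root_self_pos (P : RootPairing ι ℝ V N) (i : ι) :
    0 < (inner ℝ (P.root i) (P.root i) : ℝ) :=
  real_inner_self_pos.2 (P.ne_zero i)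

theorem reflection_eq [IsEuclidean P] (i : ι) (v : V) :
    P.reflection i v = v - (inner ℝ v (corootVec P i) : ℝ) • P.root i := by
  rw [RootPairing.reflection_apply, inner_corootVec]

/-- The inner product as an invariant form. -/
def innerForm (P : RootPairing ι ℝ V N) [IsEuclidean P] : P.InvariantForm where
  form := innerₗ V
  symm := ⟨fun x y => real_inner_comm y x⟩
  ne_zero i := (inner_root_self_pos P i).ne'
  isOrthogonal_reflection i x y := by
    have hk := (inner_root_self_pos P i).ne'
    simp only [innerₗ_apply_apply, RootPairing.reflection_apply, IsEuclidean.coroot'_apply,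
      inner_sub_left, inner_sub_right, inner_smul_left, inner_smul_right, RCLike.conj_to_real]
    rw [real_inner_comm x (P.root i)]
    field_simp
    ring

theorem inner_smul_smul [IsEuclidean P] (w : P.weylGroup) (x y : V) :
    (inner ℝ (w • x) (w • y) : ℝ) = inner ℝ x y :=
  RootPairing.InvariantForm.apply_weylGroup_smul P (B := innerForm P) w x y

theorem inner_smul_left_eq [IsEuclidean P] (w : P.weylGroup) (x y : V) :
    (inner ℝ (w • x) y : ℝ) = inner ℝ x (w⁻¹ • y) := by
  rw [← inner_smul_smul w x, smul_inv_smul]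

theorem norm_weyl_smul [IsEuclidean P] (w : P.weylGroup) (x : V) : ‖w • x‖ = ‖x‖ := by
  rw [norm_eq_sqrt_real_inner, norm_eq_sqrt_real_inner, inner_smul_smul]

theorem weylGroup_ext {w w' : P.weylGroup} (h : ∀ v : V, w • v = w' • v) : w = w' := by
  apply Subtype.ext
  apply RootPairing.Equiv.weightHom_injective P
  exact LinearEquiv.ext h

theorem ofIdx_smul_eq [IsEuclidean P] (i : ι) (v : V) :
    RootPairing.weylGroup.ofIdx P i • v = v - (inner ℝ v (corootVec P i) : ℝ) • P.root i := by
  rw [RootPairing.weylGroup.ofIdx_smul, RootPairing.Equiv.reflection_smul, reflection_eq]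

theorem inner_root_corootVec_self (P : RootPairing ι ℝ V N) (i : ι) :
    (inner ℝ (P.root i) (corootVec P i) : ℝ) = 2 := by
  rw [corootVec, inner_smul_right]
  exact div_mul_cancel₀ _ (inner_root_self_pos P i).ne'

theorem ofIdx_mul_self [IsEuclidean P] (i : ι) :
    RootPairing.weylGroup.ofIdx P i * RootPairing.weylGroup.ofIdx P i = 1 := by
  refine weylGroup_ext fun v => ?_
  rw [mul_smul, one_smul, ofIdx_smul_eq, ofIdx_smul_eq, inner_sub_left, inner_smul_left,
    inner_root_corootVec_self]
  simp only [RCLike.conj_to_real]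
  module

theorem weyl_smul_corootVec [IsEuclidean P] (w : P.weylGroup) {i j : ι}
    (h : w • P.root i = P.root j) : w • corootVec P i = corootVec P j := by
  rw [corootVec, corootVec, ← h, inner_smul_smul, smul_comm]

/-- Conjugation of reflections: if `w α_i = α_j`, then `w s_i = s_j w`. -/
theorem mul_ofIdx [IsEuclidean P] (w : P.weylGroup) {i j : ι}
    (h : w • P.root i = P.root j) :
    w * RootPairing.weylGroup.ofIdx P i = RootPairing.weylGroup.ofIdx P j * w := by
  refine weylGroup_ext fun v => ?_
  rw [mul_smul, mul_smul, ofIdx_smul_eq, ofIdx_smul_eq, ← weyl_smul_corootVec w h,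
    inner_smul_smul, smul_sub, smul_comm w, h]

/-! ### Words in the simple reflections -/

/-- The product of the simple reflections with the given indices. -/
def simpleWord (b : P.Base) (L : List b.support) : P.weylGroup :=
  (L.map fun i : b.support => RootPairing.weylGroup.ofIdx P (i : ι)).prod

variable [Finite ι] [P.IsCrystallographic] [P.IsReduced] [IsEuclidean P]

/-- Every root is reached from simple roots by negation and simple reflections; negation leaves the
reflection unchanged, and a simple reflection conjugates it. -/
theorem exists_simpleWord (b : P.Base) (w : P.weylGroup) : ∃ L, simpleWord b L = w := by
  have key : ∀ i : ι, ∃ L, simpleWord b L = RootPairing.weylGroup.ofIdx P i := by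
    intro i
    have conj : ∀ j i : ι, RootPairing.weylGroup.ofIdx P (P.reflectionPerm j i) =
        RootPairing.weylGroup.ofIdx P j * RootPairing.weylGroup.ofIdx P i *
          RootPairing.weylGroup.ofIdx P j := by
      intro j i
      rw [mul_ofIdx (RootPairing.weylGroup.ofIdx P j) (i := i) (j := P.reflectionPerm j i),
        mul_assoc, ofIdx_mul_self, mul_one]
      rw [RootPairing.weylGroup.ofIdx_smul, RootPairing.Equiv.reflection_smul,
        RootPairing.root_reflectionPerm]
    refine b.induction_reflect i (p := fun i => ∃ L, simpleWord b L =
      RootPairing.weylGroup.ofIdx P i) ?_ ?_ ?_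
    · rintro i ⟨L, hL⟩
      exact ⟨L, by rw [conj, ofIdx_mul_self, one_mul, hL]⟩
    · intro i hi
      exact ⟨[⟨i, hi⟩], by simp [simpleWord]⟩
    · rintro i j ⟨L, hL⟩ hj
      refine ⟨[⟨j, hj⟩] ++ L ++ [⟨j, hj⟩], ?_⟩
      rw [conj, ← hL]
      simp [simpleWord, mul_assoc]
  obtain ⟨w, hw⟩ := w
  induction hw using RootPairing.weylGroup.induction with
  | mem i => exact key i
  | one => exact ⟨[], rfl⟩
  | mul x y hx hy h₁ h₂ =>
    obtain ⟨L₁, h₁⟩ := h₁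
    obtain ⟨L₂, h₂⟩ := h₂
    refine ⟨L₁ ++ L₂, ?_⟩
    rw [simpleWord, List.map_append, List.prod_append]
    change simpleWord b L₁ * simpleWord b L₂ = _
    rw [h₁, h₂]
    rfl

/-- A simple reflection s_i permutes the positive roots other than α_i. So the letter s_i at which
the image of α_j turns negative meets it exactly at α_i, and conjugation turns s_i w' s_j into w',
which deletes that letter. The new word is shorter than `L` itself, as the induction on length below
requires. -/
theorem exchange (b : P.Base) (L : List b.support) (j : b.support)
    (h : ¬ b.IsPos (P.weylGroupToPerm (simpleWord b L) j)) :
    ∃ L' : List b.support, L'.length < L.length ∧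
      simpleWord b L * RootPairing.weylGroup.ofIdx P j = simpleWord b L' := by
  induction L with
  | nil =>
    refine absurd (RootPairing.Base.isPos_of_mem_support j.2) ?_
    convert h using 2
    simp [simpleWord]
  | cons i L ih =>
    have hcons : simpleWord b (i :: L) = RootPairing.weylGroup.ofIdx P i * simpleWord b L := by
      simp [simpleWord]
    by_cases hL : b.IsPos (P.weylGroupToPerm (simpleWord b L) j)
    · have hi : P.weylGroupToPerm (simpleWord b L) j = i := by
        by_contra hne
        apply h
        have := hL.reflectionPerm i.2 hne
        convert this using 1
        apply P.root.injective
        rw [← RootPairing.weylGroup_apply_root, hcons, mul_smul, RootPairing.weylGroup_apply_root,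
          RootPairing.root_reflectionPerm, RootPairing.weylGroup.ofIdx_smul,
          RootPairing.Equiv.reflection_smul]
      refine ⟨L, by simp, ?_⟩
      rw [hcons, mul_assoc, mul_ofIdx (simpleWord b L) (i := j) (j := i), ← mul_assoc,
        ofIdx_mul_self, one_mul]
      rw [RootPairing.weylGroup_apply_root, hi]
    · obtain ⟨L', hlen, hL'⟩ := ih hL
      refine ⟨i :: L', by simpa using hlen, ?_⟩
      rw [hcons, mul_assoc, hL']
      simp [simpleWord]

/-! ### Dual bases and dominance -/

variable [P.IsRootSystem] [DecidableEq ι]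

theorem inner_fundWeight_root (b : P.Base) (j k : b.support) :
    (inner ℝ (fundWeight b j) (P.root k) : ℝ) =
      if j = k then inner ℝ (P.root k) (P.root k) / 2 else 0 := by
  have h := inner_fundWeight_corootVec b j k
  have hk := (inner_root_self_pos P k).ne'
  rw [corootVec, inner_smul_right] at h
  split_ifs at h ⊢ with hjk
  · field_simp at h
    field_simp
    linarith
  · exact (mul_eq_zero.1 h).resolve_left (div_ne_zero two_ne_zero hk)

theorem IsPos.inner_fundWeight_nonneg (b : P.Base) {i : ι} (hi : b.IsPos i) (k : b.support) :
    0 ≤ (inner ℝ (fundWeight b k) (P.root i) : ℝ) := by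
  refine hi.induction_on_add (p := fun i => 0 ≤ (inner ℝ (fundWeight b k) (P.root i) : ℝ)) ?_ ?_
  · intro i hi
    rw [inner_fundWeight_root b k ⟨i, hi⟩]
    have := inner_root_self_pos P i
    split_ifs <;> positivity
  · intro i j l hl hi hj
    rw [hl, inner_add_right, inner_fundWeight_root b k ⟨j, hj⟩]
    have := inner_root_self_pos P j
    split_ifs
    · positivity
    · simpa using hi

/-- Dominance of v over its orbit: with w = w₁s_i one has v - wv = (v - w₁v) + (v, α_i^∨) w₁α_i. If
w₁α_i is positive both terms are nonnegative; otherwise `exchange` replaces the word by a shorter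
one. -/
theorem inner_fundWeight_sub_smul_nonneg (b : P.Base) {v : V}
    (hv : ∀ i : b.support, 0 ≤ (inner ℝ v (corootVec P i) : ℝ)) (w : P.weylGroup)
    (k : b.support) : 0 ≤ (inner ℝ (fundWeight b k) (v - w • v) : ℝ) := by
  obtain ⟨L, rfl⟩ := exists_simpleWord b w
  induction hn : L.length using Nat.strong_induction_on generalizing L with
  | _ n ih =>
    rcases L.eq_nil_or_concat with rfl | ⟨L₁, i, rfl⟩
    · simp [simpleWord]
    have hcat : simpleWord b (L₁ ++ [i]) =
        simpleWord b L₁ * RootPairing.weylGroup.ofIdx P i := by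
      simp [simpleWord]
    rw [List.concat_eq_append, List.length_append, List.length_singleton] at hn
    rw [List.concat_eq_append, hcat]
    by_cases hL : b.IsPos (P.weylGroupToPerm (simpleWord b L₁) i)
    · rw [mul_smul, ofIdx_smul_eq, smul_sub, smul_comm, RootPairing.weylGroup_apply_root,
        ← sub_add, inner_add_right, inner_smul_right]
      have h₁ := ih _ (by omega) L₁ rfl
      have h₂ := hv i
      have h₃ := IsPos.inner_fundWeight_nonneg b hL k
      positivity
    · obtain ⟨L', hlen, hL'⟩ := exchange b L₁ i hL
      rw [hL']
      exact ih _ (by omega) L' rfl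

end

end AffineWeylMonodromy

namespace AffineWeylMonodromy

noncomputable section

variable {ι V N : Type*} [NormedAddCommGroup V] [InnerProductSpace ℝ V]
  [AddCommGroup N] [Module ℝ N] {P : RootPairing ι ℝ V N} [P.IsRootSystem] [DecidableEq ι]
  [IsEuclidean P]

/-! ### Pairings of weights with roots and coroots -/

theorem inner_fundWeight_corootVec_nonneg (b : P.Base) (j k : b.support) :
    0 ≤ (inner ℝ (fundWeight b j) (corootVec P k) : ℝ) := by
  rw [inner_fundWeight_corootVec]
  split_ifs <;> norm_num

theorem inner_weight_corootVec (b : P.Base) (m : b.support → ℕ) (k : b.support) :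
    (inner ℝ (weight b m) (corootVec P k) : ℝ) = m k := by
  simp [weight, sum_inner, inner_smul_left, inner_fundWeight_corootVec]

theorem root_eq_smul_corootVec (i : ι) :
    P.root i = ((inner ℝ (P.root i) (P.root i) : ℝ) / 2) • corootVec P i := by
  have h := (inner_root_self_pos P i).ne'
  rw [corootVec, smul_smul, div_mul_div_comm, mul_comm, div_self (by positivity), one_smul]

theorem inner_root_eq (v : V) (i : ι) :
    (inner ℝ v (P.root i) : ℝ) =
      (inner ℝ (P.root i) (P.root i) : ℝ) / 2 * inner ℝ v (corootVec P i) := by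
  conv_lhs => rw [root_eq_smul_corootVec i, inner_smul_right]

theorem ofIdx_smul_weight (b : P.Base) (m : b.support → ℕ) {i : b.support} (hi : m i = 0) :
    RootPairing.weylGroup.ofIdx P (i : ι) • weight b m = weight b m := by
  rw [ofIdx_smul_eq, inner_weight_corootVec, hi]
  simp

/-! ### Dual bases and the rigidity of weights that pair maximally with ω -/

section DualBases

variable [Finite ι] [P.IsCrystallographic] [P.IsReduced]

/-- The simple coroots and the fundamental weights are dual bases. -/
theorem sum_inner_fundWeight_smul_corootVec (b : P.Base) (v : V) :
    ∑ k : b.support, (inner ℝ (fundWeight b k) v : ℝ) • corootVec P k = v := by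
  conv_rhs => rw [← b.toWeightBasis.sum_repr v]
  refine Finset.sum_congr rfl fun k _ => ?_
  have hk : (inner ℝ (fundWeight b k) v : ℝ) =
      b.toWeightBasis.repr v k * (inner ℝ (P.root k) (P.root k) / 2) := by
    conv_lhs => rw [← b.toWeightBasis.sum_repr v]
    simp [inner_sum, inner_smul_right, inner_fundWeight_root]
  rw [hk, mul_smul, ← root_eq_smul_corootVec, RootPairing.Base.toWeightBasis_apply]

theorem inner_eq_sum (b : P.Base) (u v : V) :
    (inner ℝ u v : ℝ) =
      ∑ k : b.support, inner ℝ u (corootVec P k) * inner ℝ (fundWeight b k) v := by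
  conv_lhs => rw [← sum_inner_fundWeight_smul_corootVec b v]
  simp [inner_sum, inner_smul_right, mul_comm]

theorem sum_inner_corootVec_smul_fundWeight (b : P.Base) (v : V) :
    ∑ k : b.support, (inner ℝ v (corootVec P k) : ℝ) • fundWeight b k = v := by
  refine ext_inner_right ℝ fun u => ?_
  rw [inner_eq_sum b v u]
  simp [sum_inner, inner_smul_left]

theorem eq_zero_of_inner_fundWeight (b : P.Base) {v : V}
    (h : ∀ k, (inner ℝ (fundWeight b k) v : ℝ) = 0) : v = 0 := by
  rw [← sum_inner_fundWeight_smul_corootVec b v]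
  simp [h]

theorem inner_weight_eq_sum (b : P.Base) (m : b.support → ℕ) (v : V) :
    (inner ℝ (weight b m) v : ℝ) = ∑ k, m k * inner ℝ (fundWeight b k) v := by
  simp [weight, sum_inner, inner_smul_left]

/-- If `w` does not lower the pairing of `ω_j` with `ω`, then `ω_j - w ω_j` is a combination of
the simple roots orthogonal to `ω`. -/
theorem inner_fundWeight_sub_smul_eq_zero (b : P.Base) (m : b.support → ℕ) {j : b.support}
    {w : P.weylGroup} (h : (inner ℝ (fundWeight b j - w • fundWeight b j) (weight b m) : ℝ) = 0)
    {k : b.support} (hk : m k ≠ 0) :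
    (inner ℝ (fundWeight b k) (fundWeight b j - w • fundWeight b j) : ℝ) = 0 := by
  have hnn := inner_fundWeight_sub_smul_nonneg b
    (fun i => inner_fundWeight_corootVec_nonneg b j i) w
  rw [real_inner_comm, inner_weight_eq_sum, Finset.sum_eq_zero_iff_of_nonneg
    (fun k _ => mul_nonneg (Nat.cast_nonneg _) (hnn k))] at h
  exact (mul_eq_zero.1 (h k (Finset.mem_univ k))).resolve_left (Nat.cast_ne_zero.2 hk)

/-- Since m_j ≠ 0, the difference ω_j - wω_j is orthogonal to ω_j; as w preserves norms, this is the
equality case of Cauchy–Schwarz. -/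
theorem smul_fundWeight_eq_self (b : P.Base) (m : b.support → ℕ) {j : b.support}
    (hj : m j ≠ 0) {w : P.weylGroup}
    (h : (inner ℝ (fundWeight b j - w • fundWeight b j) (weight b m) : ℝ) = 0) :
    w • fundWeight b j = fundWeight b j := by
  have h₀ := inner_fundWeight_sub_smul_eq_zero b m h hj
  have h₁ := norm_sub_sq_real (fundWeight b j) (w • fundWeight b j)
  rw [norm_weyl_smul] at h₁
  rw [inner_sub_right, real_inner_self_eq_norm_sq] at h₀
  have h₂ : ‖fundWeight b j - w • fundWeight b j‖ ^ 2 = 0 := by linarith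
  exact (sub_eq_zero.1 (norm_eq_zero.1 (pow_eq_zero_iff two_ne_zero |>.1 h₂))).symm

theorem stabilizer_smul_fundWeight (b : P.Base) (m : b.support → ℕ) {j : b.support}
    (hj : m j ≠ 0) {w : P.weylGroup} (hw : w • weight b m = weight b m) :
    w • fundWeight b j = fundWeight b j := by
  refine smul_fundWeight_eq_self b m hj ?_
  rw [inner_sub_left, inner_smul_left_eq, inv_smul_eq_iff.2 hw.symm, sub_self]

/-! ### The weight lattice -/

/-- The weight lattice. -/
def weightLattice (b : P.Base) : AddSubgroup V where
  carrier := {μ | ∀ r : b.support, ∃ n : ℤ, (inner ℝ μ (corootVec P r) : ℝ) = n}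
  zero_mem' r := ⟨0, by simp⟩
  add_mem' {μ ν} hμ hν r := by
    obtain ⟨a, ha⟩ := hμ r
    obtain ⟨c, hc⟩ := hν r
    exact ⟨a + c, by rw [inner_add_left, ha, hc]; push_cast; rfl⟩
  neg_mem' {μ} hμ r := by
    obtain ⟨a, ha⟩ := hμ r
    exact ⟨-a, by rw [inner_neg_left, ha]; push_cast; rfl⟩

theorem fundWeight_mem_weightLattice (b : P.Base) (j : b.support) :
    fundWeight b j ∈ weightLattice b := fun r =>
  ⟨if j = r then 1 else 0, by rw [inner_fundWeight_corootVec]; split_ifs <;> simp⟩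

theorem smul_mem_weightLattice (b : P.Base) (w : P.weylGroup) {μ : V}
    (hμ : μ ∈ weightLattice b) : w • μ ∈ weightLattice b := by
  intro r
  obtain ⟨a, ha⟩ := exists_int_smul_corootVec b w⁻¹ r
  choose n hn using hμ
  refine ⟨∑ j, a j * n j, ?_⟩
  rw [inner_smul_left_eq, ha, inner_sum]
  simp [inner_smul_right, hn]

/-- The coordinates of a weight in the basis of fundamental weights are integers, bounded by
Cauchy–Schwarz. The finiteness makes the induction on norms in `stabSum_mem_pullbackAlg` well
founded. -/
theorem finite_weightLattice_inter (b : P.Base) (R : ℝ) :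
    {μ | μ ∈ weightLattice b ∧ ‖μ‖ ≤ R}.Finite := by
  let C : b.support → ℤ := fun r => ⌈R * ‖corootVec P (r : ι)‖⌉
  have hfin : (Set.univ.pi fun r => Set.Icc (-C r) (C r)).Finite :=
    Set.Finite.pi fun r => Set.finite_Icc _ _
  refine (hfin.image fun n => ∑ r, (n r : ℝ) • fundWeight b r).subset ?_
  rintro μ ⟨hμ, hR⟩
  choose n hn using hμ
  refine ⟨n, fun r _ => ?_, ?_⟩
  · have h₁ := abs_le.1 ((abs_real_inner_le_norm μ (corootVec P (r : ι))).trans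
      (mul_le_mul_of_nonneg_right hR (norm_nonneg _)))
    have h₂ := Int.le_ceil (R * ‖corootVec P (r : ι)‖)
    rw [hn] at h₁
    constructor
    · have : (-(C r : ℤ) : ℝ) ≤ n r := by linarith [h₁.1]
      exact_mod_cast this
    · have : (n r : ℝ) ≤ (C r : ℤ) := h₁.2.trans h₂
      exact_mod_cast this
  · simp only [← hn]
    exact sum_inner_corootVec_smul_fundWeight b μ

/-- Take w in the stabilizer maximizing (wμ, ρ), with ρ the sum of the fundamental weights. If (wμ,
α_i^∨) were negative for some i with m_i = 0, then s_i, which fixes ω, would increase this value. -/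
theorem exists_stabilizer_smul_dominant (b : P.Base) (m : b.support → ℕ) (μ : V) :
    ∃ w : P.weylGroup, w • weight b m = weight b m ∧
      ∀ i, m i = 0 → 0 ≤ (inner ℝ (w • μ) (corootVec P i) : ℝ) := by
  obtain ⟨w, hw, hmax⟩ := Set.exists_max_image
    {w : P.weylGroup | w • weight b m = weight b m}
    (fun w => (inner ℝ (w • μ) (∑ k, fundWeight b k) : ℝ)) (Set.toFinite _)
    ⟨1, one_smul _ _⟩
  refine ⟨w, hw, fun i hi => ?_⟩
  have h := hmax (RootPairing.weylGroup.ofIdx P (i : ι) * w) (by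
    change (_ * _) • _ = _
    rw [mul_smul, (hw : _ • _ = _), ofIdx_smul_weight b m hi])
  have hρ : (inner ℝ (P.root i) (∑ k, fundWeight b k) : ℝ) =
      inner ℝ (P.root i) (P.root i) / 2 := by
    rw [real_inner_comm]
    simp [sum_inner, inner_fundWeight_root]
  rw [mul_smul, ofIdx_smul_eq, inner_sub_left, real_inner_smul_left, hρ] at h
  have := inner_root_self_pos P (i : ι)
  by_contra! hneg
  nlinarith

/-- The lengths of the roots are commensurable, so that `κ` is positive. -/
theorem kappa_pos [P.IsIrreducible] (b : P.Base) (m : b.support → ℕ) (hm : m ≠ 0) :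
    0 < kappa b m := by
  obtain ⟨s, hs⟩ := Function.ne_iff.1 hm
  have hs : m s ≠ 0 := hs
  -- Ratios of squared root lengths lie in {1, 2, 3, 1/2, 1/3}, so each (α_r, α_r)/2 is an integer
  -- multiple of (α_s, α_s)/12; hence so is each (ω, α_r), and κ ≥ d.
  set d : ℝ := (inner ℝ (P.root s) (P.root s) : ℝ) / 12 with hd
  have hd₀ : 0 < d := div_pos (inner_root_self_pos P s) (by norm_num)
  have hle : AddSubgroup.closure
      (Set.range fun r : b.support => (inner ℝ (weight b m) (P.root r) : ℝ)) ≤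
      AddSubgroup.zmultiples d := by
    rw [AddSubgroup.closure_le]
    rintro _ ⟨r, rfl⟩
    have key : ∃ n : ℤ, (inner ℝ (P.root r) (P.root r) : ℝ) / 2 = n * d := by
      have h := (innerForm P).apply_eq_or r s
      change (inner ℝ (P.root r) (P.root r) : ℝ) = inner ℝ (P.root s) (P.root s) ∨
        (inner ℝ (P.root r) (P.root r) : ℝ) = 2 * inner ℝ (P.root s) (P.root s) ∨
        (inner ℝ (P.root r) (P.root r) : ℝ) = 3 * inner ℝ (P.root s) (P.root s) ∨
        (inner ℝ (P.root s) (P.root s) : ℝ) = 2 * inner ℝ (P.root r) (P.root r) ∨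
        (inner ℝ (P.root s) (P.root s) : ℝ) = 3 * inner ℝ (P.root r) (P.root r) at h
      rcases h with h | h | h | h | h
      · exact ⟨6, by push_cast; linarith⟩
      · exact ⟨12, by push_cast; linarith⟩
      · exact ⟨18, by push_cast; linarith⟩
      · exact ⟨3, by push_cast; linarith⟩
      · exact ⟨2, by push_cast; linarith⟩
    obtain ⟨n, hn⟩ := key
    refine ⟨n * m r, ?_⟩
    change _ = (inner ℝ (weight b m) (P.root r) : ℝ)
    rw [inner_root_eq, inner_weight_corootVec, hn]
    simp only [zsmul_eq_mul]
    push_cast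
    ring
  refine hd₀.trans_le (le_csInf ⟨inner ℝ (weight b m) (P.root s), ?_,
    AddSubgroup.subset_closure ⟨s, rfl⟩⟩ ?_)
  · rw [inner_root_eq, inner_weight_corootVec]
    have := inner_root_self_pos P (s : ι)
    positivity
  · rintro t ⟨ht, htm⟩
    obtain ⟨n, rfl⟩ := hle htm
    simp only [zsmul_eq_mul] at ht ⊢
    have hn : 0 < n := by exact_mod_cast (pos_iff_pos_of_mul_pos ht).2 hd₀
    have : (1 : ℝ) ≤ n := by exact_mod_cast hn
    nlinarith

end DualBases

end

end AffineWeylMonodromy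

namespace AffineWeylMonodromy

noncomputable section

variable {ι V N : Type*} [NormedAddCommGroup V] [InnerProductSpace ℝ V]
  [AddCommGroup N] [Module ℝ N] {P : RootPairing ι ℝ V N}

/-! ### Exponentials -/

theorem expPair_zero (b : P.Base) (x : b.support → ℂ) : expPair b 0 x = 1 := by
  simp [expPair]

theorem expPair_add (b : P.Base) (μ ν : V) (x : b.support → ℂ) :
    expPair b (μ + ν) x = expPair b μ x * expPair b ν x := by
  simp only [expPair, ← Complex.exp_add, inner_add_left, Complex.ofReal_add, add_mul,
    Finset.sum_add_distrib, mul_add]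

theorem expPair_neg (b : P.Base) (μ : V) (x : b.support → ℂ) :
    expPair b (-μ) x = (expPair b μ x)⁻¹ :=
  eq_inv_of_mul_eq_one_left (by rw [← expPair_add, neg_add_cancel, expPair_zero])

theorem expPair_nsmul (b : P.Base) (μ : V) (n : ℕ) (x : b.support → ℂ) :
    expPair b (n • μ) x = expPair b μ x ^ n := by
  induction n with
  | zero => simp [expPair_zero]
  | succ n ih => rw [succ_nsmul, expPair_add, ih, pow_succ]

theorem expPair_zsmul (b : P.Base) (μ : V) (n : ℤ) (x : b.support → ℂ) :
    expPair b (n • μ) x = expPair b μ x ^ n := by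
  cases n with
  | ofNat n => simp [expPair_nsmul]
  | negSucc n => rw [negSucc_zsmul, expPair_neg, expPair_nsmul, zpow_negSucc]

/-- The complex linear form `x ↦ (μ, ∑ x^r α_r^∨)`. -/
def pairForm (b : P.Base) (μ : V) : (b.support → ℂ) →L[ℂ] ℂ :=
  ∑ r : b.support, ((inner ℝ μ (corootVec P r) : ℝ) : ℂ) • ContinuousLinearMap.proj r

theorem pairForm_apply (b : P.Base) (μ : V) (x : b.support → ℂ) :
    pairForm b μ x = ∑ r : b.support, ((inner ℝ μ (corootVec P r) : ℝ) : ℂ) * x r := by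
  simp [pairForm]

theorem expPair_eq (b : P.Base) (μ : V) (x : b.support → ℂ) :
    expPair b μ x = Complex.exp (2 * Real.pi * Complex.I * pairForm b μ x) := by
  rw [pairForm_apply]; rfl

theorem hasFDerivAt_expPair (b : P.Base) (μ : V) (x : b.support → ℂ) :
    HasFDerivAt (expPair b μ)
      ((2 * Real.pi * Complex.I * expPair b μ x) • pairForm b μ) x := by
  have h := (((pairForm b μ).hasFDerivAt (x := x)).const_mul
    (2 * Real.pi * Complex.I)).cexp
  rw [smul_smul, ← expPair_eq, mul_comm (expPair b μ x)] at h
  exact h.congr_of_eventuallyEq (Eventually.of_forall fun y => expPair_eq b μ y)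

theorem analyticAt_expPair (b : P.Base) (μ : V) (x : b.support → ℂ) :
    AnalyticAt ℂ (expPair b μ) x := by
  rw [show expPair b μ = fun x => Complex.exp (2 * Real.pi * Complex.I * pairForm b μ x) from
    funext (expPair_eq b μ)]
  exact (analyticAt_const.mul ((pairForm b μ).analyticAt x)).cexp

theorem pairForm_single [DecidableEq ι] (b : P.Base) (μ : V) (r : b.support) :
    pairForm b μ (Pi.single r 1) = ((inner ℝ μ (corootVec P r) : ℝ) : ℂ) := by
  rw [pairForm_apply]
  simp [Pi.single_apply]

variable [IsEuclidean P]

theorem expPair_fundWeight [P.IsRootSystem] (b : P.Base) (j : b.support) (x : b.support → ℂ) :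
    expPair b (fundWeight b j) x = Complex.exp (2 * Real.pi * Complex.I * x j) := by
  classical
  simp only [expPair, inner_fundWeight_corootVec, apply_ite Complex.ofReal, Complex.ofReal_one,
    Complex.ofReal_zero, ite_mul, one_mul, zero_mul, Finset.sum_ite_eq, Finset.mem_univ, if_true]

variable [P.IsRootSystem] [P.IsCrystallographic]

theorem pairForm_affineMap (b : P.Base) (k : b.support → ℤ) (w : P.weylGroup) (μ : V)
    (x : b.support → ℂ) :
    pairForm b μ (affineMap b k w x) = pairForm b (w⁻¹ • μ) x +
      ∑ r : b.support, ((inner ℝ μ (corootVec P r) : ℝ) : ℂ) * k r := by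
  have h : ∀ i : b.support, ((inner ℝ (w⁻¹ • μ) (corootVec P i) : ℝ) : ℂ) =
      ∑ r : b.support, ((inner ℝ μ (corootVec P r) : ℝ) : ℂ) * weylMatrix b w r i := by
    intro i
    rw [inner_smul_left_eq, inv_inv, smul_corootVec b w i, inner_sum]
    simp [inner_smul_right, mul_comm]
  simp only [pairForm_apply, affineMap, mul_add, Finset.sum_add_distrib, h, Finset.sum_mul,
    Finset.mul_sum]
  rw [Finset.sum_comm]
  simp only [mul_assoc]

theorem expPair_affineMap (b : P.Base) (k : b.support → ℤ) (w : P.weylGroup) {μ : V}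
    (hμ : μ ∈ weightLattice b) (x : b.support → ℂ) :
    expPair b μ (affineMap b k w x) = expPair b (w⁻¹ • μ) x := by
  choose n hn using hμ
  rw [expPair_eq, pairForm_affineMap, mul_add, Complex.exp_add, ← expPair_eq]
  simp only [hn, Complex.ofReal_intCast]
  have : (2 * Real.pi * Complex.I * ∑ r, (n r : ℂ) * (k r : ℂ) : ℂ) =
      ((∑ r, n r * k r : ℤ) : ℂ) * (2 * Real.pi * Complex.I) := by
    push_cast; ring
  rw [this, Complex.exp_int_mul_two_pi_mul_I, mul_one]

theorem affineMap_affineMap (b : P.Base) (k k' : b.support → ℤ) (w w' : P.weylGroup)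
    (x : b.support → ℂ) :
    affineMap b k w (affineMap b k' w' x) =
      affineMap b (k + (weylMatrix b w).mulVec k') (w * w') x := by
  funext j
  simp only [affineMap, weylMatrix_mul, Matrix.mul_apply, Pi.add_apply, Matrix.mulVec,
    dotProduct, mul_add, Finset.sum_add_distrib, Finset.mul_sum, Int.cast_add, Int.cast_sum,
    Int.cast_mul, Finset.sum_mul]
  rw [Finset.sum_comm]
  simp only [mul_assoc]
  ring

theorem affineMap_zero_one (b : P.Base) (x : b.support → ℂ) : affineMap b 0 1 x = x := by
  classical
  funext j
  simp [affineMap, weylMatrix_one, Matrix.one_apply]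

/-! ### The null transformation -/

variable [Finite ι] [P.IsReduced] [DecidableEq ι]

/-- The elements of the Weyl group which occur in `y^j` at `λ = 0`. -/
def nullSet (b : P.Base) (m : b.support → ℕ) (j : b.support) : Finset P.weylGroup :=
  (Set.toFinite {w : P.weylGroup |
    (inner ℝ (fundWeight b j - w • fundWeight b j) (weight b m) : ℝ) = 0}).toFinset

/-- The stabilizer of `ω` as a finite set. -/
def stabSet (b : P.Base) (m : b.support → ℕ) : Finset P.weylGroup :=
  (Set.toFinite {w : P.weylGroup | w • weight b m = weight b m}).toFinset

theorem mem_nullSet {b : P.Base} {m : b.support → ℕ} {j : b.support} {w : P.weylGroup} :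
    w ∈ nullSet b m j ↔
      (inner ℝ (fundWeight b j - w • fundWeight b j) (weight b m) : ℝ) = 0 := by
  simp [nullSet]

theorem mem_stabSet {b : P.Base} {m : b.support → ℕ} {w : P.weylGroup} :
    w ∈ stabSet b m ↔ w • weight b m = weight b m := by
  simp [stabSet]

theorem one_mem_nullSet (b : P.Base) (m : b.support → ℕ) (j : b.support) :
    1 ∈ nullSet b m j := by
  simp [mem_nullSet]

theorem mul_mem_nullSet {b : P.Base} {m : b.support → ℕ} {j : b.support} {u w : P.weylGroup}
    (hu : u • weight b m = weight b m) : u * w ∈ nullSet b m j ↔ w ∈ nullSet b m j := by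
  rw [mem_nullSet, mem_nullSet, inner_sub_left, inner_sub_left, mul_smul, inner_smul_left_eq u,
    inv_smul_eq_iff.2 hu.symm]

/-- The generator `y^j` at `λ = 0`. -/
def nullGen (b : P.Base) (m : b.support → ℕ) (j : b.support) (x : b.support → ℂ) : ℂ :=
  (Nat.card (MulAction.stabilizer P.weylGroup (fundWeight b j)) : ℂ)⁻¹ *
    ∑ w ∈ nullSet b m j, expPair b (w • fundWeight b j) x

/-- The null transformation. -/
def nullMap (b : P.Base) (m : b.support → ℕ) (x : b.support → ℂ) : b.support → ℂ :=
  fun j => nullGen b m j x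

theorem basicGen_zero [P.IsIrreducible] (b : P.Base)
    (m : b.support → ℕ) (hm : m ≠ 0) (j : b.support) (x : b.support → ℂ) :
    basicGen b m j 0 x = nullGen b m j x := by
  have hk := (kappa_pos b m hm).ne'
  rw [basicGen, nullGen, finsum_eq_sum_of_support_subset (s := nullSet b m j)]
  · congr 1
    refine Finset.sum_congr rfl fun w hw => ?_
    rw [mem_nullSet] at hw
    simp [hw]
  · intro w hw
    rw [Finset.mem_coe, mem_nullSet]
    by_contra hne
    refine hw ?_
    dsimp only
    -- A power of λ = 0 vanishes only for a nonzero exponent. Positivity of κ matters here: division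
    -- by κ = 0 would give exponent 0 to every term.
    rw [Complex.zero_cpow, zero_mul]
    exact_mod_cast div_ne_zero hne hk

/-- Translations by coroots drop out because weights pair integrally with them, and left
multiplication by an element fixing ω permutes `nullSet`. -/
theorem nullGen_affineMap (b : P.Base) (m : b.support → ℕ) (j : b.support) (k : b.support → ℤ)
    {u : P.weylGroup} (hu : u • weight b m = weight b m) (x : b.support → ℂ) :
    nullGen b m j (affineMap b k u x) = nullGen b m j x := by
  rw [nullGen, nullGen]
  congr 1
  refine Finset.sum_bij' (fun w _ => u⁻¹ * w) (fun w _ => u * w)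
    (fun w hw => (mul_mem_nullSet (inv_smul_eq_iff.2 hu.symm)).2 hw)
    (fun w hw => (mul_mem_nullSet hu).2 hw) (by simp) (by simp) ?_
  intro w hw
  rw [expPair_affineMap b k u (smul_mem_weightLattice b w (fundWeight_mem_weightLattice b j)),
    mul_smul]

theorem nullMap_affineMap (b : P.Base) (m : b.support → ℕ) (k : b.support → ℤ)
    {u : P.weylGroup} (hu : u • weight b m = weight b m) (x : b.support → ℂ) :
    nullMap b m (affineMap b k u x) = nullMap b m x :=
  funext fun j => nullGen_affineMap b m j k hu x

theorem stabilizer_card_pos (b : P.Base) (j : b.support) :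
    0 < Nat.card (MulAction.stabilizer P.weylGroup (fundWeight b j)) :=
  Nat.card_pos

/-- For m_j ≠ 0, `nullSet` is the stabilizer of ω_j, whose order cancels N_j. These generators are
therefore units, which is why negative powers of the corresponding p_j are allowed in `pullbackAlg`.
-/
theorem nullGen_eq_expPair (b : P.Base) (m : b.support → ℕ)
    {j : b.support} (hj : m j ≠ 0) (x : b.support → ℂ) :
    nullGen b m j x = expPair b (fundWeight b j) x := by
  have hset : nullSet b m j =
      (Set.toFinite (MulAction.stabilizer P.weylGroup (fundWeight b j) :
        Set P.weylGroup)).toFinset := by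
    ext w
    rw [mem_nullSet, Set.Finite.mem_toFinset, SetLike.mem_coe, MulAction.mem_stabilizer_iff]
    exact ⟨smul_fundWeight_eq_self b m hj, fun h => by rw [h, sub_self, inner_zero_left]⟩
  have hcard : (nullSet b m j).card =
      Nat.card (MulAction.stabilizer P.weylGroup (fundWeight b j)) := by
    rw [hset, ← Set.ncard_eq_toFinset_card]
    rfl
  have hsum : ∑ w ∈ nullSet b m j, expPair b (w • fundWeight b j) x =
      ∑ _w ∈ nullSet b m j, expPair b (fundWeight b j) x :=
    Finset.sum_congr rfl fun w hw => by
      rw [smul_fundWeight_eq_self b m hj (mem_nullSet.1 hw)]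
  rw [nullGen, hsum, Finset.sum_const, hcard, nsmul_eq_mul, inv_mul_cancel_left₀]
  exact_mod_cast (stabilizer_card_pos b j).ne'

theorem hasFDerivAt_nullGen (b : P.Base) (m : b.support → ℕ) (j : b.support)
    (x : b.support → ℂ) :
    HasFDerivAt (nullGen b m j)
      ((Nat.card (MulAction.stabilizer P.weylGroup (fundWeight b j)) : ℂ)⁻¹ •
        ∑ w ∈ nullSet b m j, (2 * Real.pi * Complex.I * expPair b (w • fundWeight b j) x) •
          pairForm b (w • fundWeight b j)) x :=
  (HasFDerivAt.fun_sum fun w _ => hasFDerivAt_expPair b (w • fundWeight b j) x).const_mul _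

theorem analyticAt_nullGen (b : P.Base) (m : b.support → ℕ) (j : b.support)
    (x : b.support → ℂ) : AnalyticAt ℂ (nullGen b m j) x :=
  analyticAt_const.mul (Finset.analyticAt_fun_sum _ fun _ _ => analyticAt_expPair b _ x)

theorem analyticAt_nullMap (b : P.Base) (m : b.support → ℕ) (x : b.support → ℂ) :
    AnalyticAt ℂ (nullMap b m) x :=
  analyticAt_pi_iff.2 fun j => analyticAt_nullGen b m j x

theorem continuous_nullMap (b : P.Base) (m : b.support → ℕ) : Continuous (nullMap b m) :=
  continuous_iff_continuousAt.2 fun x => (analyticAt_nullMap b m x).continuousAt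

/-- In the direction of a fundamental weight which occurs in `ω`, the generators are
eigenfunctions of the derivative. -/
theorem fderiv_nullGen_fundWeight (b : P.Base) (m : b.support → ℕ)
    (j : b.support) {k : b.support} (hk : m k ≠ 0) (x v : b.support → ℂ)
    (hv : ∀ μ : V, pairForm b μ v = ((inner ℝ (fundWeight b k) μ : ℝ) : ℂ)) :
    fderiv ℂ (nullGen b m j) x v =
      2 * Real.pi * Complex.I * ((inner ℝ (fundWeight b k) (fundWeight b j) : ℝ) : ℂ) *
        nullGen b m j x := by
  rw [(hasFDerivAt_nullGen b m j x).fderiv, nullGen, smul_apply,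
    sum_apply, smul_eq_mul]
  refine Eq.trans (congrArg _ ?_) (mul_left_comm _ _ _)
  rw [Finset.mul_sum]
  refine Finset.sum_congr rfl fun w hw => ?_
  have h := inner_fundWeight_sub_smul_eq_zero b m (mem_nullSet.1 hw) hk
  rw [inner_sub_right, sub_eq_zero] at h
  rw [smul_apply, hv, smul_eq_mul, h]
  ring

end

end AffineWeylMonodromy

namespace AffineWeylMonodromy

noncomputable section

variable {ι V N : Type*} [NormedAddCommGroup V] [InnerProductSpace ℝ V]
  [AddCommGroup N] [Module ℝ N] {P : RootPairing ι ℝ V N}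
  [IsEuclidean P] [P.IsRootSystem] [P.IsCrystallographic] [Finite ι] [P.IsReduced]
  [DecidableEq ι]

/-! ### Invariant exponential polynomials are functions of the null transformation -/

/-- The points whose coordinates `p_j` with `m_j ≠ 0` do not vanish. -/
def unitLocus {J : Type*} (m : J → ℕ) : Set (J → ℂ) := {p | ∀ j, m j ≠ 0 → p j ≠ 0}

/-- The functions of the form `G ∘ φ_0` with `G` continuous on the locus where the coordinates
`p_j`, `m_j ≠ 0`, do not vanish. -/
def pullbackAlg (b : P.Base) (m : b.support → ℕ) : Subalgebra ℂ ((b.support → ℂ) → ℂ) where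
  carrier := {f | ∃ G : (b.support → ℂ) → ℂ, ContinuousOn G (unitLocus m) ∧
    ∀ x, f x = G (nullMap b m x)}
  mul_mem' := by
    rintro f g ⟨F, hF, hf⟩ ⟨G, hG, hg⟩
    exact ⟨fun p => F p * G p, hF.mul hG, fun x => by rw [Pi.mul_apply, hf, hg]⟩
  add_mem' := by
    rintro f g ⟨F, hF, hf⟩ ⟨G, hG, hg⟩
    exact ⟨fun p => F p + G p, hF.add hG, fun x => by rw [Pi.add_apply, hf, hg]⟩
  algebraMap_mem' c := ⟨fun _ => c, continuousOn_const, fun _ => rfl⟩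

theorem nullGen_mem_pullbackAlg (b : P.Base) (m : b.support → ℕ) (j : b.support) :
    nullGen b m j ∈ pullbackAlg b m :=
  ⟨fun p => p j, (continuous_apply j).continuousOn, fun _ => rfl⟩

theorem expPair_zsmul_mem_pullbackAlg (b : P.Base) (m : b.support → ℕ) {j : b.support}
    (hj : m j ≠ 0) (n : ℤ) : expPair b (n • fundWeight b j) ∈ pullbackAlg b m :=
  ⟨fun p => p j ^ n, fun p hp => ((continuous_apply j).continuousAt.zpow₀ n
    (Or.inl (hp j hj))).continuousWithinAt, fun x => by
      rw [expPair_zsmul, ← nullGen_eq_expPair b m hj]; rfl⟩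

theorem pullbackAlg_affineMap {b : P.Base} {m : b.support → ℕ} {f : (b.support → ℂ) → ℂ}
    (hf : f ∈ pullbackAlg b m) (k : b.support → ℤ) {u : P.weylGroup}
    (hu : u • weight b m = weight b m) (x : b.support → ℂ) :
    f (affineMap b k u x) = f x := by
  obtain ⟨G, -, hG⟩ := hf
  rw [hG, hG, nullMap_affineMap b m k hu]

/-! ### Averaging over the stabilizer of ω -/

/-- The sum of the exponentials of the translates of `μ` by the stabilizer of `ω`. -/
def stabSum (b : P.Base) (m : b.support → ℕ) (μ : V) (x : b.support → ℂ) : ℂ :=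
  ∑ w ∈ stabSet b m, expPair b (w • μ) x

/-- The sum of the translates of a function by the stabilizer of `ω`. -/
def stabTrace (b : P.Base) (m : b.support → ℕ) :
    ((b.support → ℂ) → ℂ) →ₗ[ℂ] ((b.support → ℂ) → ℂ) where
  toFun f x := ∑ w ∈ stabSet b m, f (affineMap b 0 w⁻¹ x)
  map_add' f g := funext fun x => by simp [Finset.sum_add_distrib]
  map_smul' c f := funext fun x => by simp [Finset.mul_sum]

theorem stabTrace_apply (b : P.Base) (m : b.support → ℕ) (f : (b.support → ℂ) → ℂ)
    (x : b.support → ℂ) :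
    stabTrace b m f x = ∑ w ∈ stabSet b m, f (affineMap b 0 w⁻¹ x) := rfl

theorem stabTrace_expPair (b : P.Base) (m : b.support → ℕ) {μ : V} (hμ : μ ∈ weightLattice b) :
    stabTrace b m (expPair b μ) = stabSum b m μ := by
  funext x
  exact Finset.sum_congr rfl fun w _ => by rw [expPair_affineMap b 0 _ hμ, inv_inv]

theorem stabTrace_of_invariant (b : P.Base) (m : b.support → ℕ) {f : (b.support → ℂ) → ℂ}
    (hf : ∀ u : P.weylGroup, u • weight b m = weight b m → ∀ x, f (affineMap b 0 u x) = f x) :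
    stabTrace b m f = ((stabSet b m).card : ℂ) • f := by
  funext x
  rw [stabTrace_apply, Finset.sum_congr rfl fun w hw =>
    hf w⁻¹ (inv_smul_eq_iff.2 (mem_stabSet.1 hw).symm) x]
  simp

theorem one_mem_stabSet (b : P.Base) (m : b.support → ℕ) : 1 ∈ stabSet b m :=
  mem_stabSet.2 (one_smul _ _)

theorem stabSet_card_ne_zero (b : P.Base) (m : b.support → ℕ) :
    ((stabSet b m).card : ℂ) ≠ 0 :=
  Nat.cast_ne_zero.2 (Finset.card_ne_zero_of_mem (one_mem_stabSet b m))

theorem stabSum_smul (b : P.Base) (m : b.support → ℕ) {u : P.weylGroup}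
    (hu : u • weight b m = weight b m) (μ : V) : stabSum b m (u • μ) = stabSum b m μ := by
  funext x
  refine Finset.sum_bij' (fun w _ => w * u) (fun w _ => w * u⁻¹) ?_ ?_ (by simp) (by simp)
    (fun w _ => by rw [mul_smul])
  · intro w hw
    rw [mem_stabSet] at hw ⊢
    rw [mul_smul, hu, hw]
  · intro w hw
    rw [mem_stabSet] at hw ⊢
    rw [mul_smul, inv_smul_eq_iff.2 hu.symm, hw]

/-! ### The dominance order of the stabilizer and leading exponentials -/

/-- `v` is a nonnegative combination of the simple roots orthogonal to `ω`. -/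
def InCone (b : P.Base) (m : b.support → ℕ) (v : V) : Prop :=
  ∀ k, 0 ≤ (inner ℝ (fundWeight b k) v : ℝ) ∧
    (m k ≠ 0 → (inner ℝ (fundWeight b k) v : ℝ) = 0)

theorem InCone.add {b : P.Base} {m : b.support → ℕ} {v v' : V} (h : InCone b m v)
    (h' : InCone b m v') : InCone b m (v + v') := fun k => by
  rw [inner_add_right]
  exact ⟨add_nonneg (h k).1 (h' k).1, fun hk => by rw [(h k).2 hk, (h' k).2 hk, add_zero]⟩

/-- The weights whose translates by the stabilizer of `ω` are all dominated by `μ`. -/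
def dominated (b : P.Base) (m : b.support → ℕ) (μ : V) : Set V :=
  {ν | ν ∈ weightLattice b ∧ ∀ w : P.weylGroup, w • weight b m = weight b m →
    InCone b m (μ - w • ν)}

theorem add_mem_dominated {b : P.Base} {m : b.support → ℕ} {μ μ' ν ν' : V}
    (h : ν ∈ dominated b m μ) (h' : ν' ∈ dominated b m μ') :
    ν + ν' ∈ dominated b m (μ + μ') := by
  refine ⟨add_mem h.1 h'.1, fun w hw => ?_⟩
  rw [smul_add, add_sub_add_comm]
  exact (h.2 w hw).add (h'.2 w hw)

theorem smul_fundWeight_mem_dominated (b : P.Base) (m : b.support → ℕ) {j : b.support}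
    {w : P.weylGroup} (hw : w ∈ nullSet b m j) :
    w • fundWeight b j ∈ dominated b m (fundWeight b j) := by
  refine ⟨smul_mem_weightLattice b w (fundWeight_mem_weightLattice b j), fun u hu k => ?_⟩
  rw [← mul_smul]
  exact ⟨inner_fundWeight_sub_smul_nonneg b (inner_fundWeight_corootVec_nonneg b j) _ k,
    inner_fundWeight_sub_smul_eq_zero b m (mem_nullSet.1 ((mul_mem_nullSet hu).2 hw))⟩

theorem zsmul_fundWeight_mem_dominated (b : P.Base) (m : b.support → ℕ) {j : b.support}
    (hj : m j ≠ 0) (n : ℤ) :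
    n • fundWeight b j ∈ dominated b m (n • fundWeight b j) := by
  refine ⟨zsmul_mem (fundWeight_mem_weightLattice b j) n, fun u hu k => ?_⟩
  rw [smul_comm, stabilizer_smul_fundWeight b m hj hu, sub_self]
  simp

/-- The cone of nonnegative combinations of the exponentials of weights dominated by `μ`. -/
def posCone (b : P.Base) (m : b.support → ℕ) (μ : V) : AddSubmonoid ((b.support → ℂ) → ℂ) :=
  AddSubmonoid.closure {f | ∃ c : ℝ, 0 ≤ c ∧ ∃ ν ∈ dominated b m μ, f = (c : ℂ) • expPair b ν}

theorem smul_expPair_mem_posCone {b : P.Base} {m : b.support → ℕ} {μ ν : V} {c : ℝ}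
    (hc : 0 ≤ c) (hν : ν ∈ dominated b m μ) : (c : ℂ) • expPair b ν ∈ posCone b m μ :=
  AddSubmonoid.subset_closure ⟨c, hc, ν, hν, rfl⟩

theorem mul_mem_posCone {b : P.Base} {m : b.support → ℕ} {μ μ' : V}
    {f g : (b.support → ℂ) → ℂ} (hf : f ∈ posCone b m μ) (hg : g ∈ posCone b m μ') :
    f * g ∈ posCone b m (μ + μ') := by
  have h := AddSubmonoid.mul_mem_mul hf hg
  rw [posCone, posCone, AddSubmonoid.closure_mul_closure] at h
  refine AddSubmonoid.closure_mono ?_ h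
  rintro _ ⟨_, ⟨c, hc, ν, hν, rfl⟩, _, ⟨c', hc', ν', hν', rfl⟩, rfl⟩
  refine ⟨c * c', mul_nonneg hc hc', ν + ν', add_mem_dominated hν hν', ?_⟩
  funext x
  simp only [Pi.mul_apply, Pi.smul_apply, smul_eq_mul, expPair_add, Complex.ofReal_mul]
  ring

/-- `f` is a nonnegative combination of the exponentials of weights dominated by `μ`, in which
the exponential of `μ` occurs. -/
def HasLeading (b : P.Base) (m : b.support → ℕ) (μ : V) (f : (b.support → ℂ) → ℂ) : Prop :=
  μ ∈ dominated b m μ ∧ ∃ c : ℝ, 0 < c ∧ ∃ g ∈ posCone b m μ, f = (c : ℂ) • expPair b μ + g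

theorem HasLeading.mul {b : P.Base} {m : b.support → ℕ} {μ μ' : V}
    {f f' : (b.support → ℂ) → ℂ} (h : HasLeading b m μ f) (h' : HasLeading b m μ' f') :
    HasLeading b m (μ + μ') (f * f') := by
  obtain ⟨hμ, c, hc, g, hg, rfl⟩ := h
  obtain ⟨hμ', c', hc', g', hg', rfl⟩ := h'
  refine ⟨add_mem_dominated hμ hμ', c * c', mul_pos hc hc',
    (c : ℂ) • expPair b μ * g' + g * ((c' : ℂ) • expPair b μ' + g'), add_mem ?_ ?_, ?_⟩
  · exact mul_mem_posCone (smul_expPair_mem_posCone hc.le hμ) hg'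
  · exact mul_mem_posCone hg (add_mem (smul_expPair_mem_posCone hc'.le hμ') hg')
  · funext x
    simp only [Pi.mul_apply, Pi.add_apply, Pi.smul_apply, smul_eq_mul, expPair_add,
      Complex.ofReal_mul]
    ring

theorem HasLeading.of_mem_dominated {b : P.Base} {m : b.support → ℕ} {μ : V}
    (h : μ ∈ dominated b m μ) : HasLeading b m μ (expPair b μ) :=
  ⟨h, 1, one_pos, 0, zero_mem _, by simp⟩

theorem HasLeading.one (b : P.Base) (m : b.support → ℕ) : HasLeading b m 0 1 := by
  have h0 : (0 : V) ∈ dominated b m 0 := ⟨zero_mem _, fun w _ k => by simp⟩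
  convert HasLeading.of_mem_dominated h0 using 1
  funext x
  rw [expPair_zero]
  rfl

theorem HasLeading.pow {b : P.Base} {m : b.support → ℕ} {μ : V}
    {f : (b.support → ℂ) → ℂ} (h : HasLeading b m μ f) (n : ℕ) :
    HasLeading b m (n • μ) (f ^ n) := by
  induction n with
  | zero => simpa using HasLeading.one b m
  | succ n ih => simpa only [succ_nsmul, pow_succ] using ih.mul h

theorem HasLeading.prod {b : P.Base} {m : b.support → ℕ} {J : Type*} (s : Finset J) {μ : J → V}
    {f : J → (b.support → ℂ) → ℂ} (h : ∀ j ∈ s, HasLeading b m (μ j) (f j)) :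
    HasLeading b m (∑ j ∈ s, μ j) (∏ j ∈ s, f j) := by
  classical
  induction s using Finset.induction_on with
  | empty => simpa using HasLeading.one b m
  | insert j s hj ih =>
    rw [Finset.sum_insert hj, Finset.prod_insert hj]
    exact (h j (Finset.mem_insert_self _ _)).mul
      (ih fun i hi => h i (Finset.mem_insert_of_mem hi))

/-- The term w = 1 supplies the leading exponential. Further w with wω_j = ω_j may stay in the
remainder, since their coefficients are positive and cannot cancel it. -/
theorem hasLeading_nullGen (b : P.Base) (m : b.support → ℕ) (j : b.support) :
    HasLeading b m (fundWeight b j) (nullGen b m j) := by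
  classical
  have hone := one_mem_nullSet b m j
  have hdom := smul_fundWeight_mem_dominated b m hone
  rw [one_smul] at hdom
  set c : ℝ := (Nat.card (MulAction.stabilizer P.weylGroup (fundWeight b j)) : ℝ)⁻¹ with hc
  have hcpos : 0 < c := inv_pos.2 (Nat.cast_pos.2 (stabilizer_card_pos b j))
  refine ⟨hdom, c, hcpos, ∑ w ∈ (nullSet b m j).erase 1, (c : ℂ) • expPair b (w • fundWeight b j),
    sum_mem fun w hw => smul_expPair_mem_posCone hcpos.le
      (smul_fundWeight_mem_dominated b m (Finset.mem_of_mem_erase hw)), ?_⟩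
  funext x
  rw [nullGen, ← Finset.add_sum_erase _ _ hone, one_smul]
  simp only [Pi.add_apply, Pi.smul_apply, Finset.sum_apply, smul_eq_mul, hc, mul_add,
    Finset.mul_sum, Complex.ofReal_inv, Complex.ofReal_natCast]

/-- Expand μ = ∑ n_j ω_j and multiply the powers of the generators: where m_j = 0 dominance gives
n_j ≥ 0, and where m_j ≠ 0 the generator is a unit, so the sign of n_j does not matter. -/
theorem exists_hasLeading_mem_pullbackAlg (b : P.Base) (m : b.support → ℕ) {μ : V}
    (hμ : μ ∈ weightLattice b)
    (hdom : ∀ i, m i = 0 → 0 ≤ (inner ℝ μ (corootVec P i) : ℝ)) :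
    ∃ f ∈ pullbackAlg b m, HasLeading b m μ f := by
  choose n hn using hμ
  have key : ∀ j : b.support, ∃ f ∈ pullbackAlg b m, HasLeading b m (n j • fundWeight b j) f := by
    intro j
    by_cases hj : m j = 0
    · have hnj : 0 ≤ n j := by
        have := hdom j hj
        rw [hn] at this
        exact_mod_cast this
      lift n j to ℕ using hnj with a
      refine ⟨nullGen b m j ^ a, pow_mem (nullGen_mem_pullbackAlg b m j) _, ?_⟩
      simpa using (hasLeading_nullGen b m j).pow a
    · exact ⟨_, expPair_zsmul_mem_pullbackAlg b m hj (n j),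
        .of_mem_dominated (zsmul_fundWeight_mem_dominated b m hj (n j))⟩
  choose f hf hlead using key
  refine ⟨∏ j, f j, prod_mem fun j _ => hf j, ?_⟩
  convert HasLeading.prod Finset.univ fun j _ => hlead j using 1
  conv_lhs => rw [← sum_inner_corootVec_smul_fundWeight b μ]
  refine Finset.sum_congr rfl fun j _ => ?_
  rw [hn, Int.cast_smul_eq_zsmul]

/-- Dominance gives (ν, μ - ν) ≥ 0, and ‖μ‖² = ‖ν‖² + 2(ν, μ - ν) + ‖μ - ν‖². -/
theorem norm_lt_of_inCone (b : P.Base) (m : b.support → ℕ) {μ ν : V}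
    (hdom : ∀ i, m i = 0 → 0 ≤ (inner ℝ ν (corootVec P i) : ℝ))
    (h : InCone b m (μ - ν)) (hne : ν ≠ μ) : ‖ν‖ < ‖μ‖ := by
  have h₁ : 0 ≤ (inner ℝ ν (μ - ν) : ℝ) := by
    rw [inner_eq_sum b]
    refine Finset.sum_nonneg fun k _ => ?_
    by_cases hk : m k = 0
    · exact mul_nonneg (hdom k hk) (h k).1
    · rw [(h k).2 hk, mul_zero]
  have h₂ := norm_add_sq_real ν (μ - ν)
  rw [add_sub_cancel] at h₂
  have h₃ : 0 < ‖μ - ν‖ := norm_pos_iff.2 (sub_ne_zero.2 hne.symm)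
  exact lt_of_pow_lt_pow_left₀ 2 (norm_nonneg _) (by nlinarith)

/-- After moving μ to its dominant representative, take f in the algebra with leading weight μ and
average it over the stabilizer. Since f is invariant this only multiplies it by the group order,
while each exponential becomes an orbit sum. Every orbit sum that occurs is that of μ or of a
strictly shorter weight, covered by induction on the number of weights of at most the given norm. -/
theorem stabSum_mem_pullbackAlg (b : P.Base) (m : b.support → ℕ) {μ : V}
    (hμ : μ ∈ weightLattice b) : stabSum b m μ ∈ pullbackAlg b m := by
  induction hn : {ν | ν ∈ weightLattice b ∧ ‖ν‖ ≤ ‖μ‖}.ncard using Nat.strong_induction_on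
    generalizing μ with
  | _ n ih =>
  obtain ⟨u, hu, hdom⟩ := exists_stabilizer_smul_dominant b m μ
  rw [← stabSum_smul b m hu]
  have hμu := smul_mem_weightLattice b u hμ
  rw [← norm_weyl_smul u μ] at hn
  generalize u • μ = μ at hdom hμu hn
  have ih' : ∀ ν ∈ weightLattice b, ‖ν‖ < ‖μ‖ → stabSum b m ν ∈ pullbackAlg b m := by
    intro ν hν hlt
    refine ih _ ?_ hν rfl
    rw [← hn]
    refine Set.ncard_lt_ncard ⟨fun ξ hξ => ⟨hξ.1, hξ.2.trans hlt.le⟩, fun hsub => ?_⟩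
      (finite_weightLattice_inter b _)
    exact absurd (hsub ⟨hμu, le_rfl⟩).2 (not_le.2 hlt)
  obtain ⟨f, hf, -, c, hc, g, hg, hfg⟩ := exists_hasLeading_mem_pullbackAlg b m hμu hdom
  -- The remainder may contribute to the orbit sum of μ again, but only with a coefficient c' ≥ 0,
  -- so the total coefficient c + c' stays positive and can be divided out.
  have hgtr : ∃ c' : ℝ, 0 ≤ c' ∧
      stabTrace b m g - (c' : ℂ) • stabSum b m μ ∈ pullbackAlg b m := by
    clear hfg
    induction hg using AddSubmonoid.closure_induction with
    | mem g hg =>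
      obtain ⟨a, ha, ν, hν, rfl⟩ := hg
      obtain ⟨v, hv, hvdom⟩ := exists_stabilizer_smul_dominant b m ν
      rw [map_smul, stabTrace_expPair b m hν.1, ← stabSum_smul b m hv]
      by_cases hne : v • ν = μ
      · exact ⟨a, ha, by rw [hne, sub_self]; exact zero_mem _⟩
      · refine ⟨0, le_rfl, ?_⟩
        rw [Complex.ofReal_zero, zero_smul, sub_zero]
        exact Subalgebra.smul_mem _ (ih' _ (smul_mem_weightLattice b v hν.1)
          (norm_lt_of_inCone b m hvdom (hν.2 v hv) hne)) _
    | zero => exact ⟨0, le_rfl, by simp⟩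
    | add g g' _ _ h h' =>
      obtain ⟨a, ha, h⟩ := h
      obtain ⟨a', ha', h'⟩ := h'
      refine ⟨a + a', add_nonneg ha ha', ?_⟩
      convert add_mem h h' using 1
      rw [map_add, Complex.ofReal_add, add_smul]
      abel
  obtain ⟨c', hc', hmem⟩ := hgtr
  have hinv : stabTrace b m f = ((stabSet b m).card : ℂ) • f :=
    stabTrace_of_invariant b m fun u hu x => pullbackAlg_affineMap hf 0 hu x
  have hsum : ((c + c' : ℝ) : ℂ) • stabSum b m μ ∈ pullbackAlg b m := by
    have h₁ := sub_mem (Subalgebra.smul_mem _ hf ((stabSet b m).card : ℂ)) hmem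
    rw [← hinv, hfg, map_add, map_smul, stabTrace_expPair b m hμu] at h₁
    convert h₁ using 1
    rw [Complex.ofReal_add, add_smul]
    abel
  have hne : ((c + c' : ℝ) : ℂ) ≠ 0 := by exact_mod_cast (add_pos_of_pos_of_nonneg hc hc').ne'
  have := Subalgebra.smul_mem _ hsum ((c + c' : ℝ) : ℂ)⁻¹
  rwa [inv_smul_smul₀ hne] at this

/-! ### Invariant exponential polynomials -/

/-- The algebra of exponential polynomials with weights in the weight lattice. -/
def expAlg (b : P.Base) : Subalgebra ℂ ((b.support → ℂ) → ℂ) :=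
  Algebra.adjoin ℂ (expPair b '' (weightLattice b : Set V))

theorem expPair_mem_expAlg {b : P.Base} {μ : V} (hμ : μ ∈ weightLattice b) :
    expPair b μ ∈ expAlg b := Algebra.subset_adjoin ⟨μ, hμ, rfl⟩

/-- Products of exponentials are exponentials, so f is a linear combination of them; its average
over the stabilizer is a combination of orbit sums and equals f up to the group order. -/
theorem mem_pullbackAlg_of_invariant (b : P.Base) (m : b.support → ℕ)
    {f : (b.support → ℂ) → ℂ} (hf : f ∈ expAlg b)
    (hinv : ∀ u : P.weylGroup, u • weight b m = weight b m → ∀ x, f (affineMap b 0 u x) = f x) :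
    f ∈ pullbackAlg b m := by
  let S : Submonoid ((b.support → ℂ) → ℂ) :=
    { carrier := expPair b '' (weightLattice b : Set V)
      one_mem' := ⟨0, zero_mem _, funext (expPair_zero b)⟩
      mul_mem' := by
        rintro _ _ ⟨μ, hμ, rfl⟩ ⟨ν, hν, rfl⟩
        exact ⟨μ + ν, add_mem hμ hν, funext (expPair_add b μ ν)⟩ }
  have htr : stabTrace b m f ∈ pullbackAlg b m := by
    have hspan : f ∈ Submodule.span ℂ (S : Set ((b.support → ℂ) → ℂ)) := by
      have h : f ∈ Subalgebra.toSubmodule (Algebra.adjoin ℂ (S : Set ((b.support → ℂ) → ℂ))) := hf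
      rwa [Algebra.adjoin_eq_span, Submonoid.closure_eq] at h
    clear hf hinv
    induction hspan using Submodule.span_induction with
    | mem f h =>
      obtain ⟨μ, hμ, rfl⟩ := h
      rw [stabTrace_expPair b m hμ]
      exact stabSum_mem_pullbackAlg b m hμ
    | zero => rw [map_zero]; exact zero_mem _
    | add f g _ _ hf hg => rw [map_add]; exact add_mem hf hg
    | smul c f _ hf => rw [map_smul]; exact Subalgebra.smul_mem _ hf c
  rw [stabTrace_of_invariant b m hinv] at htr
  have := Subalgebra.smul_mem _ htr ((stabSet b m).card : ℂ)⁻¹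
  rwa [inv_smul_smul₀ (stabSet_card_ne_zero b m)] at this

end

end AffineWeylMonodromy

namespace AffineWeylMonodromy

noncomputable section

/-! ### Auxiliary facts -/

/-- Finitely many hyperplanes through the origin do not cover the whole space. -/
theorem exists_eq_zero_of_forall_sum_mul_eq_zero {J T : Type*} [Fintype J] (s : Finset T)
    (d : T → J → ℂ) (h : ∀ c : J → ℂ, ∃ w ∈ s, ∑ j, c j * d w j = 0) : ∃ w ∈ s, d w = 0 := by
  classical
  by_contra! hne
  have hprod : ∏ w ∈ s, ∑ j, MvPolynomial.C (d w j) * MvPolynomial.X j = 0 := by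
    refine MvPolynomial.funext fun c => ?_
    obtain ⟨w, hw, h0⟩ := h c
    rw [map_prod, map_zero]
    refine Finset.prod_eq_zero hw ?_
    simpa [mul_comm] using h0
  obtain ⟨w, hw, h0⟩ := Finset.prod_eq_zero_iff.1 hprod
  refine hne w hw (funext fun j => ?_)
  have := congrArg (MvPolynomial.eval (Pi.single j 1)) h0
  simpa [Pi.single_apply] using this

/-- The coefficients are, up to sign, elementary symmetric polynomials in the roots. -/
theorem coeff_prod_X_sub_C_mem {T A : Type*} (S : Subalgebra ℂ (A → ℂ)) (s : Finset T)
    (f : T → A → ℂ) (hf : ∀ i ∈ s, f i ∈ S) (k : ℕ) :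
    (fun x => (∏ i ∈ s, (Polynomial.X - Polynomial.C (f i x))).coeff k) ∈ S := by
  classical
  induction s using Finset.induction_on generalizing k with
  | empty =>
    simp only [Finset.prod_empty, Polynomial.coeff_one]
    split_ifs
    · exact one_mem S
    · exact zero_mem S
  | insert i s hi ih =>
    have hs : ∀ j ∈ s, f j ∈ S := fun j hj => hf j (Finset.mem_insert_of_mem hj)
    have hi' := hf i (Finset.mem_insert_self i s)
    simp only [Finset.prod_insert hi, sub_mul, Polynomial.coeff_sub, Polynomial.coeff_C_mul]
    refine sub_mem ?_ (mul_mem hi' (ih hs k))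
    cases k with
    | zero =>
      simp only [Polynomial.coeff_X_mul_zero]
      exact zero_mem S
    | succ k => simpa using ih hs k

theorem norm_root_le {Q : Polynomial ℂ} (hQ : Q.Monic) {t : ℂ} (ht : Q.eval t = 0) :
    ‖t‖ ≤ 1 + ∑ k ∈ Finset.range Q.natDegree, ‖Q.coeff k‖ := by
  have hS : 0 ≤ ∑ k ∈ Finset.range Q.natDegree, ‖Q.coeff k‖ :=
    Finset.sum_nonneg fun _ _ => norm_nonneg _
  rcases le_or_gt ‖t‖ 1 with h1 | h1
  · linarith
  rw [Polynomial.eval_eq_sum_range, Finset.sum_range_succ, hQ.coeff_natDegree, one_mul] at ht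
  rcases Nat.eq_zero_or_pos Q.natDegree with hn | hn
  · rw [hn] at ht
    simp at ht
  · have h2 : ‖t‖ ^ Q.natDegree ≤
        (∑ k ∈ Finset.range Q.natDegree, ‖Q.coeff k‖) * ‖t‖ ^ (Q.natDegree - 1) := by
      rw [← norm_pow, ← neg_eq_of_add_eq_zero_right ht, norm_neg, Finset.sum_mul]
      refine (norm_sum_le _ _).trans (Finset.sum_le_sum fun k hk => ?_)
      rw [norm_mul, norm_pow]
      have := Finset.mem_range.1 hk
      exact mul_le_mul_of_nonneg_left (pow_le_pow_right₀ h1.le (by omega)) (norm_nonneg _)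
    have h3 : ‖t‖ ^ Q.natDegree = ‖t‖ * ‖t‖ ^ (Q.natDegree - 1) := by
      rw [← pow_succ', Nat.sub_add_cancel (by omega)]
    rw [h3] at h2
    have := le_of_mul_le_mul_right h2 (pow_pos (by linarith) _)
    linarith

variable {ι V N : Type*} [NormedAddCommGroup V] [InnerProductSpace ℝ V]
  [AddCommGroup N] [Module ℝ N] {P : RootPairing ι ℝ V N}
  [IsEuclidean P] [P.IsRootSystem] [P.IsCrystallographic] [Finite ι] [P.IsReduced]
  [DecidableEq ι]

theorem prod_stabSet_inv_mul {M : Type*} [CommMonoid M] (b : P.Base) (m : b.support → ℕ)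
    (h : P.weylGroup → M) {u : P.weylGroup} (hu : u • weight b m = weight b m) :
    ∏ w ∈ stabSet b m, h (u⁻¹ * w) = ∏ w ∈ stabSet b m, h w := by
  refine Finset.prod_bij' (fun w _ => u⁻¹ * w) (fun w _ => u * w) ?_ ?_ (by simp) (by simp)
    (fun _ _ => rfl)
  · intro w hw
    rw [mem_stabSet] at hw ⊢
    rw [mul_smul, hw, inv_smul_eq_iff.2 hu.symm]
  · intro w hw
    rw [mem_stabSet] at hw ⊢
    rw [mul_smul, hw, hu]

/-! ### Fibres of the null transformation -/

/-- For fixed c, let s be the value at x' of ∑ c_j e^{ω_j}. The product over the stabilizer of s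
minus the translates of this sum is an invariant function vanishing at x', hence also at x. So for
every c some w satisfies a linear relation in c. Finitely many proper hyperplanes do not cover the
space, so one w gives e^{ω_j}(x') = e^{wω_j}(x) for all j at once, which determines x' up to integer
translations. -/
theorem exists_affineMap_of_nullMap_eq (b : P.Base) (m : b.support → ℕ) {x x' : b.support → ℂ}
    (h : nullMap b m x = nullMap b m x') :
    ∃ (k : b.support → ℤ) (w : P.weylGroup), w • weight b m = weight b m ∧
      affineMap b k w x = x' := by
  have hω : ∀ (w : P.weylGroup) (j : b.support), w • fundWeight b j ∈ weightLattice b :=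
    fun w j => smul_mem_weightLattice b w (fundWeight_mem_weightLattice b j)
  obtain ⟨w, hw, hd⟩ := exists_eq_zero_of_forall_sum_mul_eq_zero (stabSet b m)
    (fun w j => expPair b (fundWeight b j) x' - expPair b (w • fundWeight b j) x) fun c => by
    set s := ∑ j, c j * expPair b (fundWeight b j) x' with hs
    let f : (b.support → ℂ) → ℂ := ∏ w ∈ stabSet b m,
      ((fun _ => s) - ∑ j, c j • expPair b (w • fundWeight b j))
    have hf : f ∈ expAlg b := prod_mem fun w _ => sub_mem (Subalgebra.algebraMap_mem _ s)
      (sum_mem fun j _ => Subalgebra.smul_mem _ (expPair_mem_expAlg (hω w j)) _)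
    have hval : ∀ y, f y = ∏ w ∈ stabSet b m,
        (s - ∑ j, c j * expPair b (w • fundWeight b j) y) := fun y => by
      simp [f, Finset.prod_apply, Finset.sum_apply]
    obtain ⟨G, -, hG⟩ := mem_pullbackAlg_of_invariant b m hf fun u hu y => by
      rw [hval, hval]
      refine ((prod_stabSet_inv_mul b m _ hu).symm.trans
        (Finset.prod_congr rfl fun w _ => ?_)).symm
      simp only [expPair_affineMap b 0 u (hω w _), mul_smul]
    have h0 : f x = 0 := by
      rw [hG, h, ← hG, hval]
      refine Finset.prod_eq_zero (one_mem_stabSet b m) ?_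
      simp [hs]
    rw [hval] at h0
    obtain ⟨w, hw, h0⟩ := Finset.prod_eq_zero_iff.1 h0
    exact ⟨w, hw, by simpa only [mul_sub, Finset.sum_sub_distrib] using h0⟩
  have hj : ∀ j, ∃ n : ℤ, x' j = affineMap b 0 w⁻¹ x j + n := by
    intro j
    have := sub_eq_zero.1 (congrFun hd j)
    rw [← inv_inv w, ← expPair_affineMap b 0 w⁻¹ (fundWeight_mem_weightLattice b j),
      expPair_fundWeight, expPair_fundWeight, Complex.exp_eq_exp_iff_exists_int] at this
    obtain ⟨n, hn⟩ := this
    refine ⟨n, mul_left_cancel₀ Complex.two_pi_I_ne_zero ?_⟩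
    rw [hn]
    ring
  choose n hn using hj
  refine ⟨n, w⁻¹, inv_smul_eq_iff.2 (mem_stabSet.1 hw).symm, funext fun j => ?_⟩
  rw [hn]
  simp [affineMap]

/-- The exponential is a root of the monic polynomial whose roots are its translates under the
stabilizer. The coefficients are invariant, hence continuous functions of φ_0, and bound the roots.
Applied to ±ω_j, this makes φ_0 proper modulo lattice translations over the unit locus. -/
theorem exists_bound_expPair (b : P.Base) (m : b.support → ℕ) {μ : V}
    (hμ : μ ∈ weightLattice b) :
    ∃ B : (b.support → ℂ) → ℝ, ContinuousOn B (unitLocus m) ∧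
      ∀ x, ‖expPair b μ x‖ ≤ B (nullMap b m x) := by
  let Q : (b.support → ℂ) → Polynomial ℂ := fun x =>
    ∏ w ∈ stabSet b m, (Polynomial.X - Polynomial.C (expPair b (w • μ) x))
  have hQ : ∀ u : P.weylGroup, u • weight b m = weight b m → ∀ x, Q (affineMap b 0 u x) = Q x := by
    intro u hu x
    refine ((prod_stabSet_inv_mul b m _ hu).symm.trans
      (Finset.prod_congr rfl fun w _ => ?_)).symm
    rw [expPair_affineMap b 0 u (smul_mem_weightLattice b w hμ), mul_smul]
  have hcoeff : ∀ k, (fun x => (Q x).coeff k) ∈ pullbackAlg b m := fun k =>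
    mem_pullbackAlg_of_invariant b m (coeff_prod_X_sub_C_mem _ _ _ (fun w _ =>
      expPair_mem_expAlg (smul_mem_weightLattice b w hμ)) k) fun u hu x => by
        simp only [hQ u hu x]
  choose G hG hGQ using hcoeff
  refine ⟨fun p => 1 + ∑ k ∈ Finset.range (stabSet b m).card, ‖G k p‖,
    continuousOn_const.add (continuousOn_finsetSum _ fun k _ => (hG k).norm), fun x => ?_⟩
  have hmonic : (Q x).Monic := Polynomial.monic_prod_of_monic _ _ fun w _ =>
    Polynomial.monic_X_sub_C _
  have hdeg : (Q x).natDegree = (stabSet b m).card := by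
    rw [Polynomial.natDegree_prod_of_monic _ _ fun w _ => Polynomial.monic_X_sub_C _]
    simp
  have hroot : (Q x).eval (expPair b μ x) = 0 := by
    rw [Polynomial.eval_prod]
    exact Finset.prod_eq_zero (one_mem_stabSet b m) (by simp)
  have := norm_root_le hmonic hroot
  rw [hdeg] at this
  simpa only [← hGQ] using this

theorem norm_expPair_fundWeight (b : P.Base) (j : b.support) (x : b.support → ℂ) :
    ‖expPair b (fundWeight b j) x‖ = Real.exp (-(2 * Real.pi * (x j).im)) := by
  rw [expPair_fundWeight, Complex.norm_exp]
  congr 1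
  simp [Complex.mul_re, Complex.mul_im]

/-- The image of the null transformation is closed in the locus where the coordinates `p_j`,
`m_j ≠ 0`, do not vanish. -/
theorem mem_range_nullMap_of_mem_closure (b : P.Base) (m : b.support → ℕ) {p : b.support → ℂ}
    (hp : p ∈ unitLocus m) (hcl : p ∈ closure (Set.range (nullMap b m))) :
    p ∈ Set.range (nullMap b m) := by
  choose B hB hBle using fun j => exists_bound_expPair b m (fundWeight_mem_weightLattice b j)
  choose B' hB' hBle' using
    fun j => exists_bound_expPair b m (neg_mem (fundWeight_mem_weightLattice b j))
  have hopen : IsOpen (unitLocus m) := by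
    have : unitLocus m = ⋂ j, ⋂ (_ : m j ≠ 0), {p : b.support → ℂ | p j ≠ 0} := by
      ext; simp [unitLocus]
    rw [this]
    exact isOpen_iInter_of_finite fun j => isOpen_iInter_of_finite fun _ =>
      isOpen_ne_fun (continuous_apply j) continuous_const
  have hnear : ∀ᶠ q in 𝓝 p, ∀ j, B j q < B j p + 1 ∧ B' j q < B' j p + 1 :=
    eventually_all.2 fun j =>
      (((hB j).continuousAt (hopen.mem_nhds hp)).eventually_lt_const (by linarith)).and
        (((hB' j).continuousAt (hopen.mem_nhds hp)).eventually_lt_const (by linarith))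
  -- Lattice translations bring the real parts into [0, 1]; the bounds on e^{ω_j} and e^{-ω_j} near
  -- p confine the imaginary parts from below and above.
  let K : Set (b.support → ℂ) := Set.univ.pi fun j =>
    Set.Icc 0 1 ×ℂ Set.Icc (-(B j p + 1)) (B' j p + 1)
  have hK : IsCompact K := isCompact_univ_pi fun j => isCompact_Icc.reProdIm isCompact_Icc
  have hsub : ∀ᶠ q in 𝓝 p, q ∈ Set.range (nullMap b m) → q ∈ nullMap b m '' K := by
    filter_upwards [hnear] with q hq
    rintro ⟨x, rfl⟩
    refine ⟨affineMap b (fun j => -⌊(x j).re⌋) 1 x, fun j _ => ?_,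
      nullMap_affineMap b m _ (one_smul _ _) x⟩
    have hval : affineMap b (fun j => -⌊(x j).re⌋) 1 x j = x j - ⌊(x j).re⌋ := by
      simp [affineMap, weylMatrix_one, Matrix.one_apply, sub_eq_add_neg]
    have h₁ := (hBle j x).trans (hq j).1.le
    have h₂ := (hBle' j x).trans (hq j).2.le
    rw [norm_expPair_fundWeight] at h₁
    rw [expPair_neg, norm_inv, norm_expPair_fundWeight, ← Real.exp_neg, neg_neg] at h₂
    have h₃ := Real.add_one_le_exp (-(2 * Real.pi * (x j).im))
    have h₄ := Real.add_one_le_exp (2 * Real.pi * (x j).im)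
    have hπ := Real.pi_gt_three
    have hle₁ : 0 < B j p + 1 := (Real.exp_pos _).trans_le h₁
    have hle₂ : 0 < B' j p + 1 := (Real.exp_pos _).trans_le h₂
    rw [hval, Complex.mem_reProdIm]
    simp only [Complex.sub_re, Complex.sub_im, Complex.intCast_re, Complex.intCast_im, sub_zero,
      Set.mem_Icc]
    refine ⟨⟨by linarith [Int.floor_le (x j).re], by linarith [Int.lt_floor_add_one (x j).re]⟩,
      ?_, ?_⟩
    · by_contra! hlt
      nlinarith
    · by_contra! hlt
      nlinarith
  have hcl' : p ∈ closure (nullMap b m '' K) := by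
    rw [mem_closure_iff_frequently] at hcl ⊢
    exact (hcl.and_eventually hsub).mono fun q hq => hq.2 hq.1
  rw [(hK.image (continuous_nullMap b m)).isClosed.closure_eq] at hcl'
  obtain ⟨x, -, hx⟩ := hcl'
  exact ⟨x, hx⟩

/-! ### The Jacobian matrix -/

theorem pd_nullGen (b : P.Base) (m : b.support → ℕ) (j r : b.support) (x : b.support → ℂ) :
    pd (nullGen b m j) r x =
      (Nat.card (MulAction.stabilizer P.weylGroup (fundWeight b j)) : ℂ)⁻¹ *
        ∑ w ∈ nullSet b m j, 2 * Real.pi * Complex.I * expPair b (w • fundWeight b j) x *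
          ((inner ℝ (w • fundWeight b j) (corootVec P r) : ℝ) : ℂ) := by
  rw [pd, (hasFDerivAt_nullGen b m j x).fderiv, smul_apply, sum_apply, smul_eq_mul]
  congr 1
  refine Finset.sum_congr rfl fun w _ => ?_
  rw [smul_apply, pairForm_single, smul_eq_mul]

/-- The Jacobian matrix of the null transformation. -/
def nullJacobian (b : P.Base) (m : b.support → ℕ) (x : b.support → ℂ) :
    Matrix b.support b.support ℂ :=
  Matrix.of fun j r => pd (nullGen b m j) r x

/-- Move along x = -itρ with t → ∞. After row j is rescaled by e^{-2πt(ω_j, ρ)}, all terms with wω_j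
≠ ω_j decay because (ω_j - wω_j, ρ) > 0. What remains is a diagonal matrix with nonzero entries, by
the duality of fundamental weights and coroots. -/
theorem exists_det_nullJacobian_ne_zero (b : P.Base) (m : b.support → ℕ) :
    ∃ x, (nullJacobian b m x).det ≠ 0 := by
  classical
  set ρ : V := ∑ k, fundWeight b k with hρ
  let x : ℝ → b.support → ℂ := fun t r =>
    -Complex.I * (t * (inner ℝ (fundWeight b r) ρ : ℝ) : ℝ)
  have hexp : ∀ (μ : V) (t : ℝ), expPair b μ (x t) =
      ((Real.exp (2 * Real.pi * t * inner ℝ μ ρ) : ℝ) : ℂ) := by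
    intro μ t
    rw [expPair_eq, pairForm_apply, inner_eq_sum b μ ρ, Complex.ofReal_exp]
    congr 1
    push_cast
    simp only [x, Finset.mul_sum]
    refine Finset.sum_congr rfl fun r _ => ?_
    push_cast
    linear_combination (-2 * Real.pi * (inner ℝ μ (corootVec P r) : ℝ) * t *
      (inner ℝ (fundWeight b r) ρ : ℝ)) * Complex.I_sq
  have hpos : ∀ (j : b.support) (w : P.weylGroup), w • fundWeight b j ≠ fundWeight b j →
      0 < (inner ℝ (fundWeight b j) ρ : ℝ) - inner ℝ (w • fundWeight b j) ρ := by
    intro j w hne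
    have hnn := inner_fundWeight_sub_smul_nonneg b
      (inner_fundWeight_corootVec_nonneg b j) w
    rw [← inner_sub_left, real_inner_comm, hρ, sum_inner]
    refine (Finset.sum_nonneg fun k _ => hnn k).lt_of_ne' fun h0 => hne ?_
    rw [Finset.sum_eq_zero_iff_of_nonneg fun k _ => hnn k] at h0
    exact (sub_eq_zero.1 (eq_zero_of_inner_fundWeight b fun k => h0 k (Finset.mem_univ k))).symm
  set c : b.support → ℂ := fun j =>
    (Nat.card (MulAction.stabilizer P.weylGroup (fundWeight b j)) : ℂ)⁻¹ *
      ∑ w ∈ nullSet b m j, if w • fundWeight b j = fundWeight b j then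
        2 * Real.pi * Complex.I else 0 with hc
  have hc0 : ∀ j, c j ≠ 0 := by
    intro j
    refine mul_ne_zero (inv_ne_zero (Nat.cast_ne_zero.2 (stabilizer_card_pos b j).ne')) ?_
    rw [← Finset.sum_filter, Finset.sum_const, nsmul_eq_mul]
    refine mul_ne_zero (Nat.cast_ne_zero.2 (Finset.card_ne_zero_of_mem (a := 1) ?_))
      Complex.two_pi_I_ne_zero
    exact Finset.mem_filter.2 ⟨one_mem_nullSet b m j, one_smul _ _⟩
  let M : ℝ → Matrix b.support b.support ℂ := fun t => Matrix.of fun j r =>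
    ((Real.exp (-(2 * Real.pi * t * inner ℝ (fundWeight b j) ρ)) : ℝ) : ℂ) *
      nullJacobian b m (x t) j r
  have hM : Tendsto M atTop (𝓝 (Matrix.diagonal c)) := by
    refine tendsto_pi_nhds.2 fun j => tendsto_pi_nhds.2 fun r => ?_
    have hterm : ∀ w ∈ nullSet b m j, Tendsto (fun t : ℝ => 2 * Real.pi * Complex.I *
        ((Real.exp (-(2 * Real.pi * (inner ℝ (fundWeight b j) ρ -
          inner ℝ (w • fundWeight b j) ρ)) * t) : ℝ) : ℂ) *
          ((inner ℝ (w • fundWeight b j) (corootVec P r) : ℝ) : ℂ)) atTop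
        (𝓝 ((if w • fundWeight b j = fundWeight b j then 2 * Real.pi * Complex.I else 0) *
          if j = r then 1 else 0)) := by
      intro w _
      split_ifs with h1 h2 h2
      · rw [h1, inner_fundWeight_corootVec, if_pos h2]
        simp
      · rw [h1, inner_fundWeight_corootVec, if_neg h2]
        simp
      all_goals
        have hneg : -(2 * Real.pi * ((inner ℝ (fundWeight b j) ρ : ℝ) -
            inner ℝ (w • fundWeight b j) ρ)) < 0 := by
          have := hpos j w h1
          have := Real.pi_pos
          rw [neg_lt_zero]
          positivity
        have h0 : Tendsto (fun t : ℝ => Real.exp (-(2 * Real.pi *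
            ((inner ℝ (fundWeight b j) ρ : ℝ) - inner ℝ (w • fundWeight b j) ρ)) * t)) atTop
            (𝓝 0) := Real.tendsto_exp_atBot.comp (tendsto_id.const_mul_atTop_of_neg hneg)
        have h3 := (Complex.continuous_ofReal.tendsto 0).comp h0
        simpa using (h3.const_mul (2 * Real.pi * Complex.I)).mul_const
          (((inner ℝ (w • fundWeight b j) (corootVec P r) : ℝ) : ℂ))
    have hlim := (tendsto_finsetSum _ hterm).const_mul
      (Nat.card (MulAction.stabilizer P.weylGroup (fundWeight b j)) : ℂ)⁻¹
    have hd : Matrix.diagonal c j r =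
        (Nat.card (MulAction.stabilizer P.weylGroup (fundWeight b j)) : ℂ)⁻¹ *
          ∑ w ∈ nullSet b m j,
            (if w • fundWeight b j = fundWeight b j then 2 * Real.pi * Complex.I else 0) *
              if j = r then 1 else 0 := by
      rw [Matrix.diagonal_apply, ← Finset.sum_mul, ← mul_assoc]
      split_ifs <;> simp [hc]
    rw [hd]
    refine hlim.congr fun t => ?_
    simp only [M, Matrix.of_apply, nullJacobian, pd_nullGen, Finset.mul_sum]
    refine Finset.sum_congr rfl fun w _ => ?_
    rw [hexp, show -(2 * Real.pi * ((inner ℝ (fundWeight b j) ρ : ℝ) -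
      inner ℝ (w • fundWeight b j) ρ)) * t = -(2 * Real.pi * t * inner ℝ (fundWeight b j) ρ) +
        2 * Real.pi * t * inner ℝ (w • fundWeight b j) ρ by ring, Real.exp_add]
    push_cast
    ring
  have hdet : Tendsto (fun t => (M t).det) atTop (𝓝 (Matrix.diagonal c).det) :=
    ((continuous_id.matrix_det).tendsto _).comp hM
  rw [Matrix.det_diagonal] at hdet
  obtain ⟨t, ht⟩ := (hdet.eventually_ne (Finset.prod_ne_zero_iff.2 fun j _ => hc0 j)).exists
  refine ⟨x t, fun h0 => ht ?_⟩
  rw [Matrix.det_mul_column, h0, mul_zero]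

/-! ### The flat metric -/

theorem gram_mul_inner_fundWeight (b : P.Base) :
    gram b * Matrix.of (fun i j => (inner ℝ (fundWeight b i) (fundWeight b j) : ℝ)) = 1 := by
  ext i j
  rw [Matrix.mul_apply, Matrix.one_apply]
  simp only [gram, Matrix.of_apply]
  rw [← inner_eq_sum b, real_inner_comm, inner_fundWeight_corootVec]
  simp only [eq_comm]

theorem flatMetric_apply (b : P.Base) (i j : b.support) :
    flatMetric b i j = ((inner ℝ (fundWeight b i) (fundWeight b j) : ℝ) : ℂ) := by
  rw [flatMetric, Matrix.inv_eq_right_inv (gram_mul_inner_fundWeight b)]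
  rfl

theorem gram_mul_flatMetric (b : P.Base) : (gram b).map Complex.ofReal * flatMetric b = 1 := by
  rw [flatMetric, Matrix.inv_eq_right_inv (gram_mul_inner_fundWeight b),
    ← Matrix.map_one Complex.ofReal Complex.ofReal_zero Complex.ofReal_one,
    ← gram_mul_inner_fundWeight b]
  exact (Matrix.map_mul (f := Complex.ofRealHom)).symm

theorem gram_symm (b : P.Base) (i j : b.support) : gram b i j = gram b j i :=
  real_inner_comm _ _

end

end AffineWeylMonodromy

namespace AffineWeylMonodromy

noncomputable section

/-! ### Complements of analytic hypersurfaces -/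

theorem countable_zeros {h : ℂ → ℂ} (hh : ∀ t, AnalyticAt ℂ h t) {t₀ : ℂ} (h₀ : h t₀ ≠ 0) :
    {t | h t = 0}.Countable := by
  have hh' : AnalyticOnNhd ℂ h Set.univ := fun t _ => hh t
  have : DiscreteTopology {t | h t = 0} := by
    rw [discreteTopology_subtype_iff]
    intro t _
    rw [← disjoint_iff, disjoint_principal_right]
    rcases (hh t).eventually_eq_zero_or_eventually_ne_zero with h1 | h1
    · exact absurd (hh'.eqOn_zero_of_preconnected_of_eventuallyEq_zero isPreconnected_univ
        (Set.mem_univ t) h1 (Set.mem_univ t₀)) h₀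
    · exact h1
  exact Set.countable_coe_iff.1 countable_of_Lindelof_of_discrete

/-- Restrict f to the complex line through two points of the set: its zeros there are countable, and
the complement of a countable set in ℂ, of real dimension 2, is path connected. -/
theorem isPathConnected_ne_zero {J : Type*} [Fintype J] {f : (J → ℂ) → ℂ}
    (hf : ∀ x, AnalyticAt ℂ f x) {x₀ : J → ℂ} (h₀ : f x₀ ≠ 0) :
    IsPathConnected {x | f x ≠ 0} := by
  refine ⟨x₀, h₀, fun {y} hy => ?_⟩
  let L : ℂ → J → ℂ := fun t => x₀ + t • (y - x₀)
  have hL : ∀ t, AnalyticAt ℂ L t := fun t =>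
    analyticAt_const.add (analyticAt_id.smul analyticAt_const)
  have hcount := countable_zeros (h := f ∘ L) (t₀ := 0) (fun t => (hf (L t)).comp (hL t))
    (by simpa [L] using h₀)
  have hconn := hcount.isPathConnected_compl_of_one_lt_rank (by simp [Complex.rank_real_complex])
  obtain ⟨γ, hγ⟩ := hconn.joinedIn 0 (by simpa [L] using h₀) 1 (by simpa [L] using hy)
  have hLc : Continuous L := continuous_iff_continuousAt.2 fun t => (hL t).continuousAt
  refine ⟨(γ.map hLc).cast (by simp [L]) (by simp [L]), fun t => ?_⟩
  exact hγ t

variable {J : Type*} [Fintype J] [DecidableEq J]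

/-! ### Local inverses -/

theorem sum_pd_mul {u : (J → ℂ) → ℂ} (p v : J → ℂ) :
    fderiv ℂ u p v = ∑ r, pd u r p * v r := by
  conv_lhs => rw [pi_eq_sum_univ' v, map_sum]
  refine Finset.sum_congr rfl fun r _ => ?_
  rw [map_smul, smul_eq_mul, mul_comm]
  rfl

/-- The Jacobian matrix of a map. -/
def jacobian (φ : (J → ℂ) → (J → ℂ)) (x : J → ℂ) : Matrix J J ℂ :=
  Matrix.of fun i r => pd (fun y => φ y i) r x

theorem jacobian_mulVec {φ : (J → ℂ) → (J → ℂ)} {x : J → ℂ} (hφ : DifferentiableAt ℂ φ x)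
    (v : J → ℂ) : (jacobian φ x).mulVec v = fderiv ℂ φ x v := by
  funext i
  rw [Matrix.mulVec, dotProduct]
  simp only [jacobian, Matrix.of_apply]
  rw [← sum_pd_mul, fderiv_apply hφ]
  rfl

theorem jacobian_comp {φ ψ : (J → ℂ) → (J → ℂ)} {x : J → ℂ}
    (hψ : DifferentiableAt ℂ ψ x) (hφ : DifferentiableAt ℂ φ (ψ x)) :
    jacobian (fun y => φ (ψ y)) x = jacobian φ (ψ x) * jacobian ψ x := by
  refine Matrix.ext_of_mulVec_single fun r => ?_
  rw [jacobian_mulVec (φ := fun y => φ (ψ y)) (hφ.comp x hψ), ← Matrix.mulVec_mulVec,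
    jacobian_mulVec hψ, jacobian_mulVec hφ]
  exact congrArg (fun A => A (Pi.single r 1)) (fderiv_comp x hφ hψ)

theorem jacobian_id (x : J → ℂ) : jacobian (fun y => y) x = 1 := by
  refine Matrix.ext_of_mulVec_single fun r => ?_
  rw [jacobian_mulVec differentiableAt_fun_id, fderiv_fun_id, Matrix.one_mulVec]
  rfl

theorem jacobian_congr {φ ψ : (J → ℂ) → (J → ℂ)} {x : J → ℂ} (h : φ =ᶠ[𝓝 x] ψ) :
    jacobian φ x = jacobian ψ x := by
  ext i r
  have : (fun y => φ y i) =ᶠ[𝓝 x] fun y => ψ y i := h.mono fun y hy => congrFun hy i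
  simp only [jacobian, Matrix.of_apply, pd, this.fderiv_eq]

theorem exists_local_inverse {φ : (J → ℂ) → (J → ℂ)} {y : J → ℂ} (hφ : AnalyticAt ℂ φ y)
    (hdet : (jacobian φ y).det ≠ 0) :
    ∃ s : (J → ℂ) → (J → ℂ), AnalyticAt ℂ s (φ y) ∧ s (φ y) = y ∧
      (∀ᶠ p in 𝓝 (φ y), φ (s p) = p) ∧ ∀ᶠ x in 𝓝 y, s (φ x) = x := by
  have hinj : Function.Injective (fderiv ℂ φ y) := by
    intro v w hvw
    rw [← jacobian_mulVec hφ.differentiableAt, ← jacobian_mulVec hφ.differentiableAt] at hvw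
    exact Matrix.mulVec_injective_of_isUnit
      ((Matrix.isUnit_iff_isUnit_det _).2 (isUnit_iff_ne_zero.2 hdet)) hvw
  let e : (J → ℂ) ≃L[ℂ] (J → ℂ) := (LinearEquiv.ofInjectiveEndo
    (fderiv ℂ φ y).toLinearMap hinj).toContinuousLinearEquiv
  have he : HasFDerivAt φ (e : (J → ℂ) →L[ℂ] (J → ℂ)) y := by
    have heq : (e : (J → ℂ) →L[ℂ] (J → ℂ)) = fderiv ℂ φ y := by
      ext v : 1
      rfl
    rw [heq]
    exact hφ.differentiableAt.hasFDerivAt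
  -- Here `⊤` is the analytic smoothness exponent, so the local inverse comes out analytic.
  have hc : ContDiffAt ℂ ⊤ φ y := hφ.contDiffAt
  have hstr := hc.hasStrictFDerivAt' he (by simp)
  exact ⟨hc.localInverse he (by simp), (hc.to_localInverse he
    (by simp)).analyticAt, hc.localInverse_apply_image he (by simp),
    hstr.eventually_right_inverse, hstr.eventually_left_inverse⟩

/-- Continuous local sections of a locally injective map are determined by one value. -/
theorem eventuallyEq_of_section {φ s₁ s₂ s : (J → ℂ) → (J → ℂ)} {p : J → ℂ}
    (h₁ : ContinuousAt s₁ p) (h₂ : ContinuousAt s₂ p) (heq : s₁ p = s₂ p)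
    (hs₁ : ∀ᶠ q in 𝓝 p, φ (s₁ q) = q) (hs₂ : ∀ᶠ q in 𝓝 p, φ (s₂ q) = q)
    (hs : ∀ᶠ x in 𝓝 (s₁ p), s (φ x) = x) : s₁ =ᶠ[𝓝 p] s₂ := by
  have hs' := hs
  rw [heq] at hs'
  filter_upwards [h₁.eventually hs, h₂.eventually hs', hs₁, hs₂] with q a₁ a₂ b₁ b₂
  rw [← a₁, ← a₂, b₁, b₂]

/-! ### Uniqueness of analytic continuation -/

/-- The set of times at which the germs agree is clopen in the unit interval. It is closed by the
identity theorem on a ball around γ(t) where both germs at time t are analytic. -/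
theorem IsContinuation.eventuallyEq {γ : unitInterval → (J → ℂ)} (hγ : Continuous γ)
    {F F' : unitInterval → (J → ℂ) → (J → ℂ)} (hF : IsContinuation γ F)
    (hF' : IsContinuation γ F') (h₀ : F 0 =ᶠ[𝓝 (γ 0)] F' 0) (t : unitInterval) :
    F t =ᶠ[𝓝 (γ t)] F' t := by
  let S : Set unitInterval := {t | F t =ᶠ[𝓝 (γ t)] F' t}
  have hopen : IsOpen S := by
    rw [isOpen_iff_mem_nhds]
    intro t ht
    have ht' := hγ.continuousAt.eventually (eventually_eventually_nhds.2 ht)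
    filter_upwards [(hF t).2, (hF' t).2, ht'] with s h1 h2 h3
    exact h1.trans (EventuallyEq.trans h3 h2.symm)
  have hclosed : IsClosed S := by
    rw [← closure_subset_iff_isClosed]
    intro t ht
    obtain ⟨B, hB, hconn⟩ : ∃ B ∈ 𝓝 (γ t), IsPreconnected B ∧
        AnalyticOnNhd ℂ (F t) B ∧ AnalyticOnNhd ℂ (F' t) B := by
      have h1 := (hF t).1.eventually_analyticAt.and (hF' t).1.eventually_analyticAt
      obtain ⟨ε, hε, hball⟩ := Metric.eventually_nhds_iff_ball.1 h1
      exact ⟨Metric.ball (γ t) ε, Metric.ball_mem_nhds _ hε,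
        (convex_ball (γ t) ε).isPreconnected, fun q hq => (hball q hq).1,
        fun q hq => (hball q hq).2⟩
    obtain ⟨s, hs, h1, h2, h3⟩ := ((mem_closure_iff_frequently.1 ht).and_eventually
      ((hF t).2.and ((hF' t).2.and (hγ.continuousAt.eventually hB)))).exists
    have h4 : F t =ᶠ[𝓝 (γ s)] F' t := h1.symm.trans (EventuallyEq.trans hs h2)
    exact (hconn.2.1.eqOn_of_preconnected_of_eventuallyEq hconn.2.2 hconn.1 h3 h4).eventuallyEq_of_mem
      hB
  have huniv : S = Set.univ := IsClopen.eq_univ ⟨hclosed, hopen⟩ ⟨0, h₀⟩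
  exact huniv.symm.subset (Set.mem_univ t)

/-! ### Flat coordinates -/

theorem pd_analyticAt {f : (J → ℂ) → ℂ} {p : J → ℂ} (hf : AnalyticAt ℂ f p) (i : J) :
    AnalyticAt ℂ (pd f i) p := by
  have h := hf.fderiv
  exact ((ContinuousLinearMap.apply ℂ ℂ (Pi.single i (1 : ℂ) : J → ℂ)).analyticAt _).comp h

theorem pd_pd_comm {f : (J → ℂ) → ℂ} {p : J → ℂ} (hf : AnalyticAt ℂ f p) (i j : J) :
    pd (pd f i) j p = pd (pd f j) i p := by
  have hsymm : IsSymmSndFDerivAt ℂ f p := ContDiffAt.isSymmSndFDerivAt_of_omega hf.contDiffAt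
  have hpd : ∀ i j, pd (pd f i) j p =
      fderiv ℂ (fderiv ℂ f) p (Pi.single j 1) (Pi.single i 1) := by
    intro i j
    have h := hf.fderiv.differentiableAt
    change fderiv ℂ (fun q => fderiv ℂ f q (Pi.single i 1)) p (Pi.single j 1) = _
    rw [fderiv_clm_apply h (differentiableAt_const _)]
    simp
  rw [hpd, hpd, hsymm.eq]

theorem pd_mul {f g : (J → ℂ) → ℂ} {p : J → ℂ} (hf : AnalyticAt ℂ f p) (hg : AnalyticAt ℂ g p)
    (i : J) : pd (fun q => f q * g q) i p = pd f i p * g p + f p * pd g i p := by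
  simp only [pd]
  rw [fderiv_fun_mul hf.differentiableAt hg.differentiableAt]
  simp only [add_apply, smul_apply, smul_eq_mul]
  ring

theorem pd_const_mul {f : (J → ℂ) → ℂ} {p : J → ℂ} (hf : AnalyticAt ℂ f p) (c : ℂ) (i : J) :
    pd (fun q => c * f q) i p = c * pd f i p := by
  simp only [pd]
  rw [fderiv_const_mul hf.differentiableAt]
  rfl

theorem pd_sum {T : Type*} {s : Finset T} {f : T → (J → ℂ) → ℂ} {p : J → ℂ}
    (hf : ∀ t ∈ s, AnalyticAt ℂ (f t) p) (i : J) :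
    pd (fun q => ∑ t ∈ s, f t q) i p = ∑ t ∈ s, pd (f t) i p := by
  simp only [pd]
  rw [fderiv_fun_sum fun t ht => (hf t ht).differentiableAt, sum_apply]

/-- If the covariant components of a metric are the pullback of a constant symmetric form along
`x`, then the functions `x^u` are flat coordinates. -/
theorem pd_pd_eq_sum_christoffel {h : (J → ℂ) → Matrix J J ℂ} {x : (J → ℂ) → (J → ℂ)}
    {p : J → ℂ} (hx : ∀ u, AnalyticAt ℂ (fun q => x q u) p) {C : Matrix J J ℂ} (hC : C.IsSymm)
    {A : Matrix J J ℂ} (hAC : A * C = 1)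
    (hinv : ∀ᶠ q in 𝓝 p, (h q)⁻¹ = (jacobian x q).transpose * C * jacobian x q)
    (hmet : jacobian x p * h p * (jacobian x p).transpose = A) (u i j : J) :
    pd (pd (fun q => x q u) i) j p = ∑ k, christoffel h k i j p * pd (fun q => x q u) k p := by
  have han : ∀ u i, AnalyticAt ℂ (pd (fun q => x q u) i) p := fun u i => pd_analyticAt (hx u) i
  have hcov : ∀ i r j, pd (fun q => (h q)⁻¹ i r) j p = ∑ v, ∑ w, C v w *
      (pd (pd (fun q => x q v) i) j p * pd (fun q => x q w) r p +
        pd (fun q => x q v) i p * pd (pd (fun q => x q w) r) j p) := by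
    intro i r j
    have heq : (fun q => (h q)⁻¹ i r) =ᶠ[𝓝 p] fun q => ∑ v, ∑ w, C v w *
        (pd (fun q => x q v) i q * pd (fun q => x q w) r q) := by
      filter_upwards [hinv] with q hq
      rw [hq, Matrix.mul_assoc, Matrix.mul_apply]
      refine Finset.sum_congr rfl fun v _ => ?_
      rw [Matrix.mul_apply, Finset.mul_sum]
      refine Finset.sum_congr rfl fun w _ => ?_
      simp only [jacobian, Matrix.transpose_apply, Matrix.of_apply]
      ring
    have h1 : pd (fun q => (h q)⁻¹ i r) j p = pd (fun q => ∑ v, ∑ w, C v w *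
        (pd (fun q => x q v) i q * pd (fun q => x q w) r q)) j p := by
      simp only [pd, heq.fderiv_eq]
    have hm : ∀ v w, AnalyticAt ℂ (fun q => pd (fun q => x q v) i q * pd (fun q => x q w) r q) p :=
      fun v w => (han v i).mul (han w r)
    have hm' : ∀ v w, AnalyticAt ℂ (fun q => C v w *
        (pd (fun q => x q v) i q * pd (fun q => x q w) r q)) p :=
      fun v w => analyticAt_const.mul (hm v w)
    rw [h1, pd_sum (f := fun v q => ∑ w, C v w *
      (pd (fun q => x q v) i q * pd (fun q => x q w) r q))
      fun v _ => Finset.analyticAt_fun_sum _ fun w _ => hm' v w]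
    refine Finset.sum_congr rfl fun v _ => ?_
    rw [pd_sum (f := fun w q => C v w *
      (pd (fun q => x q v) i q * pd (fun q => x q w) r q)) fun w _ => hm' v w]
    refine Finset.sum_congr rfl fun w _ => ?_
    rw [pd_const_mul (hm v w), pd_mul (han v i) (han w r)]
  let T : J → ℂ := fun v => pd (pd (fun q => x q v) i) j p
  -- Symmetry of C and of second derivatives makes the three derivative terms collapse to twice Jᵀ C
  -- ∂_i∂_j x, which absorbs the factor 1/2. Multiplying by J and using J h Jᵀ = C⁻¹ then leaves
  -- ∂_i∂_j x.
  have hchr : ∀ k, christoffel h k i j p =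
      (h p).mulVec ((jacobian x p).transpose.mulVec (C.mulVec T)) k := by
    intro k
    rw [christoffel, Matrix.mulVec, dotProduct, Finset.mul_sum]
    refine Finset.sum_congr rfl fun r _ => ?_
    rw [mul_left_comm]
    congr 1
    rw [hcov, hcov, hcov]
    have hswap : ∀ f : J → J → ℂ, ∑ v, ∑ w, C v w * f v w = ∑ v, ∑ w, C v w * f w v := by
      intro f
      rw [Finset.sum_comm]
      refine Finset.sum_congr rfl fun v _ => Finset.sum_congr rfl fun w _ => ?_
      rw [hC.apply]
    have hgoal : (jacobian x p).transpose.mulVec (C.mulVec T) r =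
        ∑ v, ∑ w, C v w * (pd (fun q => x q v) r p * T w) := by
      simp only [Matrix.mulVec, dotProduct, Finset.mul_sum, jacobian, Matrix.transpose_apply,
        Matrix.of_apply]
      refine Finset.sum_congr rfl fun v _ => Finset.sum_congr rfl fun w _ => ?_
      ring
    rw [hgoal]
    have e1 : ∀ v, pd (pd (fun q => x q v) j) i p = T v := fun v => pd_pd_comm (hx v) j i
    have e2 : ∀ v, pd (pd (fun q => x q v) r) j p = pd (pd (fun q => x q v) j) r p :=
      fun v => pd_pd_comm (hx v) r j
    have e3 : ∀ v, pd (pd (fun q => x q v) r) i p = pd (pd (fun q => x q v) i) r p :=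
      fun v => pd_pd_comm (hx v) r i
    simp only [e1, e2, e3, mul_add, Finset.sum_add_distrib]
    have s1 := hswap fun v w => pd (pd (fun q => x q v) i) j p * pd (fun q => x q w) r p
    have s2 := hswap fun v w => pd (fun q => x q v) j p * pd (pd (fun q => x q w) i) r p
    have s3 : ∑ v, ∑ w, C v w * (T v * pd (fun q => x q w) r p) =
      ∑ v, ∑ w, C v w * (pd (fun q => x q v) r p * T w) := by
        rw [hswap fun v w => T v * pd (fun q => x q w) r p]
        simp only [mul_comm (T _)]
    have s4 : ∑ v, ∑ w, C v w * (pd (pd (fun q => x q v) i) r p * pd (fun q => x q w) j p) =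
        ∑ v, ∑ w, C v w * (pd (fun q => x q v) j p * pd (pd (fun q => x q w) i) r p) := by
      rw [s2]
      simp only [mul_comm (pd (pd _ _) _ _)]
    change 1 / 2 * (∑ v, ∑ w, C v w * (T v * pd (fun q => x q w) r p) + _ +
      (∑ v, ∑ w, C v w * (T v * pd (fun q => x q w) r p) + _) - _) = _
    rw [s3, s4]
    ring
  simp only [hchr]
  have hfin : ∑ k, (h p).mulVec ((jacobian x p).transpose.mulVec (C.mulVec T)) k *
      pd (fun q => x q u) k p =
      (jacobian x p).mulVec ((h p).mulVec ((jacobian x p).transpose.mulVec (C.mulVec T))) u := by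
    conv_rhs => rw [Matrix.mulVec, dotProduct]
    exact Finset.sum_congr rfl fun k _ => mul_comm _ _
  rw [hfin, Matrix.mulVec_mulVec, Matrix.mulVec_mulVec, hmet,
    Matrix.mulVec_mulVec, hAC, Matrix.one_mulVec]

end

end AffineWeylMonodromy

namespace AffineWeylMonodromy

noncomputable section

/-! ### The metric on the orbit space -/

theorem analyticAt_eval {J : Type*} [Fintype J] (q : MvPolynomial J ℂ) (p : J → ℂ) :
    AnalyticAt ℂ (fun p => MvPolynomial.eval p q) p :=
  AnalyticOnNhd.eval_mvPolynomial q p (Set.mem_univ p)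

theorem eq_zero_of_eventually_eval_eq_zero {J : Type*} [Fintype J] {q : MvPolynomial J ℂ}
    {p : J → ℂ} (h : ∀ᶠ p' in 𝓝 p, MvPolynomial.eval p' q = 0) : q = 0 := by
  refine MvPolynomial.funext fun p' => ?_
  rw [map_zero]
  exact (AnalyticOnNhd.eval_mvPolynomial q).eqOn_zero_of_preconnected_of_eventuallyEq_zero
    isPreconnected_univ (Set.mem_univ p) h (Set.mem_univ p')

theorem det_metricAt {J : Type*} [Fintype J] [DecidableEq J]
    (g : Matrix J J (MvPolynomial J ℂ)) (p : J → ℂ) :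
    (metricAt g p).det = MvPolynomial.eval p g.det := by
  rw [RingHom.map_det]
  rfl

theorem mem_regularLocus {J : Type*} [Fintype J] [DecidableEq J]
    {g η : Matrix J J (MvPolynomial J ℂ)} {p : J → ℂ} :
    p ∈ regularLocus g η ↔ (metricAt η p).det ≠ 0 ∧ (metricAt g p).det ≠ 0 := by
  simp only [regularLocus, sigmaLocus, degeneracyLocus, Set.mem_compl_iff, Set.mem_union,
    Set.mem_ofPred_eq]
  tauto

theorem regularLocus_eq {J : Type*} [Fintype J] [DecidableEq J]
    (g η : Matrix J J (MvPolynomial J ℂ)) :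
    regularLocus g η = {p | MvPolynomial.eval p (η.det * g.det) ≠ 0} := by
  ext p
  rw [mem_regularLocus, det_metricAt, det_metricAt, Set.mem_ofPred_eq, map_mul, mul_ne_zero_iff]

theorem isOpen_regularLocus {J : Type*} [Fintype J] [DecidableEq J]
    (g η : Matrix J J (MvPolynomial J ℂ)) : IsOpen (regularLocus g η) := by
  rw [regularLocus_eq]
  exact isOpen_ne_fun (continuous_iff_continuousAt.2 fun p => (analyticAt_eval _ p).continuousAt)
    continuous_const

/-- A map with invertible Jacobian matrix is locally open. -/
theorem le_map_nhds {J : Type*} [Fintype J] [DecidableEq J] {φ : (J → ℂ) → (J → ℂ)}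
    {y : J → ℂ} (hφ : AnalyticAt ℂ φ y) (hdet : (jacobian φ y).det ≠ 0) :
    𝓝 (φ y) ≤ map φ (𝓝 y) := by
  obtain ⟨s, hs, hsy, hsec, -⟩ := exists_local_inverse hφ hdet
  have ht : Tendsto s (𝓝 (φ y)) (𝓝 y) := by
    have := hs.continuousAt.tendsto
    rwa [hsy] at this
  calc 𝓝 (φ y) = map id (𝓝 (φ y)) := map_id.symm
    _ = map (φ ∘ s) (𝓝 (φ y)) := map_congr (hsec.mono fun p hp => hp.symm)
    _ = map φ (map s (𝓝 (φ y))) := map_map.symm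
    _ ≤ map φ (𝓝 y) := map_mono ht

variable {ι V N : Type*} [NormedAddCommGroup V] [InnerProductSpace ℝ V]
  [AddCommGroup N] [Module ℝ N] {P : RootPairing ι ℝ V N}
  [IsEuclidean P] [P.IsRootSystem] [P.IsCrystallographic] [Finite ι] [P.IsReduced]
  [DecidableEq ι]

/-- `g` is the image under the null transformation of the flat metric. -/
def IsNullMetric (b : P.Base) (m : b.support → ℕ)
    (g : Matrix b.support b.support (MvPolynomial b.support ℂ)) : Prop :=
  ∀ x, metricAt g (nullMap b m x) = (1 / (4 * Real.pi ^ 2) : ℂ) •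
    (jacobian (nullMap b m) x * flatMetric b * (jacobian (nullMap b m) x).transpose)

variable {b : P.Base} {m : b.support → ℕ}
  {g η : Matrix b.support b.support (MvPolynomial b.support ℂ)}

theorem phi_zero_eq_nullMap [P.IsIrreducible] (hm : m ≠ 0)
    {z : b.support → ℂ → (b.support → ℂ) → ℂ} (hz : IsPencilGenerators b m z g η) :
    phi z 0 = nullMap b m := by
  funext x j
  exact ((hz.proper j).2.2 x).trans (basicGen_zero b m hm j x)

theorem isNullMetric_of_isPencilGenerators [P.IsIrreducible] (hm : m ≠ 0)
    {z : b.support → ℂ → (b.support → ℂ) → ℂ} (hz : IsPencilGenerators b m z g η) :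
    IsNullMetric b m g := by
  intro x
  ext i j
  have h := hz.linear 0 x i j
  rw [phi_zero_eq_nullMap hm hz, zero_mul, add_zero] at h
  rw [← h, pushMetric]
  have hzj : ∀ j, z j 0 = fun x => nullMap b m x j := fun j =>
    funext fun x => congrFun (congrFun (phi_zero_eq_nullMap hm hz) x) j
  simp only [Matrix.smul_apply, smul_eq_mul, hzj]
  congr 1
  rw [Matrix.mul_apply]
  simp only [Matrix.mul_apply, Matrix.transpose_apply, jacobian, Matrix.of_apply, Finset.sum_mul]
  rw [Finset.sum_comm]

theorem det_flatMetric_ne_zero (b : P.Base) : (flatMetric b).det ≠ 0 := fun h => by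
  have := congrArg Matrix.det (gram_mul_flatMetric b)
  rw [Matrix.det_mul, h, mul_zero, Matrix.det_one] at this
  exact zero_ne_one this

theorem det_metricAt_nullMap_ne_zero_iff (hg : IsNullMetric b m g) (x : b.support → ℂ) :
    (metricAt g (nullMap b m x)).det ≠ 0 ↔ (jacobian (nullMap b m) x).det ≠ 0 := by
  rw [hg x, Matrix.det_smul, Matrix.det_mul, Matrix.det_mul, Matrix.det_transpose]
  have h1 := det_flatMetric_ne_zero b
  have h2 : (1 / (4 * Real.pi ^ 2) : ℂ) ^ Fintype.card b.support ≠ 0 :=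
    pow_ne_zero _ (by simp [Real.pi_ne_zero])
  constructor
  · exact fun h h0 => h (by rw [h0]; simp)
  · exact fun h => mul_ne_zero h2 (mul_ne_zero (mul_ne_zero h h1) h)

theorem det_ne_zero_of_isNullMetric (hg : IsNullMetric b m g) : g.det ≠ 0 := by
  obtain ⟨x, hx⟩ := exists_det_nullJacobian_ne_zero b m
  intro h
  refine (det_metricAt_nullMap_ne_zero_iff hg x).2 hx ?_
  rw [det_metricAt, h, map_zero]

/-- A polynomial which vanishes on the image of the null transformation vanishes. -/
theorem eq_zero_of_eval_nullMap_eq_zero {q : MvPolynomial b.support ℂ}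
    (hq : ∀ x, MvPolynomial.eval (nullMap b m x) q = 0) : q = 0 := by
  obtain ⟨x, hx⟩ := exists_det_nullJacobian_ne_zero b m
  refine eq_zero_of_eventually_eval_eq_zero (p := nullMap b m x) ?_
  exact le_map_nhds (analyticAt_nullMap b m x) hx (mem_map.2 (univ_mem' hq))

/-- The gradient of the pure exponential y^k|_{λ=0} points along ω_k, and in that direction every
generator is an eigenfunction of the derivative. This proves the identity on the image of φ_0, which
has interior points, so it holds for polynomials. -/
theorem metric_column_eq (hg : IsNullMetric b m g) {k : b.support} (hk : m k ≠ 0)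
    (i : b.support) :
    g i k = MvPolynomial.C (-(inner ℝ (fundWeight b k) (fundWeight b i) : ℝ) : ℂ) *
      MvPolynomial.X i * MvPolynomial.X k := by
  rw [← sub_eq_zero]
  refine eq_zero_of_eval_nullMap_eq_zero (m := m) fun x => ?_
  -- These are the coordinates of ω_k in the basis of simple coroots.
  let v : b.support → ℂ := fun r => flatMetric b r k
  have hv : ∀ μ : V, pairForm b μ v = ((inner ℝ (fundWeight b k) μ : ℝ) : ℂ) := by
    intro μ
    rw [pairForm_apply, real_inner_comm, inner_eq_sum b μ]
    push_cast
    simp only [v, flatMetric_apply]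
  have hpk : ∀ s, pd (fun y => nullMap b m y k) s x =
      2 * Real.pi * Complex.I * (if k = s then nullMap b m x k else 0) := by
    intro s
    have h1 : (fun y => nullMap b m y k) = expPair b (fundWeight b k) :=
      funext fun y => nullGen_eq_expPair b m hk y
    have h2 : nullMap b m x k = expPair b (fundWeight b k) x := nullGen_eq_expPair b m hk x
    rw [h1, h2, pd, (hasFDerivAt_expPair b _ x).fderiv, smul_apply, pairForm_single,
      inner_fundWeight_corootVec]
    split_ifs <;> simp
  have hi : ∑ r, pd (fun y => nullMap b m y i) r x * flatMetric b r k =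
      2 * Real.pi * Complex.I * ((inner ℝ (fundWeight b k) (fundWeight b i) : ℝ) : ℂ) *
        nullMap b m x i :=
    (sum_pd_mul x v).symm.trans (fderiv_nullGen_fundWeight b m i hk x v hv)
  have h := congrFun (congrFun (hg x) i) k
  rw [Matrix.smul_apply, Matrix.mul_apply] at h
  simp only [Matrix.transpose_apply, jacobian, Matrix.of_apply, hpk, mul_ite, mul_zero,
    Finset.sum_ite_eq, Finset.mem_univ, if_true, Matrix.mul_apply, hi, smul_eq_mul] at h
  have hgik : MvPolynomial.eval (nullMap b m x) (g i k) = metricAt g (nullMap b m x) i k := rfl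
  rw [map_sub, hgik, h]
  simp only [map_mul, MvPolynomial.eval_C, MvPolynomial.eval_X]
  have hπ : (Real.pi : ℂ) ≠ 0 := by exact_mod_cast Real.pi_ne_zero
  field_simp
  linear_combination (4 * (nullMap b m x i) * (nullMap b m x k) *
    ((inner ℝ (fundWeight b k) (fundWeight b i) : ℝ) : ℂ)) * Complex.I_sq

/-! ### Topology of the regular locus and of its preimage -/

theorem regularLocus_subset_unitLocus (hg : IsNullMetric b m g) :
    regularLocus g η ⊆ unitLocus m := by
  intro p hp k hk h0
  refine (mem_regularLocus.1 hp).2 (Matrix.det_eq_zero_of_column_eq_zero k fun i => ?_)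
  change MvPolynomial.eval p (g i k) = 0
  rw [metric_column_eq hg hk]
  simp [h0]

theorem isPathConnected_regularLocus (hg : IsNullMetric b m g) (hη : η.det ≠ 0) :
    IsPathConnected (regularLocus g η) := by
  have hne : η.det * g.det ≠ 0 := mul_ne_zero hη (det_ne_zero_of_isNullMetric hg)
  obtain ⟨p, hp⟩ : ∃ p, MvPolynomial.eval p (η.det * g.det) ≠ 0 := by
    by_contra! h
    exact hne (MvPolynomial.funext fun p => by rw [h p, map_zero])
  rw [regularLocus_eq]
  exact isPathConnected_ne_zero (analyticAt_eval _) hp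

theorem det_jacobian_ne_zero (hg : IsNullMetric b m g) {x : b.support → ℂ}
    (hx : nullMap b m x ∈ regularLocus g η) : (jacobian (nullMap b m) x).det ≠ 0 :=
  (det_metricAt_nullMap_ne_zero_iff hg x).1 (mem_regularLocus.1 hx).2

theorem isPathConnected_preimage_regularLocus (hg : IsNullMetric b m g) (hη : η.det ≠ 0) :
    IsPathConnected (nullMap b m ⁻¹' regularLocus g η) := by
  have hne : η.det * g.det ≠ 0 := mul_ne_zero hη (det_ne_zero_of_isNullMetric hg)
  obtain ⟨x, hx⟩ : ∃ x, MvPolynomial.eval (nullMap b m x) (η.det * g.det) ≠ 0 := by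
    by_contra! h
    exact hne (eq_zero_of_eval_nullMap_eq_zero h)
  rw [regularLocus_eq]
  exact isPathConnected_ne_zero (f := fun x => MvPolynomial.eval (nullMap b m x) (η.det * g.det))
    (fun x => (analyticAt_eval _ _).comp (analyticAt_nullMap b m x)) hx

/-- The part of X in the image is nonempty, open since φ_0 is locally open over X, and relatively
closed since X lies in the unit locus, where the image is closed; and X is connected. -/
theorem regularLocus_subset_range (hg : IsNullMetric b m g) (hη : η.det ≠ 0) :
    regularLocus g η ⊆ Set.range (nullMap b m) := by
  set X := regularLocus g η with hX
  have hopen : IsOpen (X ∩ Set.range (nullMap b m)) := by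
    rw [isOpen_iff_mem_nhds]
    rintro _ ⟨hx, x, rfl⟩
    exact inter_mem ((isOpen_regularLocus g η).mem_nhds hx)
      (le_map_nhds (analyticAt_nullMap b m x) (det_jacobian_ne_zero hg hx)
        (mem_map.2 (univ_mem' Set.mem_range_self)))
  obtain ⟨x, hx⟩ := (isPathConnected_preimage_regularLocus hg hη).nonempty
  refine ((isPathConnected_regularLocus hg hη).isConnected.isPreconnected.subset_of_closure_inter_subset
    hopen ⟨_, hx, hx, x, rfl⟩ ?_).trans Set.inter_subset_right
  rintro p ⟨hpcl, hp⟩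
  exact ⟨hp, mem_range_nullMap_of_mem_closure b m (regularLocus_subset_unitLocus hg hp)
    (closure_mono Set.inter_subset_right hpcl)⟩

end

end AffineWeylMonodromy

namespace AffineWeylMonodromy

noncomputable section

variable {ι V N : Type*} [NormedAddCommGroup V] [InnerProductSpace ℝ V]
  [AddCommGroup N] [Module ℝ N] {P : RootPairing ι ℝ V N}
  [IsEuclidean P] [P.IsRootSystem] [P.IsCrystallographic] [Finite ι] [P.IsReduced]
  [DecidableEq ι]

/-! ### The complexified Weyl group -/

/-- The matrix of `w` on the complexification of `V`. -/
def complexWeylMatrix (b : P.Base) (w : P.weylGroup) : Matrix b.support b.support ℂ :=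
  (weylMatrix b w).map (Int.castRingHom ℂ)

theorem complexWeylMatrix_one (b : P.Base) : complexWeylMatrix b 1 = 1 := by
  rw [complexWeylMatrix, weylMatrix_one, Matrix.map_one _ (map_zero _) (map_one _)]

theorem complexWeylMatrix_mul (b : P.Base) (w w' : P.weylGroup) :
    complexWeylMatrix b (w * w') = complexWeylMatrix b w * complexWeylMatrix b w' := by
  rw [complexWeylMatrix, weylMatrix_mul, Matrix.map_mul]
  rfl

theorem affineMap_eq (b : P.Base) (k : b.support → ℤ) (w : P.weylGroup) (x : b.support → ℂ) :
    affineMap b k w x = (complexWeylMatrix b w).mulVec x + fun j => (k j : ℂ) := rfl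

theorem complexWeylMatrix_injective (b : P.Base) :
    Function.Injective (complexWeylMatrix b) := by
  intro w w' h
  have h' : weylMatrix b w = weylMatrix b w' := by
    ext i j
    have hij : ((weylMatrix b w i j : ℤ) : ℂ) = weylMatrix b w' i j := congrFun (congrFun h i) j
    exact_mod_cast hij
  refine weylGroup_ext fun v => ?_
  rw [← sum_inner_fundWeight_smul_corootVec b v, Finset.smul_sum, Finset.smul_sum]
  refine Finset.sum_congr rfl fun k _ => ?_
  rw [smul_comm w, smul_comm w', smul_corootVec, smul_corootVec, h']

theorem hasFDerivAt_affineMap (b : P.Base) (k : b.support → ℤ) (w : P.weylGroup)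
    (x : b.support → ℂ) :
    HasFDerivAt (affineMap b k w)
      (Matrix.mulVecLin (complexWeylMatrix b w)).toContinuousLinearMap x :=
  (Matrix.mulVecLin (complexWeylMatrix b w)).toContinuousLinearMap.hasFDerivAt.add_const _

theorem jacobian_affineMap (b : P.Base) (k : b.support → ℤ) (w : P.weylGroup)
    (x : b.support → ℂ) : jacobian (affineMap b k w) x = complexWeylMatrix b w := by
  refine Matrix.ext_of_mulVec_single fun r => ?_
  rw [jacobian_mulVec (hasFDerivAt_affineMap b k w x).differentiableAt,
    (hasFDerivAt_affineMap b k w x).fderiv]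
  rfl

theorem transpose_mul_gram_mul (b : P.Base) (w : P.weylGroup) :
    (complexWeylMatrix b w).transpose * (gram b).map Complex.ofReal * complexWeylMatrix b w =
      (gram b).map Complex.ofReal := by
  have h : ((weylMatrix b w).map (Int.castRingHom ℝ)).transpose * gram b *
      (weylMatrix b w).map (Int.castRingHom ℝ) = gram b := by
    ext i j
    change _ = inner ℝ (corootVec P i) (corootVec P j)
    rw [← inner_smul_smul w (corootVec P i), smul_corootVec, smul_corootVec, sum_inner,
      Matrix.mul_assoc, Matrix.mul_apply]
    refine Finset.sum_congr rfl fun k _ => ?_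
    rw [inner_sum, Matrix.mul_apply, Finset.mul_sum]
    refine Finset.sum_congr rfl fun l _ => ?_
    rw [inner_smul_left, inner_smul_right]
    simp only [gram, Matrix.of_apply, Matrix.transpose_apply, Matrix.map_apply, eq_intCast,
      map_intCast]
    ring
  have h' := congrArg (fun A : Matrix b.support b.support ℝ => A.map Complex.ofRealHom) h
  simp only [Matrix.map_mul] at h'
  convert! h' using 3

theorem sum_gram_mul_eq (b : P.Base) (x y : b.support → ℂ) :
    ∑ i, ∑ j, (gram b i j : ℂ) * x i * y j =
      x ⬝ᵥ ((gram b).map Complex.ofReal).mulVec y := by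
  simp only [dotProduct, Matrix.mulVec, Finset.mul_sum, Matrix.map_apply]
  refine Finset.sum_congr rfl fun i _ => Finset.sum_congr rfl fun j _ => ?_
  ring

/-! ### The action of the stabilizer group -/

variable {b : P.Base} {m : b.support → ℕ}

/-- The affine transformation given by an element of the stabilizer group. -/
def stabMap (s : StabAffineGroup b m) : (b.support → ℂ) → (b.support → ℂ) :=
  affineMap b s.left.toAdd (s.right : P.weylGroup)

theorem stabMap_one (x : b.support → ℂ) : stabMap (1 : StabAffineGroup b m) x = x :=
  affineMap_zero_one b x

theorem stabMap_mul (s t : StabAffineGroup b m) (x : b.support → ℂ) :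
    stabMap (s * t) x = stabMap s (stabMap t x) :=
  (affineMap_affineMap b _ _ _ _ x).symm

theorem nullMap_stabMap (s : StabAffineGroup b m) (x : b.support → ℂ) :
    nullMap b m (stabMap s x) = nullMap b m x :=
  nullMap_affineMap b m _ s.right.2 x

theorem exists_stabMap_of_nullMap_eq {x x' : b.support → ℂ}
    (h : nullMap b m x = nullMap b m x') : ∃ s : StabAffineGroup b m, stabMap s x = x' := by
  obtain ⟨k, w, hw, h⟩ := exists_affineMap_of_nullMap_eq b m h
  exact ⟨⟨Multiplicative.ofAdd k, ⟨w, hw⟩⟩, h⟩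

theorem hasFDerivAt_stabMap (s : StabAffineGroup b m) (x : b.support → ℂ) :
    HasFDerivAt (stabMap s)
      (Matrix.mulVecLin (complexWeylMatrix b (s.right : P.weylGroup))).toContinuousLinearMap x :=
  hasFDerivAt_affineMap b _ _ x

theorem continuous_stabMap (s : StabAffineGroup b m) : Continuous (stabMap s) :=
  continuous_iff_continuousAt.2 fun x => (hasFDerivAt_stabMap s x).continuousAt

/-- Differentiating φ_0 ∘ s = φ_0 at the fixed point and cancelling the Jacobian shows that the
linear part of s is the identity; a translation with a fixed point is trivial. -/
theorem eq_one_of_stabMap_eq {s : StabAffineGroup b m} {x : b.support → ℂ}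
    (hx : (jacobian (nullMap b m) x).det ≠ 0) (h : stabMap s x = x) : s = 1 := by
  have hJ : jacobian (nullMap b m) x * complexWeylMatrix b (s.right : P.weylGroup) =
      jacobian (nullMap b m) x := by
    have h1 := jacobian_comp (φ := nullMap b m) (hasFDerivAt_stabMap s x).differentiableAt
      (analyticAt_nullMap b m _).differentiableAt
    simp only [nullMap_stabMap] at h1
    rw [h] at h1
    exact (h1.trans (congrArg _ (jacobian_affineMap b _ _ x))).symm
  have hM : complexWeylMatrix b (s.right : P.weylGroup) = 1 := by
    have hu := isUnit_iff_ne_zero.2 hx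
    rw [← Matrix.nonsing_inv_mul_cancel_left (A := jacobian (nullMap b m) x)
      (complexWeylMatrix b (s.right : P.weylGroup)) hu, hJ, Matrix.nonsing_inv_mul _ hu]
  have hw : (s.right : P.weylGroup) = 1 :=
    complexWeylMatrix_injective b (hM.trans (complexWeylMatrix_one b).symm)
  refine SemidirectProduct.ext ?_ (Subtype.ext hw)
  funext j
  have h2 := congrFun h j
  rw [stabMap, affineMap_eq, hM, Matrix.one_mulVec, Pi.add_apply, add_eq_left] at h2
  exact Int.cast_eq_zero.1 h2

instance stabAction (X : Set (b.support → ℂ)) :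
    MulAction (StabAffineGroup b m) (nullMap b m ⁻¹' X) where
  smul s y := ⟨stabMap s y, by
    rw [Set.mem_preimage, nullMap_stabMap]
    exact y.2⟩
  one_smul y := Subtype.ext (stabMap_one _)
  mul_smul s t y := Subtype.ext (stabMap_mul s t _)

theorem coe_stab_smul {X : Set (b.support → ℂ)} (s : StabAffineGroup b m)
    (y : nullMap b m ⁻¹' X) : ((s • y : nullMap b m ⁻¹' X) : b.support → ℂ) = stabMap s y := rfl

/-! ### Isometries -/

/-- The affine automorphism given by an element of the stabilizer group. -/
def stabAffineEquiv (s : StabAffineGroup b m) : (b.support → ℂ) ≃ᵃ[ℂ] (b.support → ℂ) where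
  toFun := stabMap s
  invFun := stabMap s⁻¹
  left_inv x := by rw [← stabMap_mul, inv_mul_cancel, stabMap_one]
  right_inv x := by rw [← stabMap_mul, mul_inv_cancel, stabMap_one]
  linear := Matrix.toLin'OfInv
    (M := complexWeylMatrix b (s.right : P.weylGroup)⁻¹)
    (M' := complexWeylMatrix b (s.right : P.weylGroup))
    (by rw [← complexWeylMatrix_mul, inv_mul_cancel, complexWeylMatrix_one])
    (by rw [← complexWeylMatrix_mul, mul_inv_cancel, complexWeylMatrix_one])
  map_vadd' x v := by
    change affineMap b _ _ (v + x) = (complexWeylMatrix b _).mulVec v + affineMap b _ _ x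
    rw [affineMap_eq, affineMap_eq, Matrix.mulVec_add, add_assoc]

theorem stabAffineEquiv_linear (s : StabAffineGroup b m) (x : b.support → ℂ) :
    (stabAffineEquiv s).linear x = (complexWeylMatrix b (s.right : P.weylGroup)).mulVec x := rfl

theorem stabAffineEquiv_mem_complexIsometry (s : StabAffineGroup b m) :
    stabAffineEquiv s ∈ complexIsometry b := by
  intro x y
  rw [sum_gram_mul_eq, sum_gram_mul_eq, stabAffineEquiv_linear, stabAffineEquiv_linear]
  conv_rhs => rw [← transpose_mul_gram_mul b (s.right : P.weylGroup)]
  rw [← Matrix.mulVec_mulVec, ← Matrix.mulVec_mulVec, Matrix.dotProduct_mulVec x,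
    Matrix.vecMul_transpose]

/-- The isometry given by an element of the stabilizer group. -/
def stabIsometry (b : P.Base) (m : b.support → ℕ) : StabAffineGroup b m →* complexIsometry b where
  toFun s := ⟨stabAffineEquiv s, stabAffineEquiv_mem_complexIsometry s⟩
  map_one' := Subtype.ext (AffineEquiv.ext fun x => stabMap_one x)
  map_mul' s t := Subtype.ext (AffineEquiv.ext fun x => stabMap_mul s t x)

theorem stabIsometry_apply (s : StabAffineGroup b m) (x : b.support → ℂ) :
    (stabIsometry b m s : (b.support → ℂ) ≃ᵃ[ℂ] (b.support → ℂ)) x = stabMap s x := rfl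

theorem stabIsometry_injective (b : P.Base) (m : b.support → ℕ) :
    Function.Injective (stabIsometry b m) := by
  obtain ⟨x, hx⟩ := exists_det_nullJacobian_ne_zero b m
  refine (injective_iff_map_eq_one _).2 fun s hs => eq_one_of_stabMap_eq hx ?_
  rw [← stabIsometry_apply, hs]
  rfl

/-! ### The covering of the regular locus -/

variable {g η : Matrix b.support b.support (MvPolynomial b.support ℂ)}

/-- The null transformation over the regular locus. -/
def nullCovering (b : P.Base) (m : b.support → ℕ) (X : Set (b.support → ℂ)) :
    nullMap b m ⁻¹' X → X :=
  X.restrictPreimage (nullMap b m)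

theorem isOpenMap_nullCovering (hg : IsNullMetric b m g) :
    IsOpenMap (nullCovering b m (regularLocus g η)) := by
  rw [isOpenMap_iff_nhds_le]
  intro y
  have hy : nullMap b m y ∈ regularLocus g η := y.2
  have h := le_map_nhds (analyticAt_nullMap b m y) (det_jacobian_ne_zero hg hy)
  have hX := isOpen_regularLocus g η
  have hY : IsOpen (nullMap b m ⁻¹' regularLocus g η) := hX.preimage (continuous_nullMap b m)
  rw [← map_le_map_iff Subtype.val_injective, hX.isOpenEmbedding_subtypeVal.map_nhds_eq, map_map]
  refine h.trans (le_of_eq ?_)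
  rw [← hY.isOpenEmbedding_subtypeVal.map_nhds_eq, map_map]
  rfl

theorem nullCovering_surjective (hg : IsNullMetric b m g) (hη : η.det ≠ 0) :
    Function.Surjective (nullCovering b m (regularLocus g η)) := by
  intro p
  obtain ⟨x, hx⟩ := regularLocus_subset_range hg hη p.2
  exact ⟨⟨x, by rw [Set.mem_preimage, hx]; exact p.2⟩, Subtype.ext hx⟩

/-- On the set where a local inverse of φ_0 recovers the point, two points of one fibre coincide. If
u and its translate both lie there, the group element fixes u. -/
theorem exists_nhds_stab_smul_disjoint (hg : IsNullMetric b m g)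
    (y : nullMap b m ⁻¹' regularLocus g η) : ∃ U ∈ 𝓝 y, ∀ s : StabAffineGroup b m,
      ((s • ·) '' U ∩ U).Nonempty → s = 1 := by
  have hy : nullMap b m y ∈ regularLocus g η := y.2
  obtain ⟨s, -, -, -, hs⟩ := exists_local_inverse (analyticAt_nullMap b m y)
    (det_jacobian_ne_zero hg hy)
  refine ⟨{u | s (nullMap b m u) = u}, continuous_subtype_val.continuousAt hs, ?_⟩
  rintro a ⟨_, ⟨u, hu, rfl⟩, hau⟩
  have hu' : nullMap b m u ∈ regularLocus g η := u.2
  refine eq_one_of_stabMap_eq (det_jacobian_ne_zero hg hu') ?_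
  have h1 : s (nullMap b m (stabMap a u)) = stabMap a u := hau
  rw [nullMap_stabMap] at h1
  exact h1.symm.trans hu

theorem isQuotientCoveringMap_nullCovering (hg : IsNullMetric b m g) (hη : η.det ≠ 0) :
    IsQuotientCoveringMap (nullCovering b m (regularLocus g η)) (StabAffineGroup b m) where
  toIsQuotientMap := (isOpenMap_nullCovering hg).isQuotientMap
    (continuous_nullMap b m).restrictPreimage (nullCovering_surjective hg hη)
  continuous_const_smul s :=
    ((continuous_stabMap s).comp continuous_subtype_val).subtype_mk _
  apply_eq_iff_mem_orbit {x y} := by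
    constructor
    · intro h
      have h' : nullMap b m y = nullMap b m x := (congrArg Subtype.val h).symm
      obtain ⟨s, hs⟩ := exists_stabMap_of_nullMap_eq h'
      exact ⟨s, Subtype.ext hs⟩
    · rintro ⟨s, rfl⟩
      exact Subtype.ext (nullMap_stabMap s _)
  disjoint := exists_nhds_stab_smul_disjoint hg

end

end AffineWeylMonodromy

namespace AffineWeylMonodromy

noncomputable section

/-! ### Analytic continuation along lifted paths -/

/-- For s near t, both F s and F t are sections of φ through the same point Γ(s), and φ is locally
injective there. -/
theorem isContinuation_of_lift {J : Type*} [Fintype J] [DecidableEq J] {φ : (J → ℂ) → (J → ℂ)}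
    (hφ : Continuous φ) {Γ : unitInterval → (J → ℂ)} (hΓ : Continuous Γ)
    {F : unitInterval → (J → ℂ) → (J → ℂ)} (hF : ∀ t, AnalyticAt ℂ (F t) (φ (Γ t)))
    (hval : ∀ t, F t (φ (Γ t)) = Γ t) (hsec : ∀ t, ∀ᶠ p in 𝓝 (φ (Γ t)), φ (F t p) = p)
    (hinv : ∀ t, ∀ᶠ x in 𝓝 (Γ t), F t (φ x) = x) :
    IsContinuation (fun t => φ (Γ t)) F := by
  refine fun t => ⟨hF t, ?_⟩
  have hc : ContinuousAt (fun t => φ (Γ t)) t := (hφ.comp hΓ).continuousAt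
  filter_upwards [hc.eventually (hF t).eventually_analyticAt,
    hc.eventually (eventually_eventually_nhds.2 (hsec t)),
    hΓ.continuousAt.eventually (hinv t)] with s h1 h2 h3
  refine eventuallyEq_of_section (hF s).continuousAt h1.continuousAt ((hval s).trans h3.symm)
    (hsec s) h2 (s := F s) ?_
  rw [hval s]
  exact hinv s

/-- Affine automorphisms which agree near a point are equal. -/
theorem affineEquiv_eq_of_eventuallyEq {J : Type*} [Fintype J]
    {A B : (J → ℂ) ≃ᵃ[ℂ] (J → ℂ)} {y : J → ℂ} (h : ∀ᶠ x in 𝓝 y, A x = B x) : A = B := by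
  have han : ∀ A : (J → ℂ) ≃ᵃ[ℂ] (J → ℂ), AnalyticOnNhd ℂ (fun x => A x) Set.univ := by
    intro A x _
    have hA : (fun x => A x) =
        fun x => (A.linear : (J → ℂ) →ₗ[ℂ] (J → ℂ)).toContinuousLinearMap x + A 0 := by
      funext x
      have := A.map_vadd 0 x
      rwa [vadd_eq_add, add_zero] at this
    rw [hA]
    exact (ContinuousLinearMap.analyticAt _ _).add analyticAt_const
  exact AffineEquiv.ext fun x => congrFun ((han A).eq_of_eventuallyEq (han B) h) x

variable {ι V N : Type*} [NormedAddCommGroup V] [InnerProductSpace ℝ V]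
  [AddCommGroup N] [Module ℝ N] {P : RootPairing ι ℝ V N}
  [IsEuclidean P] [P.IsRootSystem] [P.IsCrystallographic] [Finite ι] [P.IsReduced]
  [DecidableEq ι]
variable {b : P.Base} {m : b.support → ℕ}
  {g η : Matrix b.support b.support (MvPolynomial b.support ℂ)}
  {x : (b.support → ℂ) → (b.support → ℂ)}

/-! ### Branches of the inverse of the null transformation -/

theorem exists_nullBranch (hg : IsNullMetric b m g) (hη : η.det ≠ 0) (p₀ : regularLocus g η) :
    ∃ x, AnalyticAt ℂ x (p₀ : b.support → ℂ) ∧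
      ∀ᶠ p in 𝓝 (p₀ : b.support → ℂ), nullMap b m (x p) = p := by
  obtain ⟨y, hy⟩ := regularLocus_subset_range hg hη p₀.2
  have hmem : nullMap b m y ∈ regularLocus g η := by
    rw [hy]
    exact p₀.2
  obtain ⟨s, hs, -, hsec, -⟩ := exists_local_inverse (analyticAt_nullMap b m y)
    (det_jacobian_ne_zero hg hmem)
  rw [hy] at hs hsec
  exact ⟨s, hs, hsec⟩

/-- A branch coincides with the local inverse of φ_0 at x(p₀), so it is a two-sided inverse and its
values fill a neighbourhood of x(p₀). -/
theorem eventually_nullBranch_nullMap (hg : IsNullMetric b m g) {p₀ : regularLocus g η}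
    (hx : AnalyticAt ℂ x (p₀ : b.support → ℂ))
    (hsec : ∀ᶠ p in 𝓝 (p₀ : b.support → ℂ), nullMap b m (x p) = p) :
    ∀ᶠ y in 𝓝 (x p₀), x (nullMap b m y) = y := by
  have hp : nullMap b m (x p₀) = p₀ := hsec.self_of_nhds
  have hmem : nullMap b m (x p₀) ∈ regularLocus g η := by
    rw [hp]
    exact p₀.2
  obtain ⟨s, hs, hsy, hsec', hinv⟩ := exists_local_inverse (analyticAt_nullMap b m (x p₀))
    (det_jacobian_ne_zero hg hmem)
  rw [hp] at hs hsy hsec'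
  have heq : x =ᶠ[𝓝 (p₀ : b.support → ℂ)] s :=
    eventuallyEq_of_section hx.continuousAt hs.continuousAt hsy.symm hsec hsec' hinv
  rw [← hp] at heq
  filter_upwards [hinv, (continuous_nullMap b m).continuousAt.eventually heq] with y h1 h2
  rw [h2, h1]

theorem jacobian_nullMap_mul_jacobian {p : b.support → ℂ} (hx : AnalyticAt ℂ x p)
    (hsec : ∀ᶠ q in 𝓝 p, nullMap b m (x q) = q) :
    jacobian (nullMap b m) (x p) * jacobian x p = 1 := by
  rw [← jacobian_comp hx.differentiableAt (analyticAt_nullMap b m _).differentiableAt,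
    jacobian_congr hsec, jacobian_id]

theorem isFlatCoordinates_nullBranch (hg : IsNullMetric b m g) {p₀ : b.support → ℂ}
    (hx : AnalyticAt ℂ x p₀) (hsec : ∀ᶠ p in 𝓝 p₀, nullMap b m (x p) = p) :
    IsFlatCoordinates b (metricAt g) x p₀ := by
  set c : ℂ := 1 / (4 * Real.pi ^ 2) with hc
  have hc0 : c ≠ 0 := by simp [hc, Real.pi_ne_zero]
  have hinv : ∀ᶠ q in 𝓝 p₀, (metricAt g q)⁻¹ = (jacobian x q).transpose *
      (c⁻¹ • (gram b).map Complex.ofReal) * jacobian x q := by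
    filter_upwards [hx.eventually_analyticAt, eventually_eventually_nhds.2 hsec] with q h1 h2
    have hJ := jacobian_nullMap_mul_jacobian h1 h2
    have hq : metricAt g q = c • (jacobian (nullMap b m) (x q) * flatMetric b *
        (jacobian (nullMap b m) (x q)).transpose) := by
      rw [← hg (x q), h2.self_of_nhds]
    refine Matrix.inv_eq_right_inv ?_
    have hT : (jacobian (nullMap b m) (x q)).transpose * (jacobian x q).transpose = 1 := by
      rw [← Matrix.transpose_mul, mul_eq_one_comm.1 hJ, Matrix.transpose_one]
    rw [hq, Matrix.smul_mul, Matrix.mul_smul, Matrix.smul_mul, Matrix.mul_smul, smul_smul,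
      mul_inv_cancel₀ hc0, one_smul]
    calc _ = jacobian (nullMap b m) (x q) * (flatMetric b *
          ((jacobian (nullMap b m) (x q)).transpose * (jacobian x q).transpose) *
          (gram b).map Complex.ofReal) * jacobian x q := by simp only [Matrix.mul_assoc]
      _ = 1 := by
        rw [hT, Matrix.mul_one, mul_eq_one_comm.1 (gram_mul_flatMetric b), Matrix.mul_one, hJ]
  have hmet : ∀ᶠ q in 𝓝 p₀, jacobian x q * metricAt g q * (jacobian x q).transpose =
      c • flatMetric b := by
    filter_upwards [hx.eventually_analyticAt, eventually_eventually_nhds.2 hsec] with q h1 h2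
    have hJ := mul_eq_one_comm.1 (jacobian_nullMap_mul_jacobian h1 h2)
    have hq : metricAt g q = c • (jacobian (nullMap b m) (x q) * flatMetric b *
        (jacobian (nullMap b m) (x q)).transpose) := by
      rw [← hg (x q), h2.self_of_nhds]
    have hT : (jacobian (nullMap b m) (x q)).transpose * (jacobian x q).transpose = 1 := by
      rw [← Matrix.transpose_mul, hJ, Matrix.transpose_one]
    rw [hq, Matrix.mul_smul, Matrix.smul_mul]
    congr 1
    calc _ = (jacobian x q * jacobian (nullMap b m) (x q)) * flatMetric b *
          ((jacobian (nullMap b m) (x q)).transpose * (jacobian x q).transpose) := by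
          simp only [Matrix.mul_assoc]
      _ = flatMetric b := by rw [hJ, hT, Matrix.mul_one, Matrix.one_mul]
  refine ⟨hx, ?_, ?_⟩
  · filter_upwards [hx.eventually_analyticAt, eventually_eventually_nhds.2 hinv, hmet]
      with q h1 h2 h3 u i j
    refine pd_pd_eq_sum_christoffel (C := c⁻¹ • (gram b).map Complex.ofReal)
      (A := c • flatMetric b) (fun u => analyticAt_pi_iff.1 h1 u) ?_ ?_ h2 h3 u i j
    · ext i j
      simp [gram_symm b i j]
    · rw [Matrix.smul_mul, Matrix.mul_smul, smul_smul, mul_inv_cancel₀ hc0, one_smul,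
        mul_eq_one_comm.1 (gram_mul_flatMetric b)]
  · filter_upwards [hmet] with q hq i j
    have h := congrFun (congrFun hq i) j
    rw [Matrix.smul_apply, smul_eq_mul, Matrix.mul_apply] at h
    rw [← h]
    simp only [Matrix.mul_apply, Matrix.transpose_apply, jacobian, Matrix.of_apply,
      Finset.sum_mul]
    rw [Finset.sum_comm]

/-! ### Monodromy -/

/-- The homomorphism from the fundamental group of the base of a regular covering to its group. -/
def coveringMonodromy {E X G : Type*} [TopologicalSpace E] [TopologicalSpace X] [Group G]
    [MulAction G E] {φ : E → X} (hp : IsQuotientCoveringMap φ G) {p₀ : X} (e : φ ⁻¹' {p₀}) :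
    (FundamentalGroup X p₀)ᵐᵒᵖ →* G where
  toFun γ := (hp.fundamentalGroupToMulOpposite e γ.unop).unop
  map_one' := by rw [MulOpposite.unop_one, map_one, MulOpposite.unop_one]
  map_mul' γ γ' := by rw [MulOpposite.unop_mul, map_mul, MulOpposite.unop_mul]

theorem coveringMonodromy_surjective {E X G : Type*} [TopologicalSpace E] [TopologicalSpace X]
    [Group G] [MulAction G E] [PathConnectedSpace E] {φ : E → X}
    (hp : IsQuotientCoveringMap φ G) {p₀ : X} (e : φ ⁻¹' {p₀}) :
    Function.Surjective (coveringMonodromy hp e) := by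
  intro a
  obtain ⟨γ, hγ⟩ := hp.fundamentalGroupToMulOpposite_surjective e (MulOpposite.op a)
  exact ⟨MulOpposite.op γ, congrArg MulOpposite.unop hγ⟩

theorem exists_lift_coveringMonodromy {E X G : Type*} [TopologicalSpace E] [TopologicalSpace X]
    [Group G] [MulAction G E] {φ : E → X} (hp : IsQuotientCoveringMap φ G) {p₀ : X}
    (e : φ ⁻¹' {p₀}) (γ : Path p₀ p₀) : ∃ Γ : unitInterval → E, Continuous Γ ∧
      (∀ t, φ (Γ t) = γ t) ∧ Γ 0 = e ∧ Γ 1 = coveringMonodromy hp e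
        (MulOpposite.op (FundamentalGroup.fromPath (Path.Homotopic.Quotient.mk γ))) • (e : E) := by
  have h0 : γ.toContinuousMap 0 = φ e := γ.source.trans (Eq.symm e.2)
  exact ⟨hp.isCoveringMap.liftPath γ.toContinuousMap e h0, ContinuousMap.continuous _,
    fun t => congrFun (hp.isCoveringMap.liftPath_lifts _ _ h0) t,
    hp.isCoveringMap.liftPath_zero _ _ h0,
    (hp.unop_fundamentalGroupToMulOpposite_smul (e := e)
      (γ := FundamentalGroup.fromPath (Path.Homotopic.Quotient.mk γ))).symm⟩

/-- The local inverses of φ_0 along the lift of γ from x(p₀) form a continuation. The lift ends at a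
· x(p₀), and the section through that point is a ∘ x; uniqueness of continuation covers all other
choices. -/
theorem isMonodromy_comp_coveringMonodromy (hg : IsNullMetric b m g) (hη : η.det ≠ 0)
    {p₀ : regularLocus g η} (hx : AnalyticAt ℂ x (p₀ : b.support → ℂ))
    (hsec : ∀ᶠ p in 𝓝 (p₀ : b.support → ℂ), nullMap b m (x p) = p)
    (e : nullCovering b m (regularLocus g η) ⁻¹' {p₀})
    (he : ((e : nullMap b m ⁻¹' regularLocus g η) : b.support → ℂ) = x p₀) :
    IsMonodromy x ((stabIsometry b m).comp
      (coveringMonodromy (isQuotientCoveringMap_nullCovering hg hη) e)) := by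
  intro γ
  obtain ⟨Γ, hΓ, hlift, hΓ0, hΓ1⟩ :=
    exists_lift_coveringMonodromy (isQuotientCoveringMap_nullCovering hg hη) e γ
  set a := coveringMonodromy (isQuotientCoveringMap_nullCovering hg hη) e
    (MulOpposite.op (FundamentalGroup.fromPath (Path.Homotopic.Quotient.mk γ))) with ha
  have hlift' : ∀ t, nullMap b m (Γ t) = γ t := fun t => congrArg Subtype.val (hlift t)
  have h0 : (Γ 0 : b.support → ℂ) = x p₀ := (congrArg Subtype.val hΓ0).trans he
  have h1 : (Γ 1 : b.support → ℂ) = stabMap a (x p₀) := by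
    rw [hΓ1, coe_stab_smul, he]
  have hloc : ∀ t, ∃ s : (b.support → ℂ) → (b.support → ℂ),
      AnalyticAt ℂ s (nullMap b m (Γ t)) ∧ s (nullMap b m (Γ t)) = Γ t ∧
      (∀ᶠ p in 𝓝 (nullMap b m (Γ t)), nullMap b m (s p) = p) ∧
      ∀ᶠ y in 𝓝 (Γ t : b.support → ℂ), s (nullMap b m y) = y := by
    intro t
    have hmem : nullMap b m (Γ t) ∈ regularLocus g η := (Γ t).2
    exact exists_local_inverse (analyticAt_nullMap b m _) (det_jacobian_ne_zero hg hmem)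
  choose F hF hval hFsec hinv using hloc
  have hcont : IsContinuation (fun t => (γ t : b.support → ℂ)) F := by
    have h := isContinuation_of_lift (continuous_nullMap b m)
      (continuous_subtype_val.comp hΓ) hF hval hFsec hinv
    have hγ : (fun t => nullMap b m ((Subtype.val ∘ Γ) t)) =
        fun t => (γ t : b.support → ℂ) := funext hlift'
    rwa [hγ] at h
  have hγ0 : nullMap b m (Γ 0) = p₀ := by rw [hlift', γ.source]
  have hγ1 : nullMap b m (Γ 1) = p₀ := by rw [hlift', γ.target]
  have hF0 := hF 0
  have hF1 := hF 1
  have hv0 := hval 0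
  have hv1 := hval 1
  have hs0 := hFsec 0
  have hs1 := hFsec 1
  rw [hγ0] at hF0 hv0 hs0
  rw [hγ1] at hF1 hv1 hs1
  have hx0 : F 0 =ᶠ[𝓝 (p₀ : b.support → ℂ)] x :=
    eventuallyEq_of_section hF0.continuousAt hx.continuousAt (hv0.trans h0) hs0 hsec
      (by rw [hv0]; exact hinv 0)
  have hx1 : F 1 =ᶠ[𝓝 (p₀ : b.support → ℂ)] fun p => stabMap a (x p) := by
    refine eventuallyEq_of_section hF1.continuousAt
      ((continuous_stabMap a).continuousAt.comp hx.continuousAt) (hv1.trans h1) hs1 ?_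
      (by rw [hv1]; exact hinv 1)
    filter_upwards [hsec] with p hp
    rw [nullMap_stabMap, hp]
  refine ⟨⟨F, hcont, hx0⟩, fun F' hF' hF'0 => ?_⟩
  have hγc : Continuous fun t => (γ t : b.support → ℂ) := continuous_subtype_val.comp γ.continuous
  have h := hF'.eventuallyEq hγc hcont (by
    rw [γ.source]
    exact hF'0.trans hx0.symm) 1
  rw [γ.target] at h
  exact h.trans hx1

/-- Both isometries describe the same continued germ, so they agree on the open set filled by the
values of x, and affine maps are determined there. -/
theorem IsMonodromy.unique (hg : IsNullMetric b m g) {p₀ : regularLocus g η}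
    (hx : AnalyticAt ℂ x (p₀ : b.support → ℂ))
    (hsec : ∀ᶠ p in 𝓝 (p₀ : b.support → ℂ), nullMap b m (x p) = p)
    {r r' : (FundamentalGroup (regularLocus g η) p₀)ᵐᵒᵖ →* complexIsometry b}
    (hr : IsMonodromy x r) (hr' : IsMonodromy x r') : r = r' := by
  ext1 q
  obtain ⟨γ, hγ⟩ := Path.Homotopic.Quotient.mk_surjective (FundamentalGroup.toPath q.unop)
  obtain rfl : q = MulOpposite.op (FundamentalGroup.fromPath (Path.Homotopic.Quotient.mk γ)) :=
    congrArg MulOpposite.op hγ.symm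
  obtain ⟨⟨F, hF, hF0⟩, huniq⟩ := hr γ
  have h := (huniq F hF hF0).symm.trans ((hr' γ).2 F hF hF0)
  have hp : nullMap b m (x p₀) = p₀ := hsec.self_of_nhds
  rw [← hp] at h
  refine Subtype.ext (affineEquiv_eq_of_eventuallyEq (y := x p₀) ?_)
  filter_upwards [eventually_nullBranch_nullMap hg hx hsec,
    (continuous_nullMap b m).continuousAt.eventually h] with y h1 h2
  rwa [h1] at h2

/-! ### The image of the monodromy representation -/

/-- For a deck isometry A, the points Ay and y share a fibre, so Ay = sy for some s in the group.
Both A and s lift φ_0 through this point, so they agree near y and hence everywhere, being affine.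
-/
theorem mem_range_stabIsometry_iff (hg : IsNullMetric b m g) (hη : η.det ≠ 0)
    (A : complexIsometry b) : A ∈ (stabIsometry b m).range ↔
      IsDeck (nullMap b m) (regularLocus g η) (A : (b.support → ℂ) ≃ᵃ[ℂ] (b.support → ℂ)) := by
  constructor
  · rintro ⟨s, rfl⟩
    have := (isQuotientCoveringMap_nullCovering hg hη).toContinuousConstSMul
    exact ⟨Homeomorph.smul s, fun y => ⟨nullMap_stabMap s y, rfl⟩⟩
  · rintro ⟨h, hh⟩
    obtain ⟨y, hy⟩ := (isPathConnected_preimage_regularLocus hg hη).nonempty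
    have hA : ∀ y ∈ nullMap b m ⁻¹' regularLocus g η,
        nullMap b m ((A : (b.support → ℂ) ≃ᵃ[ℂ] (b.support → ℂ)) y) = nullMap b m y :=
      fun y hy => by rw [(hh ⟨y, hy⟩).2, (hh ⟨y, hy⟩).1]
    obtain ⟨s, hs⟩ := exists_stabMap_of_nullMap_eq (hA y hy).symm
    refine ⟨s, Subtype.ext (affineEquiv_eq_of_eventuallyEq (y := y) ?_)⟩
    have hopen : IsOpen (nullMap b m ⁻¹' regularLocus g η) :=
      (isOpen_regularLocus g η).preimage (continuous_nullMap b m)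
    have hmem : nullMap b m (stabMap s y) ∈ regularLocus g η := by
      rw [nullMap_stabMap]
      exact hy
    obtain ⟨σ, -, -, -, hσ⟩ := exists_local_inverse (analyticAt_nullMap b m _)
      (det_jacobian_ne_zero hg hmem)
    have hAc : Continuous (A : (b.support → ℂ) ≃ᵃ[ℂ] (b.support → ℂ)) :=
      AffineMap.continuous_of_finiteDimensional
        ((A : (b.support → ℂ) ≃ᵃ[ℂ] (b.support → ℂ)) : (b.support → ℂ) →ᵃ[ℂ] (b.support → ℂ))
    have hσ' := hσ
    rw [hs] at hσ'
    filter_upwards [(continuous_stabMap s).continuousAt.eventually hσ,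
      hAc.continuousAt.eventually hσ', hopen.mem_nhds hy] with u h1 h2 hu
    rw [nullMap_stabMap] at h1
    rw [hA u hu] at h2
    exact h1.symm.trans h2

/-- The inclusion of the stabilizer group in the affine Weyl group. -/
def stabInclusion (b : P.Base) (m : b.support → ℕ) : StabAffineGroup b m →* AffineWeylGroup b :=
  SemidirectProduct.map (MonoidHom.id _)
    (MulAction.stabilizer P.weylGroup (weight b m)).subtype fun _ => rfl

theorem stabInclusion_injective (b : P.Base) (m : b.support → ℕ) :
    Function.Injective (stabInclusion b m) := by
  intro s t h
  have hl : (stabInclusion b m s).left = (stabInclusion b m t).left := congrArg _ h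
  have hr : (stabInclusion b m s).right = (stabInclusion b m t).right := congrArg _ h
  exact SemidirectProduct.ext hl (Subtype.ext hr)

theorem mem_range_stabInclusion {s : AffineWeylGroup b} :
    s ∈ (stabInclusion b m).range ↔ s.right • weight b m = weight b m :=
  ⟨fun ⟨a, ha⟩ => ha ▸ a.right.2, fun h => ⟨⟨s.left, ⟨s.right, h⟩⟩, rfl⟩⟩

end

end AffineWeylMonodromy

/-! ### The monodromy theorem -/

theorem mainTheorem3 {ι V N : Type*} [Finite ι] [DecidableEq ι]
    [NormedAddCommGroup V] [InnerProductSpace ℝ V] [AddCommGroup N] [Module ℝ N]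
    (P : RootPairing ι ℝ V N) [P.IsRootSystem] [P.IsCrystallographic] [P.IsReduced]
    [P.IsIrreducible] [IsEuclidean P] (b : P.Base)
    (m : b.support → ℕ) (hm : m ≠ 0)
    (z : b.support → ℂ → (b.support → ℂ) → ℂ)
    (g η : Matrix b.support b.support (MvPolynomial b.support ℂ))
    (hz : IsPencilGenerators b m z g η) :
    IsPathConnected (regularLocus g η) ∧
    ∀ p₀ : regularLocus g η,
      (∃ x, IsNullBranch z x p₀) ∧
      ∀ x, IsNullBranch z x p₀ →
        IsFlatCoordinates b (metricAt g) x p₀ ∧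
        (∃ r : (FundamentalGroup (regularLocus g η) p₀)ᵐᵒᵖ →* complexIsometry b,
          IsMonodromy x r) ∧
        ∀ r : (FundamentalGroup (regularLocus g η) p₀)ᵐᵒᵖ →* complexIsometry b,
          IsMonodromy x r →
          (∀ A : complexIsometry b, A ∈ r.range ↔
            IsDeck (phi z 0) (regularLocus g η)
              (A : (b.support → ℂ) ≃ᵃ[ℂ] (b.support → ℂ))) ∧
          (∃ e : r.range ≃* StabAffineGroup b m, ∀ (A : r.range) (v : b.support → ℂ),
            ((A : complexIsometry b) : (b.support → ℂ) ≃ᵃ[ℂ] (b.support → ℂ)) v =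
              affineMap b (e A).left.toAdd (e A).right v) ∧
          (∃ f : r.range →* AffineWeylGroup b, Function.Injective f ∧
            (∀ s, s ∈ f.range ↔ s.right • weight b m = weight b m) ∧
            ∀ (A : r.range) (v : b.support → ℂ),
              ((A : complexIsometry b) : (b.support → ℂ) ≃ᵃ[ℂ] (b.support → ℂ)) v =
                affineMap b (f A).left.toAdd (f A).right v) := by
  have hφ := phi_zero_eq_nullMap hm hz
  have hg := isNullMetric_of_isPencilGenerators hm hz
  have hη := hz.generic
  refine ⟨isPathConnected_regularLocus hg hη, fun p₀ => ⟨?_, fun x hx => ?_⟩⟩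
  · obtain ⟨x, hx, hsec⟩ := exists_nullBranch hg hη p₀
    exact ⟨x, hx, by rwa [hφ]⟩
  obtain ⟨hx, hsec⟩ := hx
  rw [hφ] at hsec ⊢
  have hp : nullMap b m (x p₀) = p₀ := hsec.self_of_nhds
  have hmem : nullMap b m (x p₀) ∈ regularLocus g η := by
    rw [hp]
    exact p₀.2
  let e : nullCovering b m (regularLocus g η) ⁻¹' {p₀} := ⟨⟨x p₀, hmem⟩, Subtype.ext hp⟩
  have hmono := isMonodromy_comp_coveringMonodromy hg hη hx hsec e rfl
  refine ⟨isFlatCoordinates_nullBranch hg hx hsec, ⟨_, hmono⟩, fun r hr => ?_⟩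
  have : PathConnectedSpace (nullMap b m ⁻¹' regularLocus g η) :=
    isPathConnected_iff_pathConnectedSpace.1 (isPathConnected_preimage_regularLocus hg hη)
  -- By uniqueness r is the covering monodromy followed by the isometry action; the covering
  -- monodromy is onto because the total space is path connected.
  have hrange : r.range = (stabIsometry b m).range := by
    rw [IsMonodromy.unique hg hx hsec hr hmono, MonoidHom.range_comp,
      MonoidHom.range_eq_top.2 (coveringMonodromy_surjective _ e), ← MonoidHom.range_eq_map]
  let E : StabAffineGroup b m ≃* (stabIsometry b m).range :=
    MonoidHom.ofInjective (stabIsometry_injective b m)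
  let e' : r.range ≃* StabAffineGroup b m := (MulEquiv.subgroupCongr hrange).trans E.symm
  have he' : ∀ (A : r.range) (v : b.support → ℂ),
      ((A : complexIsometry b) : (b.support → ℂ) ≃ᵃ[ℂ] (b.support → ℂ)) v =
        stabMap (e' A) v := by
    intro A v
    have hA : stabIsometry b m (e' A) = A :=
      congrArg Subtype.val (E.apply_symm_apply (MulEquiv.subgroupCongr hrange A))
    rw [← hA, stabIsometry_apply]
  refine ⟨fun A => ?_, ⟨e', he'⟩, (stabInclusion b m).comp e'.toMonoidHom,
    (stabInclusion_injective b m).comp e'.injective, fun s => ?_, he'⟩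
  · rw [hrange]
    exact mem_range_stabIsometry_iff hg hη A
  · rw [MonoidHom.range_comp, MonoidHom.range_eq_top.2 e'.surjective, ← MonoidHom.range_eq_map]
    exact mem_range_stabInclusion
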